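/- Let $d\in\{4,5\}$. Let $p$ be a prime with $p\equiv 1 \pmod 4$, and let $v\in\mathbb{Z}^d$ be a primitive row vector with $p\nmid D=\|v\|^2$. For a commutative ring $R$ let $\mathbb{H}_v(R)=\{g\in \mathrm{SO}_d(R): vg=v\}$, and put $H_{v,p}=\mathbb{H}_v(\mathbb{Q}_p)$ and $H_{v,S}=\mathbb{H}_v(\mathbb{R})\times\mathbb{H}_v(\mathbb{Q}_p)$. Let $$\Gamma_4=\{\gamma\in \mathrm{SO}_d(\mathbb{Z}[\tfrac1p]) : \gamma\equiv 1 \bmod 4\,\mathbb{Z}[\tfrac1p]\},$$ embedded diagonally in $\mathrm{SL}_d(\mathbb{R})\times \mathrm{SL}_d(\mathbb{Q}_p)$, and write $\|\cdot\|_\infty$, $\|\cdot\|_p$ for the maximum norms of the entries of a matrix over $\mathbb{R}$, $\mathbb{Q}_p$. Choose $k_v\in \mathrm{SO}_d(\mathbb{R})$ with $vk_v=\sqrt{D}\,e_d$, and fix an open neighbourhood $\Theta_\infty$ of the identity in $\mathrm{SO}_d(\mathbb{R})$. Let $V_4$ be the volume of the orbit $\Gamma_4H_{v,S}k_v=\Gamma_4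 k_v H$ with acting group $H=k_v^{-1}H_{v,S}k_v$, that is, $V_4=m_H(\Theta_\infty\times \mathrm{SO}_d(\mathbb{Z}_p))^{-1}$, where $m_H$ is the Haar measure on $H$ for which $(H\cap k_v^{-1}\Gamma_4k_v)\backslash H$ has measure $1$. For a symmetric matrix $A$ let $\mathrm{SO}_A=\{h\in \mathrm{SL}_{d-1}: hAh^{T}=A\}$. Let $\mathrm{SO}(2,1)$, $\mathrm{SO}_\eta(3,1)$ ($\eta\in\mathbb{Z}_p^\times$ a non-square) and $\mathrm{SO}(2,2)$ be the groups $\mathrm{SO}_A$ for the matrices $A$ of the quadratic forms $2xy+z^2$, $2xy+z^2+\eta w^2$ and $2xy+2zw$, embedded in $\mathrm{SL}_d$ as the matrices $\mathrm{diag}(h,1)$. Two subgroups $L,L'$ of $\mathrm{SL}_d(\mathbb{Q}_p)$ are $\mathbb{Z}_p$-conjugate if $L=hL'h^{-1}$ for some $h\in \mathrm{GL}_d(\mathbb{Z}_p)$, and $L^+$ denotes the subgroup of $L$ generated by its unipotent elements. Then there is a constant $C$, depending only on $d$ and $\Theta_\infty$ (and not on $p$, $v$, $k_v$, $\eta$),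 such that the following hold. 1. If $d=4$ and $H_{v,p}$ is $\mathbb{Z}_p$-conjugate to $\mathrm{SO}(2,1)(\mathbb{Q}_p)$, then there exist $\gamma_1,\gamma_2\in\Gamma_4\cap H_{v,S}$ whose common eigenspace $\{w\in\mathbb{Q}^d: w\gamma_i=w \text{ for all } i\}$ for the eigenvalue $1$ is $\mathbb{Q}v$, with $\|\gamma_i\|_\infty\le C$ and $\|\gamma_i\|_p\le p^4V_4^2$ for $i=1,2$. 2. If $d=5$ and $H_{v,p}$ is $\mathbb{Z}_p$-conjugate to $\mathrm{SO}_\eta(3,1)(\mathbb{Q}_p)$ for some non-square $\eta\in\mathbb{Z}_p^\times$, then there exist $\gamma_1,\gamma_2,\gamma_3\in\Gamma_4\cap H_{v,S}$ (not necessarily distinct) whose common eigenspace for the eigenvalue $1$ is $\mathbb{Q}v$, with $\|\gamma_i\|_\infty\le C$ and $\|\gamma_i\|_p\le p^4V_4^2$ for $i=1,2,3$. 3. If $d=5$ and $H_{v,p}^+$ is $\mathbb{Z}_p$-conjugate to $\mathrm{SO}(2,2)(\mathbb{Q}_p)^+$, then there exists $\gamma\in\Gamma_4\cap H_{v,S}$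 whose eigenspace for the eigenvalue $1$ is $\mathbb{Q}v$, with $\|\gamma\|_\infty\le C$ and $\|\gamma\|_p\le C\,p^2V_4$. -/

import Mathlib

open MeasureTheory Matrix

/-- The special linear group `SL_d(R)`. -/
abbrev SLd (d : ℕ) (R : Type*) [CommRing R] : Type _ := SpecialLinearGroup (Fin d) R

section AlgebraicGroups

variable {d : ℕ} {R : Type*} [CommRing R]

/-- The special orthogonal group of the quadratic form `x ↦ x A xᵀ` on row vectors. -/
def SOForm (A : Matrix (Fin d) (Fin d) R) : Subgroup (SLd d R) where
  carrier := {g | (g : Matrix (Fin d) (Fin d) R) * A * (g : Matrix (Fin d) (Fin d) R)ᵀ = A}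
  one_mem' := by simp
  mul_mem' := by
    intro a b ha hb
    have ha' : a.1 * A * a.1ᵀ = A := ha
    have hb' : b.1 * A * b.1ᵀ = A := hb
    change (a.1 * b.1) * A * (a.1 * b.1)ᵀ = A
    calc (a.1 * b.1) * A * (a.1 * b.1)ᵀ = a.1 * (b.1 * A * b.1ᵀ) * a.1ᵀ := by
          simp only [transpose_mul, Matrix.mul_assoc]
      _ = A := by rw [hb', ha']
  inv_mem' := by
    intro a ha
    have ha' : a.1 * A * a.1ᵀ = A := ha
    have h1 : (a⁻¹).1 * a.1 = 1 := congrArg Subtype.val (inv_mul_cancel a)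
    have h2 : a.1ᵀ * (a⁻¹).1ᵀ = 1 := by rw [← transpose_mul, h1, transpose_one]
    change (a⁻¹).1 * A * (a⁻¹).1ᵀ = A
    calc (a⁻¹).1 * A * (a⁻¹).1ᵀ = (a⁻¹).1 * (a.1 * A * a.1ᵀ) * (a⁻¹).1ᵀ := by rw [ha']
      _ = ((a⁻¹).1 * a.1) * A * (a.1ᵀ * (a⁻¹).1ᵀ) := by simp only [Matrix.mul_assoc]
      _ = A := by rw [h1, h2, Matrix.one_mul, Matrix.mul_one]

variable (d R) in
/-- `SO_d(R)`, the special orthogonal group of the sum of `d` squares. -/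
def SOd : Subgroup (SLd d R) := SOForm (1 : Matrix (Fin d) (Fin d) R)

variable (R) in
/-- `ℍ_v(R) = {g ∈ SO_d(R) : v g = v}` for an integer row vector `v`. -/
def stabSO (v : Fin d → ℤ) : Subgroup (SLd d R) where
  carrier := {g | g ∈ SOd d R ∧
    (fun i => (v i : R)) ᵥ* (g : Matrix (Fin d) (Fin d) R) = fun i => (v i : R)}
  one_mem' := ⟨one_mem _, by simp⟩
  mul_mem' := by
    rintro a b ⟨ha, ha'⟩ ⟨hb, hb'⟩
    refine ⟨mul_mem ha hb, ?_⟩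
    change _ ᵥ* (a.1 * b.1) = _
    rw [← vecMul_vecMul, ha', hb']
  inv_mem' := by
    rintro a ⟨ha, ha'⟩
    refine ⟨inv_mem ha, ?_⟩
    have h1 : a.1 * (a⁻¹).1 = 1 := congrArg Subtype.val (mul_inv_cancel a)
    conv_lhs => rw [← ha']
    rw [vecMul_vecMul, h1, vecMul_one]

/-- `H⁺`, the subgroup generated by the unipotent elements of `H`. -/
def plusSubgroup (H : Subgroup (SLd d R)) : Subgroup (SLd d R) :=
  Subgroup.closure {u | u ∈ H ∧ IsNilpotent ((u : Matrix (Fin d) (Fin d) R) - 1)}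

/-- The embedding `SL_n → SL_{n+1}`, sending `h` to the block matrix with diagonal blocks
`h` and `1`. -/
def blockEmbed (n : ℕ) (R : Type*) [CommRing R] : SLd n R →* SLd (n + 1) R where
  toFun h := ⟨reindex finSumFinEquiv finSumFinEquiv
      (fromBlocks h.1 0 0 (1 : Matrix (Fin 1) (Fin 1) R)), by
    rw [det_reindex_self, det_fromBlocks_zero₂₁, h.2, det_one, one_mul]⟩
  map_one' := by
    apply Subtype.ext
    change reindex finSumFinEquiv finSumFinEquiv
      (fromBlocks (1 : Matrix (Fin n) (Fin n) R) 0 0 (1 : Matrix (Fin 1) (Fin 1) R)) = 1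
    rw [fromBlocks_one, reindex_apply, submatrix_one_equiv]
  map_mul' a b := by
    apply Subtype.ext
    change reindex finSumFinEquiv finSumFinEquiv
        (fromBlocks (a.1 * b.1) 0 0 (1 : Matrix (Fin 1) (Fin 1) R)) =
      reindex finSumFinEquiv finSumFinEquiv
        (fromBlocks a.1 0 0 (1 : Matrix (Fin 1) (Fin 1) R)) *
      reindex finSumFinEquiv finSumFinEquiv
        (fromBlocks b.1 0 0 (1 : Matrix (Fin 1) (Fin 1) R))
    rw [reindex_apply, reindex_apply, reindex_apply, submatrix_mul_equiv, fromBlocks_multiply]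
    simp

variable (R) in
/-- The symmetric matrix of the ternary form `2xy + z²`. -/
def form21 : Matrix (Fin 3) (Fin 3) R := !![0, 1, 0; 1, 0, 0; 0, 0, 1]

/-- The symmetric matrix of the quaternary form `2xy + z² + ηw²`. -/
def form31 (η : R) : Matrix (Fin 4) (Fin 4) R :=
  !![0, 1, 0, 0; 1, 0, 0, 0; 0, 0, 1, 0; 0, 0, 0, η]

variable (R) in
/-- The symmetric matrix of the quaternary form `2xy + 2zw`. -/
def form22 : Matrix (Fin 4) (Fin 4) R :=
  !![0, 1, 0, 0; 1, 0, 0, 0; 0, 0, 0, 1; 0, 0, 1, 0]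

end AlgebraicGroups

/-- Two subgroups of `SL_d(ℚ_p)` are `ℤ_p`-conjugate: `H = h H' h⁻¹` for some `h ∈ GL_d(ℤ_p)`. -/
def IsZpConj {p : ℕ} [Fact p.Prime] {d : ℕ} (H H' : Subgroup (SLd d ℚ_[p])) : Prop :=
  ∃ h : GL (Fin d) ℤ_[p], ∀ g : SLd d ℚ_[p], g ∈ H ↔
    ∃ g' ∈ H', (g : Matrix (Fin d) (Fin d) ℚ_[p])
      = (h : Matrix (Fin d) (Fin d) ℤ_[p]).map PadicInt.Coe.ringHom
        * (g' : Matrix (Fin d) (Fin d) ℚ_[p])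
        * ((h⁻¹ : GL (Fin d) ℤ_[p]) : Matrix (Fin d) (Fin d) ℤ_[p]).map PadicInt.Coe.ringHom

/-- The maximum norm of a matrix. -/
noncomputable def maxNorm {d : ℕ} {K : Type*} [Norm K] (A : Matrix (Fin d) (Fin d) K) : ℝ :=
  ⨆ i, ⨆ j, ‖A i j‖

/-- The ring `ℤ[1/p]`, as a subring of `ℚ`. -/
def ZInv (p : ℕ) : Subring ℚ := Subring.closure {(p : ℚ)⁻¹}

/-- `Γ₄`, the matrices in `SO_d(ℤ[1/p])` that are trivial modulo `4 ℤ[1/p]`. -/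
def Gamma4 (p d : ℕ) : Subgroup (SLd d (ZInv p)) :=
  SOd d (ZInv p) ⊓
    (SpecialLinearGroup.map (n := Fin d)
      (Ideal.Quotient.mk (Ideal.span {(4 : ZInv p)}))).ker

section SArithmetic

variable (p : ℕ) [Fact p.Prime] (d : ℕ)

/-- `SL_d(ℚ_S) = SL_d(ℝ) × SL_d(ℚ_p)`. -/
abbrev SLS : Type := SLd d ℝ × SLd d ℚ_[p]

/-- The diagonal embedding of `SL_d(ℤ[1/p])` in `SL_d(ℝ) × SL_d(ℚ_p)`. -/
noncomputable def diagEmbed : SLd d (ZInv p) →* SLS p d :=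
  (SpecialLinearGroup.map ((Rat.castHom ℝ).comp (ZInv p).subtype)).prod
    (SpecialLinearGroup.map ((Rat.castHom ℚ_[p]).comp (ZInv p).subtype))

variable {d}

/-- `H_{v,S} = ℍ_v(ℝ) × ℍ_v(ℚ_p)`. -/
noncomputable def HvS (v : Fin d → ℤ) : Subgroup (SLS p d) := (stabSO ℝ v).prod (stabSO ℚ_[p] v)

end SArithmetic

section Volume

variable {G : Type*} [Group G]

/-- `Hᵍ = g⁻¹ H g`. -/
def conjBy (H : Subgroup G) (g : G) : Subgroup G := H.map (MulAut.conj g⁻¹).toMonoidHom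

variable [TopologicalSpace G] [IsTopologicalGroup G]

/-- The volume, relative to the set `Θ`, of the orbit `Γ g H` in `Γ \ G` of the acting group `H`.
The stabilizer of `Γ g` in `H` is `H ∩ Γᵍ`; the Haar measure `m_H` of `H` is scaled so that a
fundamental domain for `(H ∩ Γᵍ) \ H` has measure one, that is, so that `m_H` is compatible with
the invariant probability measure on the orbit; the volume is `m_H(Θ)⁻¹`. -/
noncomputable def orbitVolume (Γ : Subgroup G) (g : G) (H : Subgroup G) [LocallyCompactSpace H]
    (Θ : Set G) : ℝ :=
  letI : MeasurableSpace H := borel H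
  haveI : BorelSpace H := ⟨rfl⟩
  let μ : Measure H := Measure.haar
  let mH : Measure H := (covolume ((conjBy Γ g).subgroupOf H) H μ)⁻¹ • μ
  ((mH (((↑) : H → G) ⁻¹' Θ))⁻¹).toReal

end Volume

section TopologicalFacts

theorem isClosed_SOd (d : ℕ) (K : Type*) [CommRing K] [TopologicalSpace K] [IsTopologicalRing K]
    [T2Space K] : IsClosed (SOd d K : Set (SLd d K)) := by
  have hc : Continuous fun g : SLd d K => (g : Matrix (Fin d) (Fin d) K) := continuous_subtype_val
  exact isClosed_eq ((hc.mul continuous_const).mul hc.matrix_transpose) continuous_const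

theorem isClosed_stabSO {d : ℕ} (K : Type*) [CommRing K] [TopologicalSpace K]
    [IsTopologicalRing K] [T2Space K] (v : Fin d → ℤ) :
    IsClosed (stabSO K v : Set (SLd d K)) := by
  have hc : Continuous fun g : SLd d K => (g : Matrix (Fin d) (Fin d) K) := continuous_subtype_val
  exact (isClosed_SOd d K).inter
    (isClosed_eq (continuous_const.matrix_vecMul hc) continuous_const)

theorem isClosed_conjBy {G : Type*} [Group G] [TopologicalSpace G] [IsTopologicalGroup G]
    (H : Subgroup G) (hH : IsClosed (H : Set G)) (g : G) : IsClosed (conjBy H g : Set G) := by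
  have h : (conjBy H g : Set G) = (fun x => g * x * g⁻¹) ⁻¹' (H : Set G) := by
    ext x
    simp only [conjBy, Subgroup.coe_map, Set.mem_image, Set.mem_preimage, SetLike.mem_coe,
      MulEquiv.coe_toMonoidHom, MulAut.conj_apply, inv_inv]
    constructor
    · rintro ⟨y, hy, rfl⟩
      simpa [mul_assoc] using hy
    · intro hx
      exact ⟨_, hx, by group⟩
  rw [h]
  exact hH.preimage (by fun_prop)

instance locallyCompactSpace_SLd (d : ℕ) (K : Type*) [CommRing K] [TopologicalSpace K]
    [IsTopologicalRing K] [T2Space K] [LocallyCompactSpace K] : LocallyCompactSpace (SLd d K) :=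
  haveI : LocallyCompactSpace (Matrix (Fin d) (Fin d) K) :=
    inferInstanceAs (LocallyCompactSpace (Fin d → Fin d → K))
  SpecialLinearGroup.isClosedEmbedding_val.locallyCompactSpace

instance locallyCompactSpace_conjBy_HvS (p : ℕ) [Fact p.Prime] {d : ℕ} (v : Fin d → ℤ)
    (g : SLS p d) : LocallyCompactSpace (conjBy (HvS p v) g) := by
  have h : IsClosed (HvS p v : Set (SLS p d)) := by
    rw [HvS, Subgroup.coe_prod]
    exact (isClosed_stabSO ℝ v).prod (isClosed_stabSO ℚ_[p] v)
  exact (isClosed_conjBy _ h g).isClosedEmbedding_subtypeVal.locallyCompactSpace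

end TopologicalFacts

section Orbit

variable (p : ℕ) [Fact p.Prime] {d : ℕ}

/-- `Θ = Θ_∞ × SO_d(ℤ_p)`, for a subset `Θ_∞` of `SO_d(ℝ)`. -/
def thetaSet (Θ : Set (SOd d ℝ)) : Set (SLS p d) :=
  (((↑) : SOd d ℝ → SLd d ℝ) '' Θ) ×ˢ
    (SpecialLinearGroup.map (PadicInt.Coe.ringHom (p := p)) '' (SOd d ℤ_[p] : Set (SLd d ℤ_[p])))

/-- `V₄`, the volume of the orbit `Γ₄ H_{v,S} k = Γ₄ k H_{v,S}ᵏ`, whose acting group is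
`H_{v,S}ᵏ`; here `k ∈ SL_d(ℝ)` is placed at the real coordinate. -/
noncomputable def V4 (v : Fin d → ℤ) (k : SLd d ℝ) (Θ : Set (SOd d ℝ)) : ℝ :=
  orbitVolume ((Gamma4 p d).map (diagEmbed p d)) ((k, 1) : SLS p d)
    (conjBy (HvS p v) (k, 1)) (thetaSet p Θ)

/-- The standing assumptions on `p`, `v` and `k = k_v` in dimension `n + 1`. -/
structure Admissible {n : ℕ} (v : Fin (n + 1) → ℤ) (k : SLd (n + 1) ℝ) : Prop where
  p_mod : p % 4 = 1
  primitive : Finset.univ.gcd v = 1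
  not_dvd : ¬ (p : ℤ) ∣ v ⬝ᵥ v
  k_mem : k ∈ SOd (n + 1) ℝ
  v_k : (fun i => (v i : ℝ)) ᵥ* (k : Matrix (Fin (n + 1)) (Fin (n + 1)) ℝ)
    = Pi.single (Fin.last n) (√((v ⬝ᵥ v : ℤ) : ℝ))

/-- The space of rational row vectors that are fixed by `γ`. -/
def fixedSpace (γ : SLd d (ZInv p)) : Submodule ℚ (Fin d → ℚ) :=
  Module.End.eigenspace
    (vecMulLinear ((γ : Matrix (Fin d) (Fin d) (ZInv p)).map (ZInv p).subtype)) 1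

/-- The line spanned by the integer vector `v`. -/
def lineOf (v : Fin d → ℤ) : Submodule ℚ (Fin d → ℚ) := Submodule.span ℚ {fun i => (v i : ℚ)}

end Orbit

/-! ### Integrality and divisibility in `ℤ[1/p]` -/

section ZInvArithmetic

/-! The elements of `Γ₄` come from a pigeonhole argument on the orbit. In the acting group `H` let
`K` be the subgroup of elements with integral `p`-adic component; it is open, and it is compact
because real orthogonal matrices are bounded. The stabilizer `Λ` of the base point acts freely on `H
/ K`. Indeed, if a conjugate of `γ ∈ Γ₄` is `p`-integral, then so is `tr γ²`; writing `γ² = 1 + 8Z`,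
orthogonality gives `d - tr γ² = 32 ∑ Z_ij²`, an integral multiple of 32 between `0` and `2d < 32`.
So `γ² = 1`, and the congruence modulo 4 yields `γ = 1` (`ratMat_eq_one_of_trace`). Reduction theory
shows that `Λ \ H / K` is finite (`exists_finite_classes`), so the covolume is the number of double
cosets times the measure of `K`. As `Θ ∩ H ⊆ K`, this number is at most `V₄` (`card_le_V4`). Hence
any family of more than `V₄` elements of `ℍ_v(ℚ_p)` contains two, `g` and `g'`, joined by some `γ ∈
Γ₄ ∩ ℍ_v` with `g⁻¹ γ g'` integral (`exists_collision`). The `p`-adic size of `γ` is bounded by the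
sizes of `g` and `g'⁻¹`; its real entries are at most 1, so `C = 1` works.

The families are chosen so that `γ` cannot fix too much. In the first two cases, `ℤ_p`-conjugacy
provides an integral hyperbolic pair `e, f` orthogonal to `v` and complementary vectors `y` of unit
norm (`exists_isHyperbolicFrame`). The family is `u(c) a(s)`, with `u(c)` the Eichler transvection
of `e` and `c y`, and `a(s)` the torus element `e ↦ s⁻¹ e`, `f ↦ s f`. For a given `w ∉ ℚv`, the
parameters `c` stay in a residue class modulo `p` in which the projection of `w` keeps a unit
`e`-coordinate under `u(c)`. If `γ` fixed `w`, then `k = g⁻¹ γ g'` would preserve the line of `e`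
modulo `s`, so `a(s) k a(s)⁻¹` and with it `γ` would be integral (`normLe_of_fixes`), whence `γ =
1`. But then the two parameters would agree modulo `s`, hence be equal. So every `w ∉ ℚv` is moved
by a small `γ`. A nontrivial `γ` fixes a space of codimension at least 2, and each further choice
lowers the dimension, so `d - 2` elements cut out `ℚv`.

In the split case the quaternary space is the space of `2 × 2` matrices with the determinant form,
and the family consists of left multiplications. These commute with right multiplications, which
integral isometries normalize integrally. If `γ` fixes a vector outside `ℚv`, it fixes an
anisotropic vector `x` orthogonal to `v`. In the basis formed by `x` and its images under right
multiplications, `γ` acts by an integral matrix, so `tr γ²` is integral and `γ = 1`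
(`norm_trace_mul_self_le`), again a contradiction. One element therefore suffices. Translates of
size `|z|⁻¹` are separated modulo `z²`, which is why only the first power of `V₄` appears. -/

theorem mem_ZInv_iff {p : ℕ} (hp : p ≠ 0) {q : ℚ} :
    q ∈ ZInv p ↔ ∃ (n : ℕ) (a : ℤ), q * (p : ℚ) ^ n = a := by
  have hp' : (p : ℚ) ≠ 0 := by exact_mod_cast hp
  constructor
  · intro h
    induction h using Subring.closure_induction with
    | mem x hx => exact ⟨1, 1, by rw [Set.mem_singleton_iff.1 hx]; simp [hp']⟩
    | zero => exact ⟨0, 0, by simp⟩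
    | one => exact ⟨0, 1, by simp⟩
    | add x y _ _ hx hy =>
      obtain ⟨n, a, hn⟩ := hx
      obtain ⟨m, b, hm⟩ := hy
      exact ⟨n + m, a * p ^ m + b * p ^ n, by push_cast; rw [← hn, ← hm]; ring⟩
    | neg x _ hx =>
      obtain ⟨n, a, hn⟩ := hx
      exact ⟨n, -a, by push_cast; rw [← hn]; ring⟩
    | mul x y _ _ hx hy =>
      obtain ⟨n, a, hn⟩ := hx
      obtain ⟨m, b, hm⟩ := hy
      exact ⟨n + m, a * b, by push_cast; rw [← hn, ← hm]; ring⟩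
  · rintro ⟨n, a, h⟩
    have hq : q = a * ((p : ℚ)⁻¹) ^ n := by
      rw [← h, mul_assoc, ← mul_pow, mul_inv_cancel₀ hp', one_pow, mul_one]
    rw [hq]
    have h1 : (p : ℚ)⁻¹ ∈ ZInv p := Subring.subset_closure rfl
    have h2 : ((a : ℤ) : ℚ) ∈ ZInv p := intCast_mem (ZInv p) a
    exact Subring.mul_mem _ h2 (Subring.pow_mem _ h1 n)

theorem intCast_mem_ZInv (p : ℕ) (a : ℤ) : (a : ℚ) ∈ ZInv p := intCast_mem (ZInv p) a

theorem natCast_mem_ZInv (p a : ℕ) : (a : ℚ) ∈ ZInv p := natCast_mem (ZInv p) a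

theorem inv_pow_mem_ZInv (p n : ℕ) : ((p : ℚ) ^ n)⁻¹ ∈ ZInv p := by
  have h1 : (p : ℚ)⁻¹ ∈ ZInv p := Subring.subset_closure rfl
  rw [← inv_pow]
  exact Subring.pow_mem _ h1 n

theorem eq_intCast_of_mem_ZInv {p : ℕ} [hp : Fact p.Prime] {q : ℚ} (hq : q ∈ ZInv p)
    (hn : ‖(q : ℚ_[p])‖ ≤ 1) : ∃ a : ℤ, q = a := by
  obtain ⟨n, a, h⟩ := (mem_ZInv_iff hp.out.ne_zero).1 hq
  have hp0 : (p : ℚ) ≠ 0 := by exact_mod_cast hp.out.ne_zero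
  have h1 : ‖(a : ℚ_[p])‖ ≤ (p : ℝ) ^ (-n : ℤ) := by
    have h2 : (a : ℚ_[p]) = (q : ℚ_[p]) * (p : ℚ_[p]) ^ n := by exact_mod_cast h.symm
    rw [h2, norm_mul, Padic.norm_p_pow]
    exact mul_le_of_le_one_left (by positivity) hn
  rw [Padic.norm_int_le_pow_iff_dvd] at h1
  obtain ⟨b, hb⟩ := h1
  refine ⟨b, ?_⟩
  rw [hb] at h
  push_cast at h
  exact mul_right_cancel₀ (pow_ne_zero n hp0) (by rw [h, mul_comm])

theorem dvd_of_eq_mul_ZInv {p : ℕ} [hp : Fact p.Prime] {m a : ℤ} (hm : IsCoprime m (p : ℤ))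
    {q : ℚ} (hq : q ∈ ZInv p) (h : (a : ℚ) = m * q) : m ∣ a := by
  obtain ⟨n, b, hb⟩ := (mem_ZInv_iff hp.out.ne_zero).1 hq
  have : a * (p : ℤ) ^ n = m * b := by
    have : (a : ℚ) * p ^ n = m * b := by rw [h, ← hb]; ring
    exact_mod_cast this
  exact (hm.pow_right (n := n)).dvd_of_dvd_mul_right ⟨b, this⟩

/-- For odd `p` the powers of 2 remain non-units in `ℤ[1/p]`; they all divide the integer obtained
by clearing the `p`-power denominator. -/
theorem eq_zero_of_forall_two_pow {p : ℕ} [hp : Fact p.Prime] (hodd : Odd p) {q : ℚ}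
    (h : ∀ k : ℕ, ∃ r ∈ ZInv p, q = 2 ^ k * r) : q = 0 := by
  obtain ⟨r, hr, hqr⟩ := h 0
  obtain ⟨n, b, hb⟩ := (mem_ZInv_iff hp.out.ne_zero).1 hr
  have hp0 : (p : ℚ) ≠ 0 := by exact_mod_cast hp.out.ne_zero
  have hqb : q * (p : ℚ) ^ n = b := by rw [hqr, ← hb]; ring
  have hcop : ∀ k : ℕ, IsCoprime ((2 : ℤ) ^ k) (p : ℤ) := fun k => by
    have : Nat.Coprime 2 p := (Nat.coprime_two_left).2 hodd
    exact (Nat.isCoprime_iff_coprime.2 this).pow_left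
  have hall : ∀ k : ℕ, (2 : ℤ) ^ k ∣ b := fun k => by
    obtain ⟨s, hs, hqs⟩ := h k
    refine dvd_of_eq_mul_ZInv (hcop k) (q := s * (p : ℚ) ^ n)
      (Subring.mul_mem _ hs (Subring.pow_mem _ (natCast_mem (ZInv p) p) n)) ?_
    rw [← hqb, hqs]; push_cast; ring
  -- The exponent `|b|` already suffices, since `|b| < 2 ^ |b|`.
  have hb0 : b = 0 := by
    refine Int.eq_zero_of_abs_lt_dvd (hall b.natAbs) ?_
    rw [Int.abs_eq_natAbs]
    exact_mod_cast Nat.lt_two_pow_self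
  rw [hb0, Int.cast_zero] at hqb
  exact (mul_eq_zero.1 hqb).resolve_right (pow_ne_zero n hp0)

end ZInvArithmetic

/-! ### Entrywise `p`-adic bounds for matrices -/

section NormBounds

variable {p : ℕ} [Fact p.Prime] {l m n : Type*}

/-- All entries of the matrix have `p`-adic norm at most `c`. -/
def NormLe (c : ℝ) (A : Matrix m n ℚ_[p]) : Prop := ∀ i j, ‖A i j‖ ≤ c

theorem Padic.norm_sum_le_of_forall {ι : Type*} {s : Finset ι} {f : ι → ℚ_[p]} {c : ℝ}
    (hc : 0 ≤ c) (h : ∀ i ∈ s, ‖f i‖ ≤ c) : ‖∑ i ∈ s, f i‖ ≤ c :=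
  IsUltrametricDist.norm_sum_le_of_forall_le_of_nonneg hc h

theorem Padic.norm_add_le_of_le {x y : ℚ_[p]} {c : ℝ} (hx : ‖x‖ ≤ c) (hy : ‖y‖ ≤ c) :
    ‖x + y‖ ≤ c := (Padic.nonarchimedean x y).trans (max_le hx hy)

theorem Padic.norm_sub_le_of_le {x y : ℚ_[p]} {c : ℝ} (hx : ‖x‖ ≤ c) (hy : ‖y‖ ≤ c) :
    ‖x - y‖ ≤ c := by
  rw [sub_eq_add_neg]
  exact norm_add_le_of_le hx (by rwa [norm_neg])

theorem Padic.norm_dotProduct_le [Fintype m] {x y : m → ℚ_[p]} {a b : ℝ} (ha : 0 ≤ a)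
    (hb : 0 ≤ b) (hx : ∀ i, ‖x i‖ ≤ a) (hy : ∀ i, ‖y i‖ ≤ b) : ‖x ⬝ᵥ y‖ ≤ a * b :=
  norm_sum_le_of_forall (mul_nonneg ha hb) fun i _ => by
    rw [norm_mul]
    exact mul_le_mul (hx i) (hy i) (norm_nonneg _) ha

theorem NormLe.mul [Fintype m] {a b : ℝ} (ha : 0 ≤ a) (hb : 0 ≤ b) {A : Matrix l m ℚ_[p]}
    {B : Matrix m n ℚ_[p]} (hA : NormLe a A) (hB : NormLe b B) : NormLe (a * b) (A * B) :=
  fun i j => Padic.norm_dotProduct_le ha hb (fun k => hA i k) (fun k => hB k j)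

theorem NormLe.mul_one [Fintype m] {A : Matrix l m ℚ_[p]}
    {B : Matrix m n ℚ_[p]} (hA : NormLe 1 A) (hB : NormLe 1 B) : NormLe 1 (A * B) := by
  simpa using hA.mul zero_le_one zero_le_one hB

theorem NormLe.vecMul [Fintype m] {a b : ℝ} (ha : 0 ≤ a) (hb : 0 ≤ b) {x : m → ℚ_[p]}
    {B : Matrix m n ℚ_[p]} (hx : ∀ i, ‖x i‖ ≤ a) (hB : NormLe b B) (j : n) :
    ‖(x ᵥ* B) j‖ ≤ a * b :=
  Padic.norm_dotProduct_le ha hb hx (fun k => hB k j)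

theorem NormLe.vecMul_one [Fintype m] {x : m → ℚ_[p]}
    {B : Matrix m n ℚ_[p]} (hx : ∀ i, ‖x i‖ ≤ 1) (hB : NormLe 1 B) (j : n) :
    ‖(x ᵥ* B) j‖ ≤ 1 := by
  simpa using hB.vecMul zero_le_one zero_le_one hx j

theorem NormLe.add {c : ℝ} {A B : Matrix m n ℚ_[p]} (hA : NormLe c A) (hB : NormLe c B) :
    NormLe c (A + B) := fun i j => Padic.norm_add_le_of_le (hA i j) (hB i j)

theorem NormLe.transpose {c : ℝ} {A : Matrix m n ℚ_[p]} (hA : NormLe c A) : NormLe c Aᵀ :=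
  fun i j => hA j i

theorem NormLe.one [DecidableEq m] : NormLe 1 (1 : Matrix m m ℚ_[p]) := fun i j => by
  rw [Matrix.one_apply]; split_ifs <;> simp

theorem NormLe.trace [Fintype m] {c : ℝ} (hc : 0 ≤ c) {A : Matrix m m ℚ_[p]} (hA : NormLe c A) :
    ‖A.trace‖ ≤ c := Padic.norm_sum_le_of_forall hc fun i _ => hA i i

theorem NormLe.mono {c b : ℝ} (h : c ≤ b) {A : Matrix m n ℚ_[p]} (hA : NormLe c A) :
    NormLe b A := fun i j => (hA i j).trans h

theorem NormLe.exists_map_eq {A : Matrix m n ℚ_[p]} (hA : NormLe 1 A) :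
    ∃ B : Matrix m n ℤ_[p], B.map PadicInt.Coe.ringHom = A :=
  ⟨Matrix.of fun i j => ⟨A i j, hA i j⟩, by ext; rfl⟩

theorem NormLe.map_coe (B : Matrix m n ℤ_[p]) : NormLe 1 (B.map PadicInt.Coe.ringHom) :=
  fun i j => (B i j).2

theorem NormLe.det [Fintype m] [DecidableEq m] {A : Matrix m m ℚ_[p]} (hA : NormLe 1 A) :
    ‖A.det‖ ≤ 1 := by
  obtain ⟨B, rfl⟩ := hA.exists_map_eq
  rw [← RingHom.mapMatrix_apply, ← RingHom.map_det]
  exact B.det.2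

theorem exists_normLe [Finite m] [Finite n] (A : Matrix m n ℚ_[p]) :
    ∃ N : ℕ, NormLe ((p : ℝ) ^ N) A := by
  have := Fintype.ofFinite m
  have := Fintype.ofFinite n
  have hp1 : (1 : ℝ) < p := by exact_mod_cast (Fact.out : p.Prime).one_lt
  obtain ⟨N, hN⟩ := pow_unbounded_of_one_lt (∑ i, ∑ j, ‖A i j‖) hp1
  refine ⟨N, fun i j => le_trans ?_ hN.le⟩
  exact (Finset.single_le_sum (f := fun j => ‖A i j‖) (fun _ _ => norm_nonneg _)
    (Finset.mem_univ j)).trans (Finset.single_le_sum (f := fun i => ∑ j, ‖A i j‖)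
      (fun _ _ => Finset.sum_nonneg fun _ _ => norm_nonneg _) (Finset.mem_univ i))

theorem maxNorm_le {d : ℕ} [NeZero d] {K : Type*} [Norm K] {A : Matrix (Fin d) (Fin d) K} {c : ℝ}
    (h : ∀ i j, ‖A i j‖ ≤ c) : maxNorm A ≤ c :=
  ciSup_le fun i => ciSup_le fun j => h i j

end NormBounds

/-! ### Special orthogonal matrices -/

section Orthogonal

variable {d : ℕ} {R : Type*} [CommRing R]

theorem SOd.mul_transpose {g : SLd d R} (hg : g ∈ SOd d R) : g.1 * g.1ᵀ = 1 := by
  have : g.1 * 1 * g.1ᵀ = 1 := hg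
  rwa [Matrix.mul_one] at this

theorem SOd.transpose_mul {g : SLd d R} (hg : g ∈ SOd d R) : g.1ᵀ * g.1 = 1 :=
  mul_eq_one_comm.1 (SOd.mul_transpose hg)

theorem SOd.coe_inv {g : SLd d R} (hg : g ∈ SOd d R) : (g⁻¹).1 = g.1ᵀ := by
  have h1 : (g⁻¹).1 * g.1 = 1 := congrArg Subtype.val (inv_mul_cancel g)
  calc (g⁻¹).1 = (g⁻¹).1 * (g.1 * g.1ᵀ) := by rw [SOd.mul_transpose hg, Matrix.mul_one]
    _ = g.1ᵀ := by rw [← Matrix.mul_assoc, h1, Matrix.one_mul]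

theorem mem_SOd_iff {g : SLd d R} : g ∈ SOd d R ↔ g.1 * g.1ᵀ = 1 := by
  refine ⟨SOd.mul_transpose, fun h => ?_⟩
  change g.1 * 1 * g.1ᵀ = 1
  rwa [Matrix.mul_one]

theorem SOd.vecMul_dotProduct {g : SLd d R} (hg : g ∈ SOd d R) (x y : Fin d → R) :
    (x ᵥ* g.1) ⬝ᵥ (y ᵥ* g.1) = x ⬝ᵥ y := by
  rw [← mulVec_transpose g.1 y, dotProduct_mulVec, vecMul_vecMul, SOd.mul_transpose hg,
    vecMul_one]

theorem SOd.abs_le_one {g : SLd d ℝ} (hg : g ∈ SOd d ℝ) (i j : Fin d) : ‖g.1 i j‖ ≤ 1 := by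
  have h : ∑ k, g.1 i k * g.1 i k = 1 := by
    have := congrFun (congrFun (SOd.mul_transpose hg) i) i
    simpa [Matrix.mul_apply] using this
  have h2 : g.1 i j * g.1 i j ≤ 1 :=
    (Finset.single_le_sum (f := fun k => g.1 i k * g.1 i k)
      (fun k _ => mul_self_nonneg _) (Finset.mem_univ j)).trans h.le
  rw [Real.norm_eq_abs]
  exact abs_le_one_iff_mul_self_le_one.2 h2

end Orthogonal

/-! ### Elements of `Γ₄` as rational matrices, and the rigidity of their traces -/

section RationalMatrices

variable {p d : ℕ}

/-- The rational matrix underlying an element of `SL_d(ℤ[1/p])`. -/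
def ratMat (γ : SLd d (ZInv p)) : Matrix (Fin d) (Fin d) ℚ := γ.1.map (ZInv p).subtype

theorem ratMat_injective : Function.Injective (ratMat (p := p) (d := d)) := fun γ δ h => by
  ext i j
  exact congrFun (congrFun h i) j

theorem ratMat_one : ratMat (1 : SLd d (ZInv p)) = 1 :=
  Matrix.map_one _ rfl rfl

theorem ratMat_det (γ : SLd d (ZInv p)) : (ratMat γ).det = 1 := by
  have := congrArg (ZInv p).subtype γ.2
  rwa [RingHom.map_det, map_one] at this

theorem diagEmbed_fst (p : ℕ) [Fact p.Prime] (γ : SLd d (ZInv p)) :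
    (diagEmbed p d γ).1.1 = (ratMat γ).map (Rat.castHom ℝ) := rfl

theorem diagEmbed_snd (p : ℕ) [Fact p.Prime] (γ : SLd d (ZInv p)) :
    (diagEmbed p d γ).2.1 = (ratMat γ).map (Rat.castHom ℚ_[p]) := rfl

theorem mem_Gamma4_iff {γ : SLd d (ZInv p)} : γ ∈ Gamma4 p d ↔
    ratMat γ * (ratMat γ)ᵀ = 1 ∧ ∃ Y : Matrix (Fin d) (Fin d) ℚ,
      (∀ i j, Y i j ∈ ZInv p) ∧ ratMat γ = 1 + (4 : ℚ) • Y := by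
  have hinj : Function.Injective
      (fun M : Matrix (Fin d) (Fin d) (ZInv p) => M.map (ZInv p).subtype) :=
    Matrix.map_injective Subtype.val_injective
  rw [Gamma4, Subgroup.mem_inf]
  refine and_congr ?_ ?_
  · rw [mem_SOd_iff, ← hinj.eq_iff]
    rw [Matrix.map_mul, Matrix.transpose_map, Matrix.map_one _ rfl rfl]
    rfl
  · rw [MonoidHom.mem_ker]
    constructor
    · intro h
      have h1 : ∀ i j, ∃ y : ZInv p, γ.1 i j - (1 : Matrix (Fin d) (Fin d) (ZInv p)) i j = 4 * y := by
        intro i j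
        have h2 := congrFun (congrFun (congrArg Subtype.val h) i) j
        have h3 : Ideal.Quotient.mk (Ideal.span {(4 : ZInv p)}) (γ.1 i j) =
            Ideal.Quotient.mk (Ideal.span {(4 : ZInv p)})
              ((1 : Matrix (Fin d) (Fin d) (ZInv p)) i j) := by
          refine Eq.trans h2 ?_
          change (1 : Matrix (Fin d) (Fin d) _) i j = _
          rw [Matrix.one_apply, Matrix.one_apply]
          split_ifs <;> simp
        rw [Ideal.Quotient.eq, Ideal.mem_span_singleton] at h3
        exact h3
      choose y hy using h1
      refine ⟨Matrix.of fun i j => (y i j : ℚ), fun i j => (y i j).2, ?_⟩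
      ext i j
      have h4 := congrArg (ZInv p).subtype (hy i j)
      rw [map_sub, map_mul] at h4
      have h5 : (ZInv p).subtype ((1 : Matrix (Fin d) (Fin d) (ZInv p)) i j) =
          (1 : Matrix (Fin d) (Fin d) ℚ) i j := by
        rw [Matrix.one_apply, Matrix.one_apply]
        split_ifs <;> simp
      rw [h5] at h4
      have h6 : ratMat γ i j = (ZInv p).subtype (γ.1 i j) := rfl
      have h7 : (ZInv p).subtype 4 = (4 : ℚ) := map_ofNat _ 4
      rw [Matrix.add_apply, Matrix.smul_apply, Matrix.of_apply, smul_eq_mul, h6, ← h7]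
      exact sub_eq_iff_eq_add'.1 h4
    · rintro ⟨Y, hY, h⟩
      ext i j
      change Ideal.Quotient.mk (Ideal.span {(4 : ZInv p)}) (γ.1 i j) =
        (1 : Matrix (Fin d) (Fin d) _) i j
      have h1 : Ideal.Quotient.mk (Ideal.span {(4 : ZInv p)}) (γ.1 i j) =
          Ideal.Quotient.mk (Ideal.span {(4 : ZInv p)})
            ((1 : Matrix (Fin d) (Fin d) (ZInv p)) i j) := by
        rw [Ideal.Quotient.eq, Ideal.mem_span_singleton]
        refine ⟨⟨Y i j, hY i j⟩, ?_⟩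
        apply Subtype.ext
        have h2 := congrFun (congrFun h i) j
        rw [Matrix.add_apply, Matrix.smul_apply, smul_eq_mul] at h2
        have h5 : (ZInv p).subtype ((1 : Matrix (Fin d) (Fin d) (ZInv p)) i j) =
            (1 : Matrix (Fin d) (Fin d) ℚ) i j := by
          rw [Matrix.one_apply, Matrix.one_apply]
          split_ifs <;> simp
        have h7 : (ZInv p).subtype 4 = (4 : ℚ) := map_ofNat _ 4
        change (ZInv p).subtype (γ.1 i j) - (ZInv p).subtype
          ((1 : Matrix (Fin d) (Fin d) (ZInv p)) i j) = (ZInv p).subtype 4 * Y i j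
        rw [h5, h7]
        exact sub_eq_iff_eq_add'.2 h2
      rw [h1, Matrix.one_apply, Matrix.one_apply]
      split_ifs <;> simp

theorem exists_SLd_ratMat_eq {A : Matrix (Fin d) (Fin d) ℚ} (hA : ∀ i j, A i j ∈ ZInv p)
    (hdet : A.det = 1) : ∃ γ : SLd d (ZInv p), ratMat γ = A := by
  refine ⟨⟨Matrix.of fun i j => ⟨A i j, hA i j⟩, ?_⟩, by ext; rfl⟩
  apply Subtype.val_injective
  change (ZInv p).subtype _ = (1 : ℚ)
  rw [RingHom.map_det]
  exact hdet

theorem ZInv_mul_mem {l m n : Type*} [Fintype m] {A : Matrix l m ℚ} {B : Matrix m n ℚ}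
    (hA : ∀ i j, A i j ∈ ZInv p) (hB : ∀ i j, B i j ∈ ZInv p) (i : l) (j : n) :
    (A * B) i j ∈ ZInv p :=
  Subring.sum_mem _ fun k _ => Subring.mul_mem _ (hA i k) (hB k j)

/-- Expansion of `tr ((A - 1)(A - 1)ᵀ)`. Through the positivity of sums of rational squares, it lets
the trace detect the identity. -/
theorem trace_sub_one_mul_transpose {A : Matrix (Fin d) (Fin d) ℚ} (hA : A * Aᵀ = 1) :
    ∑ i, ∑ j, (A - 1) i j ^ 2 = 2 * (d - A.trace) := by
  have h1 : ((A - 1) * (A - 1)ᵀ).trace = 2 * (d - A.trace) := by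
    rw [transpose_sub, transpose_one, Matrix.sub_mul, Matrix.mul_sub, Matrix.mul_sub, hA]
    simp only [Matrix.mul_one, Matrix.one_mul, trace_sub, trace_one, Fintype.card_fin,
      trace_transpose]
    ring
  rw [← h1]
  simp only [Matrix.trace, Matrix.diag, Matrix.mul_apply, transpose_apply, sq]

theorem neg_le_trace {A : Matrix (Fin d) (Fin d) ℚ} (hA : A * Aᵀ = 1) : -(d : ℚ) ≤ A.trace := by
  have h : ∀ i, -1 ≤ A i i := fun i => by
    have h1 : ∑ k, A i k * A i k = 1 := by
      have := congrFun (congrFun hA i) i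
      simpa [Matrix.mul_apply] using this
    have h2 : A i i * A i i ≤ 1 :=
      (Finset.single_le_sum (f := fun k => A i k * A i k)
        (fun k _ => mul_self_nonneg _) (Finset.mem_univ i)).trans h1.le
    exact (abs_le.1 (abs_le_one_iff_mul_self_le_one.2 h2)).1
  calc -(d : ℚ) = ∑ _i : Fin d, (-1 : ℚ) := by simp
    _ ≤ A.trace := Finset.sum_le_sum fun i _ => h i

/-- Elements of `Γ₄` with `p`-integral `tr γ²` are trivial. -/
theorem ratMat_eq_one_of_trace [hp : Fact p.Prime] (hodd : Odd p) (hd : d < 16)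
    {G : Matrix (Fin d) (Fin d) ℚ} (hG : G * Gᵀ = 1) {Y : Matrix (Fin d) (Fin d) ℚ}
    (hY : ∀ i j, Y i j ∈ ZInv p) (hGY : G = 1 + (4 : ℚ) • Y)
    (htr : ‖(((G * G).trace : ℚ) : ℚ_[p])‖ ≤ 1) : G = 1 := by
  -- Squaring raises the congruence level: `(1 + 4Y)² = 1 + 8(Y + 2Y²)`. The defect of the trace
  -- becomes a multiple of 32, which beats its bound `2d`; for `G` itself the factor would only be
  -- 8.
  set Z : Matrix (Fin d) (Fin d) ℚ := Y + (2 : ℚ) • (Y * Y) with hZdef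
  have hZ : ∀ i j, Z i j ∈ ZInv p := fun i j =>
    Subring.add_mem _ (hY i j) (Subring.mul_mem _ (intCast_mem_ZInv p 2) (ZInv_mul_mem hY hY i j))
  have hWZ : G * G = 1 + (8 : ℚ) • Z := by
    rw [hGY, hZdef]
    simp only [Matrix.add_mul, Matrix.mul_add, Matrix.one_mul, Matrix.mul_one, smul_add, smul_smul,
      Matrix.smul_mul, Matrix.mul_smul]
    module
  have hWW : (G * G) * (G * G)ᵀ = 1 := by
    rw [transpose_mul, Matrix.mul_assoc, ← Matrix.mul_assoc G Gᵀ, hG, Matrix.one_mul, hG]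
  have hq : (d : ℚ) - (G * G).trace = 32 * ∑ i, ∑ j, Z i j ^ 2 := by
    have h1 := trace_sub_one_mul_transpose hWW
    have h2 : ∀ i j, (G * G - 1) i j = 8 * Z i j := fun i j => by
      rw [hWZ, add_sub_cancel_left, Matrix.smul_apply, smul_eq_mul]
    simp only [h2, mul_pow, ← Finset.mul_sum] at h1
    linarith
  have hqm : ∑ i, ∑ j, Z i j ^ 2 ∈ ZInv p :=
    Subring.sum_mem _ fun i _ => Subring.sum_mem _ fun j _ => Subring.pow_mem _ (hZ i j) 2
  have hq0 : 0 ≤ ∑ i, ∑ j, Z i j ^ 2 :=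
    Finset.sum_nonneg fun i _ => Finset.sum_nonneg fun j _ => sq_nonneg _
  obtain ⟨a, ha⟩ : ∃ a : ℤ, (d : ℚ) - (G * G).trace = a := by
    refine eq_intCast_of_mem_ZInv (p := p) ?_ ?_
    · rw [hq]
      exact Subring.mul_mem _ (intCast_mem_ZInv p 32) hqm
    · push_cast
      exact Padic.norm_sub_le_of_le (by exact_mod_cast Padic.norm_int_le_one (p := p) (d : ℤ)) htr
  have hdvd : (32 : ℤ) ∣ a := by
    refine dvd_of_eq_mul_ZInv (p := p) ?_ hqm (by rw [← ha, hq]; norm_num)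
    have : IsCoprime ((2 : ℤ) ^ 5) (p : ℤ) :=
      IsCoprime.pow_left (Nat.isCoprime_iff_coprime.2 ((Nat.coprime_two_left).2 hodd))
    simpa using this
  have ha0 : a = 0 := by
    have h1 : (0 : ℚ) ≤ a := by rw [← ha, hq]; positivity
    have h2 : (a : ℚ) < 32 := by
      rw [← ha]
      have := neg_le_trace hWW
      have hd' : (d : ℚ) < 16 := by exact_mod_cast hd
      linarith
    have h1' : 0 ≤ a := by exact_mod_cast h1
    have h2' : a < 32 := by exact_mod_cast h2
    omega
  have hsum : ∑ i, ∑ j, Z i j ^ 2 = 0 := by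
    rw [ha, ha0] at hq
    simpa using hq.symm
  have hZ0 : Z = 0 := by
    ext i j
    have h1 := (Finset.sum_eq_zero_iff_of_nonneg
      (fun i _ => Finset.sum_nonneg fun j _ => sq_nonneg (Z i j))).1 hsum i (Finset.mem_univ i)
    have h2 := (Finset.sum_eq_zero_iff_of_nonneg (fun j _ => sq_nonneg (Z i j))).1 h1 j
      (Finset.mem_univ j)
    simpa using h2
  -- Now `G² = 1`, that is `Y = -2Y²`. Iterating this makes `Y` divisible by every power of 2.
  have hYY : Y = (-2 : ℚ) • (Y * Y) := by
    have : Y + (2 : ℚ) • (Y * Y) = 0 := hZ0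
    rw [neg_smul]
    exact eq_neg_of_add_eq_zero_left this
  have hdiv : ∀ k : ℕ, ∃ V : Matrix (Fin d) (Fin d) ℚ, (∀ i j, V i j ∈ ZInv p) ∧
      Y = (2 ^ k : ℚ) • V := by
    intro k
    induction k with
    | zero => exact ⟨Y, hY, by simp⟩
    | succ k ih =>
      obtain ⟨V, hV, hYV⟩ := ih
      refine ⟨(-2 ^ k : ℚ) • (V * V), fun i j => ?_, ?_⟩
      · refine Subring.mul_mem _ ?_ (ZInv_mul_mem hV hV i j)
        exact_mod_cast intCast_mem_ZInv p (-2 ^ k)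
      · rw [hYY, hYV]
        simp only [Matrix.smul_mul, Matrix.mul_smul, smul_smul]
        congr 1
        ring
  have hY0 : Y = 0 := by
    ext i j
    refine eq_zero_of_forall_two_pow hodd fun k => ?_
    obtain ⟨V, hV, hYV⟩ := hdiv k
    exact ⟨V i j, hV i j, by rw [hYV]; rfl⟩
  rw [hGY, hY0, smul_zero, add_zero]

theorem trace_map_cast [Fact p.Prime] (A : Matrix (Fin d) (Fin d) ℚ) :
    (A.map (Rat.castHom ℚ_[p])).trace = ((A.trace : ℚ) : ℚ_[p]) := by
  simp [Matrix.trace]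

theorem Gamma4.eq_one_of_trace [hp : Fact p.Prime] (hodd : Odd p) (hd : d < 16)
    {γ : SLd d (ZInv p)} (hγ : γ ∈ Gamma4 p d)
    (htr : ‖((diagEmbed p d γ).2.1 * (diagEmbed p d γ).2.1).trace‖ ≤ 1) : γ = 1 := by
  obtain ⟨h1, Y, hY, h2⟩ := mem_Gamma4_iff.1 hγ
  apply ratMat_injective
  rw [ratMat_one]
  refine ratMat_eq_one_of_trace hodd hd h1 hY h2 ?_
  rwa [diagEmbed_snd, ← Matrix.map_mul, trace_map_cast] at htr

end RationalMatrices

/-! ### The unimodular lattice attached to a `p`-adic isometry -/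

section Lattice

variable {p : ℕ} [hp : Fact p.Prime] {d : ℕ}

/-- The vectors `y ∈ ℤ[1/p]^d` for which `y g` is `p`-integral. -/
def latticeOf (g : Matrix (Fin d) (Fin d) ℚ_[p]) : Submodule ℤ (Fin d → ℚ) where
  carrier := {y | (∀ i, y i ∈ ZInv p) ∧ ∀ j, ‖((fun i => (y i : ℚ_[p])) ᵥ* g) j‖ ≤ 1}
  zero_mem' := ⟨fun _ => Subring.zero_mem _, fun j => by
    have : (fun i => (((0 : Fin d → ℚ) i : ℚ) : ℚ_[p])) = 0 := by ext; simp
    rw [this, zero_vecMul]; simp⟩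
  add_mem' := by
    rintro x y ⟨hx, hx'⟩ ⟨hy, hy'⟩
    refine ⟨fun i => Subring.add_mem _ (hx i) (hy i), fun j => ?_⟩
    have : (fun i => (((x + y) i : ℚ) : ℚ_[p])) =
        (fun i => (x i : ℚ_[p])) + fun i => (y i : ℚ_[p]) := by ext; simp
    rw [this, add_vecMul]
    exact Padic.norm_add_le_of_le (hx' j) (hy' j)
  smul_mem' := by
    rintro c y ⟨hy, hy'⟩
    refine ⟨fun i => ?_, fun j => ?_⟩
    · rw [Pi.smul_apply, zsmul_eq_mul]
      exact Subring.mul_mem _ (intCast_mem_ZInv p c) (hy i)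
    · have : (fun i => (((c • y) i : ℚ) : ℚ_[p])) = (c : ℚ_[p]) • fun i => (y i : ℚ_[p]) := by
        ext; simp
      rw [this, smul_vecMul, Pi.smul_apply, smul_eq_mul, norm_mul]
      exact mul_le_one₀ (Padic.norm_int_le_one c) (norm_nonneg _) (hy' j)

theorem cast_dotProduct {K : Type*} [DivisionRing K] [CharZero K] (x y : Fin d → ℚ) :
    ((x ⬝ᵥ y : ℚ) : K) = (fun i => (x i : K)) ⬝ᵥ fun i => (y i : K) := by
  simp [dotProduct]

/-- The isometry `g` preserves the dot product and makes both vectors `p`-integral, so their product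
is a `p`-integral element of `ℤ[1/p]`. -/
theorem latticeOf.dotProduct_int {g : SLd d ℚ_[p]} (hg : g ∈ SOd d ℚ_[p]) {x y : Fin d → ℚ}
    (hx : x ∈ latticeOf g.1) (hy : y ∈ latticeOf g.1) : ∃ a : ℤ, x ⬝ᵥ y = a := by
  refine eq_intCast_of_mem_ZInv (p := p)
    (Subring.sum_mem _ fun i _ => Subring.mul_mem _ (hx.1 i) (hy.1 i)) ?_
  rw [cast_dotProduct, ← SOd.vecMul_dotProduct hg]
  simpa using Padic.norm_dotProduct_le zero_le_one zero_le_one hx.2 hy.2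

/-- Scaling by a power of `p` moves `z` into `ℤ_p`, where truncations of the expansion are integers.
-/
theorem Padic.exists_ZInv_near (z : ℚ_[p]) (M : ℕ) :
    ∃ q ∈ ZInv p, ‖z - (q : ℚ_[p])‖ ≤ ((p : ℝ) ^ M)⁻¹ := by
  have hp1 : (1 : ℝ) < p := by exact_mod_cast hp.out.one_lt
  have hp0 : (p : ℚ_[p]) ≠ 0 := by exact_mod_cast hp.out.ne_zero
  obtain ⟨K, hK⟩ := pow_unbounded_of_one_lt ‖z‖ hp1
  have hz : ‖z * (p : ℚ_[p]) ^ K‖ ≤ 1 := by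
    rw [norm_mul, Padic.norm_p_pow, _root_.zpow_neg, zpow_natCast]
    exact mul_inv_le_one_of_le₀ hK.le (by positivity)
  set x : ℤ_[p] := ⟨z * (p : ℚ_[p]) ^ K, hz⟩ with hx
  have h1 : ‖x - (x.appr (M + K) : ℤ_[p])‖ ≤ (p : ℝ) ^ (-(M + K : ℕ) : ℤ) :=
    (PadicInt.norm_le_pow_iff_mem_span_pow _ _).2 (PadicInt.appr_spec (M + K) x)
  have h2 : ‖z * (p : ℚ_[p]) ^ K - (x.appr (M + K) : ℚ_[p])‖ ≤ (p : ℝ) ^ (-(M + K : ℕ) : ℤ) := by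
    have h3 : ‖((x - (x.appr (M + K) : ℤ_[p]) : ℤ_[p]) : ℚ_[p])‖ ≤ (p : ℝ) ^ (-(M + K : ℕ) : ℤ) :=
      h1
    rwa [PadicInt.coe_sub, PadicInt.coe_natCast] at h3
  refine ⟨(x.appr (M + K) : ℚ) * ((p : ℚ) ^ K)⁻¹, Subring.mul_mem _ (natCast_mem_ZInv p _)
    (inv_pow_mem_ZInv p K), ?_⟩
  have h3 : z - (((x.appr (M + K) : ℚ) * ((p : ℚ) ^ K)⁻¹ : ℚ) : ℚ_[p]) =
      (z * (p : ℚ_[p]) ^ K - (x.appr (M + K) : ℚ_[p])) * ((p : ℚ_[p]) ^ K)⁻¹ := by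
    push_cast
    rw [sub_mul, mul_assoc, mul_inv_cancel₀ (pow_ne_zero K hp0), mul_one]
  rw [h3, norm_mul, norm_inv, Padic.norm_p_pow]
  calc _ ≤ (p : ℝ) ^ (-(M + K : ℕ) : ℤ) * ((p : ℝ) ^ (-(K : ℤ)))⁻¹ :=
        mul_le_mul_of_nonneg_right h2 (by positivity)
    _ = ((p : ℝ) ^ M)⁻¹ := by
        have hp0' : (p : ℝ) ≠ 0 := by positivity
        rw [← _root_.zpow_neg, ← zpow_add₀ hp0', ← zpow_natCast, ← _root_.zpow_neg]
        congr 1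
        push_cast; ring

/-- Away from `p` the lattice is `ℤ^d`, and at `p` it is `ℤ_p^d g⁻¹` with `det g = 1`, so its
covolume is one. Concretely, the determinants of a basis matrix and of its inverse are both
`p`-integral elements of `ℤ[1/p]`, hence integers with product 1. -/
theorem latticeOf.exists_basis {g : SLd d ℚ_[p]} (hg : g ∈ SOd d ℚ_[p]) :
    ∃ X : Matrix (Fin d) (Fin d) ℚ, |X.det| = 1 ∧ ∀ i, X i ∈ latticeOf g.1 := by
  have hpQ : (p : ℚ) ≠ 0 := by exact_mod_cast hp.out.ne_zero
  have hpP : (p : ℚ_[p]) ≠ 0 := by exact_mod_cast hp.out.ne_zero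
  have hpR : (0 : ℝ) < p := by exact_mod_cast hp.out.pos
  obtain ⟨N, hN⟩ := exists_normLe g.1
  have hnormp : ‖((p : ℚ_[p])) ^ N‖ = ((p : ℝ) ^ N)⁻¹ := by
    rw [Padic.norm_p_pow, _root_.zpow_neg, zpow_natCast]
  -- the lattice lies between `p ^ N ℤ ^ d` and `p ^ (-N) ℤ ^ d`
  have hin : ∀ a : Fin d → ℤ, (fun i => (p : ℚ) ^ N * a i) ∈ latticeOf g.1 := by
    intro a
    refine ⟨fun i => by exact_mod_cast intCast_mem_ZInv p ((p : ℤ) ^ N * a i), fun j => ?_⟩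
    have h1 : ∀ i, ‖((((p : ℚ) ^ N * a i : ℚ)) : ℚ_[p])‖ ≤ ((p : ℝ) ^ N)⁻¹ := fun i => by
      push_cast
      rw [norm_mul, hnormp]
      exact mul_le_of_le_one_right (by positivity) (Padic.norm_int_le_one _)
    have h2 := hN.vecMul (by positivity) (by positivity) h1 j
    rwa [inv_mul_cancel₀ (by positivity)] at h2
  have hout : ∀ y ∈ latticeOf g.1, ∃ a : Fin d → ℤ, ∀ i, (p : ℚ) ^ N * y i = a i := by
    intro y hy
    have h1 : (fun i => (y i : ℚ_[p])) = ((fun i => (y i : ℚ_[p])) ᵥ* g.1) ᵥ* g.1ᵀ := by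
      rw [vecMul_vecMul, SOd.mul_transpose hg, vecMul_one]
    have h2 : ∀ i, ‖(y i : ℚ_[p])‖ ≤ (p : ℝ) ^ N := fun i => by
      have := hN.transpose.vecMul zero_le_one (by positivity) hy.2 i
      rw [← h1, one_mul] at this
      exact this
    have h3 : ∀ i, ∃ a : ℤ, (p : ℚ) ^ N * y i = a := fun i => by
      refine eq_intCast_of_mem_ZInv (p := p) (Subring.mul_mem _
        (Subring.pow_mem _ (natCast_mem_ZInv p p) N) (hy.1 i)) ?_
      push_cast
      rw [norm_mul, hnormp, inv_mul_le_iff₀ (by positivity), mul_one]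
      exact h2 i
    choose a ha using h3
    exact ⟨a, ha⟩
  let φ : (Fin d → ℤ) →ₗ[ℤ] (Fin d → ℚ) :=
    { toFun := fun a i => ((p : ℚ) ^ N)⁻¹ * a i
      map_add' := fun a b => by ext; simp [mul_add]
      map_smul' := fun c a => by ext; simp; ring }
  let M : Submodule ℤ (Fin d → ℤ) := (latticeOf g.1).comap φ
  obtain ⟨r, ⟨b⟩⟩ := Submodule.nonempty_basis_of_pid (Pi.basisFun ℤ (Fin d)) M
  have hr : r = d := by
    have h1 : Module.finrank ℤ M = r := by
      rw [Module.finrank_eq_card_basis b, Fintype.card_fin]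
    have h2 : Module.finrank ℤ (Fin d → ℤ) = d := by simp
    have h3 : Module.finrank ℤ M ≤ Module.finrank ℤ (Fin d → ℤ) := Submodule.finrank_le M
    -- `M` is the lattice multiplied by `p ^ N`, so it contains `p ^ (2N) ℤ^d` and has full rank.
    let ψ : (Fin d → ℤ) →ₗ[ℤ] M :=
      LinearMap.codRestrict M (((p : ℤ) ^ (2 * N)) • LinearMap.id) (fun a => by
        change φ _ ∈ latticeOf g.1
        convert hin a using 1
        ext i
        change ((p : ℚ) ^ N)⁻¹ * (((p : ℤ) ^ (2 * N) * a i : ℤ) : ℚ) = _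
        push_cast
        rw [two_mul, pow_add]
        field_simp)
    have hψ : Function.Injective ψ := by
      intro a a' h
      have h4 : ((p : ℤ) ^ (2 * N)) • a = ((p : ℤ) ^ (2 * N)) • a' := congrArg Subtype.val h
      exact smul_right_injective _ (pow_ne_zero _ (by exact_mod_cast hp.out.ne_zero)) h4
    have : Module.Finite ℤ M := Module.Finite.of_basis b
    have : Module.Free ℤ M := Module.Free.of_basis b
    have h5 : Module.finrank ℤ (Fin d → ℤ) ≤ Module.finrank ℤ M :=
      LinearMap.finrank_le_finrank_of_injective hψ
    omega
  subst hr
  let X : Matrix (Fin r) (Fin r) ℚ := Matrix.of fun i => φ (b i : Fin r → ℤ)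
  have hXL : ∀ i, X i ∈ latticeOf g.1 := fun i => (b i).2
  have hspan : ∀ y ∈ latticeOf g.1, ∃ c : Fin r → ℤ, (fun i => (c i : ℚ)) ᵥ* X = y := by
    intro y hy
    obtain ⟨a, ha⟩ := hout y hy
    have hφ : φ a = y := by
      ext i
      change ((p : ℚ) ^ N)⁻¹ * (a i : ℚ) = y i
      rw [← ha i, inv_mul_cancel_left₀ (pow_ne_zero _ hpQ)]
    have haM : a ∈ M := by
      change φ a ∈ latticeOf g.1
      rwa [hφ]
    refine ⟨b.repr ⟨a, haM⟩, ?_⟩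
    have h1 : ∑ i, b.repr ⟨a, haM⟩ i • (b i : Fin r → ℤ) = a := by
      have := congrArg Subtype.val (b.sum_repr ⟨a, haM⟩)
      simpa only [AddSubmonoidClass.coe_finsetSum, SetLike.val_smul] using this
    rw [← hφ]
    nth_rewrite 2 [← h1]
    rw [map_sum]
    simp_rw [LinearMap.map_smul]
    ext j
    simp only [vecMul, dotProduct, Finset.sum_apply, zsmul_eq_mul]
    rfl
  have hC : ∀ i : Fin r, ∃ c : Fin r → ℤ, (fun k => (c k : ℚ)) ᵥ* X =
      fun k => (p : ℚ) ^ N * ((Pi.single i 1 : Fin r → ℤ) k : ℚ) := fun i =>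
    hspan _ (hin (Pi.single i 1))
  choose C hC using hC
  let W : Matrix (Fin r) (Fin r) ℚ := ((p : ℚ) ^ N)⁻¹ • Matrix.of fun i k => (C i k : ℚ)
  have hWX : W * X = 1 := by
    rw [Matrix.smul_mul]
    ext i j
    have h1 := congrFun (hC i) j
    have h2 : ((Matrix.of fun i k => (C i k : ℚ)) * X) i j = ((fun k => (C i k : ℚ)) ᵥ* X) j := rfl
    rw [Matrix.smul_apply, h2, h1, smul_eq_mul, inv_mul_cancel_left₀ (pow_ne_zero _ hpQ),
      Matrix.one_apply, Pi.single_apply]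
    simp [eq_comm]
  have hXW : X * W = 1 := mul_eq_one_comm.1 hWX
  have hWm : ∀ i j, W i j ∈ ZInv p := fun i j => by
    exact Subring.mul_mem _ (inv_pow_mem_ZInv p N) (intCast_mem_ZInv p (C i j))
  have hdetm : ∀ A : Matrix (Fin r) (Fin r) ℚ, (∀ i j, A i j ∈ ZInv p) → A.det ∈ ZInv p := by
    intro A hA
    have : A = (Matrix.of fun i j => (⟨A i j, hA i j⟩ : ZInv p)).map (ZInv p).subtype := rfl
    rw [this, ← RingHom.mapMatrix_apply, ← RingHom.map_det]
    exact Subtype.prop _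
  have hdetcast : ∀ A : Matrix (Fin r) (Fin r) ℚ,
      (A.map (Rat.castHom ℚ_[p])).det = (A.det : ℚ_[p]) := fun A => by
    rw [← RingHom.mapMatrix_apply, ← RingHom.map_det]; rfl
  have hY : NormLe 1 (X.map (Rat.castHom ℚ_[p]) * g.1) := fun i j => (hXL i).2 j
  -- Each row of `gᵀ` is approximated by a vector `y` over `ℤ[1/p]`. Precision `p ^ (-N)` puts `y`
  -- in the lattice, so `y W` is its integral coordinate vector; precision `p ^ (-N')` keeps the
  -- error integral after multiplication by `W`.
  have hZ : NormLe 1 (g.1ᵀ * W.map (Rat.castHom ℚ_[p])) := by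
    obtain ⟨N', hN'⟩ := exists_normLe (W.map (Rat.castHom ℚ_[p]))
    intro i j
    choose y hym hy using fun k => Padic.exists_ZInv_near (g.1ᵀ i k) (N + N')
    have hdiff : ∀ k, ‖(g.1ᵀ i - fun k => (y k : ℚ_[p])) k‖ ≤ ((p : ℝ) ^ (N + N'))⁻¹ := hy
    have hp1 : (1 : ℝ) ≤ p := by exact_mod_cast hp.out.one_lt.le
    have hyL : y ∈ latticeOf g.1 := by
      refine ⟨hym, fun k => ?_⟩
      have h1 : (fun i => (y i : ℚ_[p])) ᵥ* g.1 =
          g.1ᵀ i ᵥ* g.1 - (g.1ᵀ i - fun k => (y k : ℚ_[p])) ᵥ* g.1 := by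
        rw [sub_vecMul, sub_sub_cancel]
      rw [h1]
      refine Padic.norm_sub_le_of_le ?_ ?_
      · have h2 : (g.1ᵀ i ᵥ* g.1) k = (g.1ᵀ * g.1) i k := rfl
        rw [h2, SOd.transpose_mul hg]
        exact NormLe.one i k
      · refine (hN.vecMul (by positivity) (by positivity) hdiff k).trans ?_
        rw [inv_mul_le_iff₀ (by positivity), mul_one]
        exact pow_le_pow_right₀ hp1 (by omega)
    obtain ⟨c, hc⟩ := hspan y hyL
    have h3 : (g.1ᵀ * W.map (Rat.castHom ℚ_[p])) i j =
        ((g.1ᵀ i - fun k => (y k : ℚ_[p])) ᵥ* W.map (Rat.castHom ℚ_[p])) j + (c j : ℚ_[p]) := by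
      have h4 : (fun k => (y k : ℚ_[p])) ᵥ* W.map (Rat.castHom ℚ_[p]) =
          fun k => (c k : ℚ_[p]) := by
        have h5 : y ᵥ* W = fun k => (c k : ℚ) := by
          rw [← hc, vecMul_vecMul, hXW, vecMul_one]
        ext k
        have h6 := congrArg (fun q : ℚ => (q : ℚ_[p])) (congrFun h5 k)
        simpa [vecMul, dotProduct] using h6
      rw [sub_vecMul, h4, Pi.sub_apply, sub_add_cancel]
      rfl
    rw [h3]
    refine Padic.norm_add_le_of_le ?_ (Padic.norm_int_le_one _)
    refine (hN'.vecMul (by positivity) (by positivity) hdiff j).trans ?_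
    rw [inv_mul_le_iff₀ (by positivity), mul_one]
    exact pow_le_pow_right₀ hp1 (by omega)
  obtain ⟨a, ha⟩ : ∃ a : ℤ, X.det = a := by
    refine eq_intCast_of_mem_ZInv (p := p) (hdetm X fun i j => (hXL i).1 j) ?_
    have := hY.det
    rwa [det_mul, g.2, mul_one, hdetcast] at this
  obtain ⟨a', ha'⟩ : ∃ a : ℤ, W.det = a := by
    refine eq_intCast_of_mem_ZInv (p := p) (hdetm W hWm) ?_
    have := hZ.det
    rwa [det_mul, det_transpose, g.2, one_mul, hdetcast] at this
  refine ⟨X, ?_, hXL⟩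
  have h1 : a * a' = 1 := by
    have := congrArg Matrix.det hXW
    rw [det_mul, ha, ha', det_one] at this
    exact_mod_cast this
  rw [ha]
  rcases Int.isUnit_iff.1 (IsUnit.of_mul_eq_one a' h1) with h | h <;> simp [h]

end Lattice

/-! ### Minkowski's theorem and short orthogonal families -/

section Minkowski

variable {d : ℕ}

/-- Minkowski's theorem for the parallelepiped cut out by an orthonormal basis and the lattice
spanned by the rows of a matrix of determinant `±1`. -/
theorem exists_lattice_vector_in_box (b : OrthonormalBasis (Fin d) ℝ (EuclideanSpace ℝ (Fin d)))
    {r : Fin d → ℝ} (hr0 : ∀ i, 0 < r i) (hr : 1 < ∏ i, r i)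
    {X : Matrix (Fin d) (Fin d) ℚ} (hX : |X.det| = 1) :
    ∃ c : Fin d → ℤ, (fun i => (c i : ℚ)) ᵥ* X ≠ 0 ∧ ∀ i,
      |inner ℝ (b i) (WithLp.toLp 2 (fun j => ((((fun i => (c i : ℚ)) ᵥ* X) j : ℚ) : ℝ)))| < r i := by
  classical
  set XR : Matrix (Fin d) (Fin d) ℝ := X.map (Rat.castHom ℝ) with hXR
  have hdet : XR.det = (X.det : ℝ) := by
    rw [hXR, ← RingHom.mapMatrix_apply, ← RingHom.map_det]; rfl
  have hdetabs : |XR.det| = 1 := by rw [hdet]; exact_mod_cast hX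
  have hunit : IsUnit XR := by
    rw [Matrix.isUnit_iff_isUnit_det, isUnit_iff_ne_zero]
    intro h
    rw [h] at hdetabs
    simp at hdetabs
  have hli : LinearIndependent ℝ (fun i => XR i) := Matrix.linearIndependent_rows_of_isUnit hunit
  let β : Module.Basis (Fin d) ℝ (Fin d → ℝ) := basisOfPiSpaceOfLinearIndependent hli
  have hβ : ⇑β = fun i => XR i := coe_basisOfPiSpaceOfLinearIndependent hli
  have hvolF : volume (ZSpan.fundamentalDomain β) = 1 := by
    rw [ZSpan.volume_fundamentalDomain, hβ]
    change ENNReal.ofReal |XR.det| = 1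
    rw [hdetabs, ENNReal.ofReal_one]
  -- Coordinates in an orthonormal basis preserve volume, so the box `S` has volume `2^d ∏ r i`,
  -- against covolume one for the lattice.
  let T : (Fin d → ℝ) → (Fin d → ℝ) := fun y i => inner ℝ (b i) (WithLp.toLp 2 y)
  have hT : MeasurePreserving T volume volume := by
    have h1 := ((PiLp.volume_preserving_ofLp (Fin d)).comp b.measurePreserving_repr).comp
      (PiLp.volume_preserving_toLp (Fin d))
    have h2 : T = (WithLp.ofLp ∘ b.repr) ∘ WithLp.toLp 2 := by
      funext y
      ext i
      simp [T, b.repr_apply_apply]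
    rw [h2]
    exact h1
  have hTadd : ∀ x y, T (x + y) = T x + T y := fun x y => by
    ext i; simp [T, inner_add_right]
  have hTsmul : ∀ (a : ℝ) x, T (a • x) = a • T x := fun a x => by
    ext i; simp [T, inner_smul_right]
  let S : Set (Fin d → ℝ) := T ⁻¹' (Set.univ.pi fun i => Set.Ioo (-r i) (r i))
  have hS : ∀ y, y ∈ S ↔ ∀ i, |T y i| < r i := fun y => by
    simp [S, abs_lt]
  have hvolS : volume S = ENNReal.ofReal (2 ^ d * ∏ i, r i) := by
    rw [hT.measure_preimage (MeasurableSet.univ_pi fun i => measurableSet_Ioo).nullMeasurableSet,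
      volume_pi, Measure.pi_pi]
    simp only [Real.volume_Ioo]
    rw [← ENNReal.ofReal_prod_of_nonneg (fun i _ => by linarith [hr0 i])]
    congr 1
    have : ∀ i, r i - -r i = 2 * r i := fun i => by ring
    simp only [this, Finset.prod_mul_distrib, Finset.prod_const, Finset.card_univ, Fintype.card_fin]
  have hsymm : ∀ y ∈ S, -y ∈ S := fun y hy => by
    rw [hS] at hy ⊢
    intro i
    have : T (-y) = -T y := by simpa using hTsmul (-1) y
    rw [this, Pi.neg_apply, abs_neg]
    exact hy i
  have hconv : Convex ℝ S := by
    have : Convex ℝ (Set.univ.pi fun i => Set.Ioo (-r i) (r i)) :=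
      convex_pi fun i _ => convex_Ioo _ _
    exact this.is_linear_preimage ⟨hTadd, hTsmul⟩
  have hlt : volume (ZSpan.fundamentalDomain β) * 2 ^ Module.finrank ℝ (Fin d → ℝ) <
      volume S := by
    rw [hvolF, hvolS, one_mul, Module.finrank_fin_fun]
    have h2 : (2 : ENNReal) ^ d = ENNReal.ofReal (2 ^ d) := by
      rw [ENNReal.ofReal_pow (by norm_num)]; norm_num
    rw [h2]
    refine (ENNReal.ofReal_lt_ofReal_iff (by positivity)).2 ?_
    exact lt_mul_of_one_lt_right (by positivity) hr
  have : Countable (Submodule.span ℤ (Set.range β)).toAddSubgroup :=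
    inferInstanceAs (Countable (Submodule.span ℤ (Set.range β)))
  obtain ⟨y, hy0, hyS⟩ := exists_ne_zero_mem_lattice_of_measure_mul_two_pow_lt_measure
    (ZSpan.isAddFundamentalDomain' β volume) hsymm hconv hlt
  obtain ⟨c, hc⟩ := (Submodule.mem_span_range_iff_exists_fun ℤ).1 y.2
  have hcy : (fun j => ((((fun i => (c i : ℚ)) ᵥ* X) j : ℚ) : ℝ)) = (y : Fin d → ℝ) := by
    rw [← hc, hβ]
    ext j
    simp [vecMul, dotProduct, Finset.sum_apply, hXR]
  refine ⟨c, fun h => hy0 ?_, fun i => ?_⟩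
  · apply Subtype.ext
    rw [← hcy, h]
    ext j
    simp
  · rw [hcy]
    exact (hS _).1 hyS i

theorem inner_toLp_cast (x y : Fin d → ℚ) :
    inner ℝ (WithLp.toLp 2 fun i => ((x i : ℚ) : ℝ) : EuclideanSpace ℝ (Fin d))
      (WithLp.toLp 2 fun i => ((y i : ℚ) : ℝ)) = ((x ⬝ᵥ y : ℚ) : ℝ) := by
  rw [cast_dotProduct, EuclideanSpace.inner_eq_star_dotProduct]
  simp [dotProduct_comm]

/-- The lattices `latticeOf g`, for `g ∈ SO_d(ℚ_p)`, contain orthogonal families of vectors of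
bounded length. -/
theorem latticeOf.exists_orthogonal (d k : ℕ) (hk : k ≤ d) : ∃ B : ℕ, 1 ≤ B ∧
    ∀ (p : ℕ) [Fact p.Prime] (g : SLd d ℚ_[p]), g ∈ SOd d ℚ_[p] → ∃ x : Fin d → Fin d → ℚ,
      ∀ i, i.1 < k → x i ∈ latticeOf g.1 ∧ x i ≠ 0 ∧ x i ⬝ᵥ x i ≤ B ∧
        ∀ j, j.1 < k → i ≠ j → x i ⬝ᵥ x j = 0 := by
  induction k with
  | zero => exact ⟨1, le_rfl, fun p _ g _ => ⟨0, fun i hi => absurd hi (Nat.not_lt_zero _)⟩⟩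
  | succ k ih =>
    obtain ⟨B, hB, ih⟩ := ih (by omega)
    have hBR : (1 : ℝ) ≤ B := by exact_mod_cast hB
    set R : ℕ := B ^ d + 1 with hR
    refine ⟨max B (d * R ^ 2), le_max_of_le_left hB, fun p _ g hg => ?_⟩
    obtain ⟨x, hx⟩ := ih p g hg
    obtain ⟨X, hX, hXL⟩ := latticeOf.exists_basis hg
    let xE : Fin d → EuclideanSpace ℝ (Fin d) := fun i => WithLp.toLp 2 fun j => ((x i j : ℚ) : ℝ)
    have hxx : ∀ i, i.1 < k → 1 ≤ ‖xE i‖ ∧ ‖xE i‖ ≤ B := by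
      intro i hi
      obtain ⟨h1, h2, h3, -⟩ := hx i hi
      obtain ⟨a, ha⟩ := latticeOf.dotProduct_int hg h1 h1
      have hsq : ‖xE i‖ ^ 2 = a := by
        rw [← real_inner_self_eq_norm_sq, inner_toLp_cast, ha]; push_cast; rfl
      have ha1 : 1 ≤ a := by
        have h4 : 0 < x i ⬝ᵥ x i := by
          rcases (dotProduct_self_star_nonneg (x i)).lt_or_eq with h | h
          · simpa using h
          · exact absurd (dotProduct_self_eq_zero.1 (by simpa using h.symm)) h2
        rw [ha] at h4
        have : 0 < a := by exact_mod_cast h4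
        omega
      have ha1' : (1 : ℝ) ≤ a := by exact_mod_cast ha1
      have haB : (a : ℝ) ≤ B := by rw [ha] at h3; exact_mod_cast h3
      constructor <;> nlinarith [norm_nonneg (xE i)]
    let u : Fin d → EuclideanSpace ℝ (Fin d) := fun i => ‖xE i‖⁻¹ • xE i
    let s : Set (Fin d) := {i | i.1 < k}
    have hu : Orthonormal ℝ (s.domRestrict u) := by
      constructor
      · rintro ⟨i, hi⟩
        have h0 : ‖xE i‖ ≠ 0 := by linarith [(hxx i hi).1]
        simp [Set.domRestrict, u, norm_smul, h0]
      · rintro ⟨i, hi⟩ ⟨j, hj⟩ hij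
        have hij' : i ≠ j := fun h => hij (Subtype.ext h)
        have h1 : inner ℝ (xE i) (xE j) = 0 := by
          rw [inner_toLp_cast, (hx i hi).2.2.2 j hj hij']; simp
        simp [Set.domRestrict, u, inner_smul_left, inner_smul_right, h1]
    set i₀ : Fin d := ⟨k, by omega⟩ with hi₀
    obtain ⟨b, hb⟩ := hu.exists_orthonormalBasis_extension_of_card_eq (by simp)
    -- The side `‖x_i‖⁻¹` along `x_i` forces `|x_i · y| < 1`, and this product is an integer, so `y`
    -- is orthogonal to `x_i`. The other sides equal `R = B ^ d + 1`, enough to outweigh at most `d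
    -- - 1` sides of length at least `B⁻¹`.
    let r : Fin d → ℝ := fun i => if i.1 < k then ‖xE i‖⁻¹ else R
    have hR1 : (1 : ℝ) ≤ R := by rw [hR]; push_cast; linarith [pow_nonneg (by linarith : (0 : ℝ) ≤ B) d]
    have hrB : ∀ i, (B : ℝ)⁻¹ ≤ r i := by
      intro i
      simp only [r]
      split_ifs with h
      · exact inv_anti₀ (by linarith [(hxx i h).1]) (hxx i h).2
      · exact (inv_le_one_of_one_le₀ hBR).trans hR1
    have hrR : ∀ i, r i ≤ R := by
      intro i
      simp only [r]
      split_ifs with h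
      · exact (inv_le_one_of_one_le₀ (hxx i h).1).trans hR1
      · exact le_rfl
    have hr0 : ∀ i, 0 < r i := fun i => lt_of_lt_of_le (by positivity) (hrB i)
    have hprod : 1 < ∏ i, r i := by
      rw [← Finset.mul_prod_erase _ _ (Finset.mem_univ i₀)]
      have h1 : r i₀ = R := by simp [r, i₀]
      have h2 : ((B : ℝ)⁻¹) ^ (d - 1) ≤ ∏ i ∈ Finset.univ.erase i₀, r i := by
        have h3 : (Finset.univ.erase i₀).card = d - 1 := by simp
        rw [← h3, ← Finset.prod_const]
        exact Finset.prod_le_prod (fun _ _ => by positivity) fun i _ => hrB i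
      rw [h1]
      calc (1 : ℝ) < ((B : ℝ) ^ d + 1) * ((B : ℝ) ^ d)⁻¹ := by
            rw [add_mul, mul_inv_cancel₀ (by positivity)]
            have : (0 : ℝ) < 1 * ((B : ℝ) ^ d)⁻¹ := by positivity
            linarith
        _ ≤ R * ((B : ℝ)⁻¹) ^ (d - 1) := by
            rw [hR]; push_cast
            rw [inv_pow]
            gcongr
            omega
        _ ≤ _ := mul_le_mul_of_nonneg_left h2 (by positivity)
    obtain ⟨c, hc0, hc⟩ := exists_lattice_vector_in_box b hr0 hprod hX
    set y : Fin d → ℚ := (fun i => (c i : ℚ)) ᵥ* X with hy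
    have hyL : y ∈ latticeOf g.1 := by
      have h1 : y = ∑ i, c i • X i := by
        ext j
        simp [hy, vecMul, dotProduct]
      rw [h1]
      exact Submodule.sum_mem _ fun i _ => Submodule.smul_mem _ _ (hXL i)
    have horth : ∀ i, i.1 < k → x i ⬝ᵥ y = 0 := by
      intro i hi
      obtain ⟨a, ha⟩ := latticeOf.dotProduct_int hg (hx i hi).1 hyL
      have h1 := hc i
      rw [hb i hi] at h1
      have hpos : 0 < ‖xE i‖⁻¹ := by
        have := (hxx i hi).1
        positivity
      simp only [u, r, hi, if_true, inner_smul_left, xE, inner_toLp_cast, ha] at h1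
      rw [abs_mul, RCLike.conj_to_real, abs_of_pos hpos] at h1
      have h2 : |((a : ℚ) : ℝ)| < 1 := lt_of_mul_lt_mul_left (by simpa using h1) hpos.le
      have h3 : |a| < 1 := by exact_mod_cast h2
      rw [ha, Int.abs_lt_one_iff.1 h3, Int.cast_zero]
    have hnorm : y ⬝ᵥ y ≤ (d * R ^ 2 : ℕ) := by
      have h1 := b.sum_sq_norm_inner_right (WithLp.toLp 2 fun j => ((y j : ℚ) : ℝ))
      rw [← real_inner_self_eq_norm_sq, inner_toLp_cast] at h1
      have h2 : ((y ⬝ᵥ y : ℚ) : ℝ) ≤ ∑ _i : Fin d, (R : ℝ) ^ 2 := by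
        rw [← h1]
        refine Finset.sum_le_sum fun i _ => ?_
        rw [Real.norm_eq_abs]
        exact pow_le_pow_left₀ (abs_nonneg _) ((hc i).le.trans (hrR i)) 2
      simp only [Finset.sum_const, Finset.card_univ, Fintype.card_fin, nsmul_eq_mul] at h2
      exact_mod_cast h2
    refine ⟨Function.update x i₀ y, fun i hi => ?_⟩
    have hlt : ∀ j : Fin d, j.1 < k + 1 → j ≠ i₀ → j.1 < k := fun j hj hne => by
      have : j.1 ≠ k := fun h => hne (Fin.ext h)
      omega
    by_cases hik : i = i₀
    · rw [hik] at hi ⊢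
      simp only [Function.update_self]
      refine ⟨hyL, hc0, hnorm.trans (by exact_mod_cast le_max_right _ _), fun j hj hij => ?_⟩
      rw [Function.update_of_ne hij.symm, dotProduct_comm]
      exact horth j (hlt j hj hij.symm)
    · have hi' := hlt i hi hik
      obtain ⟨h1, h2, h3, h4⟩ := hx i hi'
      rw [Function.update_of_ne hik]
      refine ⟨h1, h2, h3.trans (by exact_mod_cast le_max_left _ _), fun j hj hij => ?_⟩
      by_cases hjk : j = i₀
      · rw [hjk, Function.update_self]
        exact horth i hi'
      · rw [Function.update_of_ne hjk]
        exact h4 j (hlt j hj hjk) hij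

end Minkowski

/-! ### Finiteness of classes by reduction theory -/

section ClassNumber

variable {p : ℕ} [hp : Fact p.Prime] {d : ℕ}

/-- The image of `ℤ` in the quotient is finite, so the powers of `p` repeat there. Hence the inverse
of `p` is itself a power of `p`, and the image of `ℤ` is everything. -/
theorem ZInv_quotient_finite (p : ℕ) [hp : Fact p.Prime] {m : ℕ} (hm : m ≠ 0) :
    Finite (ZInv p ⧸ Ideal.span {(m : ZInv p)}) := by
  set R := ZInv p ⧸ Ideal.span {(m : ZInv p)} with hR
  have hp0 : (p : ℚ) ≠ 0 := by exact_mod_cast hp.out.ne_zero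
  have hmR : (m : R) = 0 := by
    have : Ideal.Quotient.mk (Ideal.span {(m : ZInv p)}) (m : ZInv p) = 0 :=
      Ideal.Quotient.eq_zero_iff_mem.2 (Ideal.mem_span_singleton_self _)
    simpa using this
  set I : Subring R := (Int.castRingHom R).range with hI
  have hIfin : (I : Set R).Finite := by
    refine ((Set.finite_Icc (0 : ℤ) m).image (fun a : ℤ => (a : R))).subset ?_
    rintro _ ⟨a, rfl⟩
    refine ⟨a % m, ⟨Int.emod_nonneg _ (by exact_mod_cast hm),
      (Int.emod_lt_of_pos _ (by positivity)).le⟩, ?_⟩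
    have h1 : (a : R) = ((a % m + m * (a / m) : ℤ) : R) := by rw [Int.emod_add_mul_ediv]
    change ((a % m : ℤ) : R) = (a : R)
    rw [h1, Int.cast_add, Int.cast_mul, Int.cast_natCast, hmR, zero_mul, add_zero]
  let ι : ZInv p := ⟨(p : ℚ)⁻¹, Subring.subset_closure rfl⟩
  have hι : (p : ZInv p) * ι = 1 := by
    apply Subtype.ext
    change ((p : ZInv p) : ℚ) * (p : ℚ)⁻¹ = 1
    simp [hp0]
  set ιR : R := Ideal.Quotient.mk _ ι with hιR
  have hιR1 : (p : R) * ιR = 1 := by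
    have := congrArg (Ideal.Quotient.mk (Ideal.span {(m : ZInv p)})) hι
    simpa using this
  have hpI : (p : R) ∈ I := ⟨p, by simp⟩
  have hιI : ιR ∈ I := by
    obtain ⟨i, -, j, -, hij, h⟩ := Set.infinite_univ.exists_ne_map_eq_of_mapsTo
      (f := fun i : ℕ => (p : R) ^ i) (fun i _ => I.pow_mem hpI i) hIfin
    wlog hlt : i < j generalizing i j
    · exact this j i hij.symm h.symm (by omega)
    have h1 : (p : R) ^ (j - i) = 1 := by
      have h2 := congrArg (· * ιR ^ i) h
      rw [← mul_pow, hιR1, one_pow] at h2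
      rw [show j = (j - i) + i by omega, pow_add, mul_assoc, ← mul_pow, hιR1, one_pow,
        mul_one] at h2
      exact h2.symm
    have h3 : ιR = (p : R) ^ (j - i - 1) := by
      have h4 : (p : R) ^ (j - i - 1) * ((p : R) * ιR) = ιR := by
        rw [← mul_assoc, ← pow_succ, show j - i - 1 + 1 = j - i by omega, h1, one_mul]
      rw [hιR1, mul_one] at h4
      exact h4.symm
    rw [h3]
    exact I.pow_mem hpI _
  have hall : ∀ x : R, x ∈ I := by
    intro x
    obtain ⟨⟨q, hq⟩, rfl⟩ := Ideal.Quotient.mk_surjective x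
    obtain ⟨n, a, h⟩ := (mem_ZInv_iff hp.out.ne_zero).1 hq
    have h1 : (⟨q, hq⟩ : ZInv p) = (a : ZInv p) * ι ^ n := by
      apply Subtype.ext
      change q = ((a : ZInv p) : ℚ) * ((p : ℚ)⁻¹) ^ n
      rw [inv_pow, eq_mul_inv_iff_mul_eq₀ (pow_ne_zero _ hp0), h]
      simp
    rw [h1, map_mul, map_pow, map_intCast]
    exact I.mul_mem ⟨a, by simp⟩ (I.pow_mem hιI n)
  have : (Set.univ : Set R).Finite := hIfin.subset fun x _ => hall x
  exact Set.finite_univ_iff.1 this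

/-- Since `n ≤ B < p ^ B`, the power `p ^ B` does not divide `n`. -/
theorem Padic.norm_intCast_inv_le {n : ℤ} {B : ℕ} (h1 : 1 ≤ n) (hB : n ≤ B) :
    ‖((n : ℚ_[p]))⁻¹‖ ≤ (p : ℝ) ^ B := by
  have hnot : ¬ ((p ^ B : ℕ) : ℤ) ∣ n := by
    intro h
    have h2 : ((p ^ B : ℕ) : ℤ) ≤ n := Int.le_of_dvd (by omega) h
    have h3 : (B : ℤ) < ((p ^ B : ℕ) : ℤ) := by exact_mod_cast Nat.lt_pow_self hp.out.one_lt
    omega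
  have h2 : ¬ ‖(n : ℚ_[p])‖ ≤ (p : ℝ) ^ (-B : ℤ) := fun h =>
    hnot (by exact_mod_cast (Padic.norm_int_le_pow_iff_dvd n B).1 h)
  have hp0 : (0 : ℝ) < p := by exact_mod_cast hp.out.pos
  rw [norm_inv]
  refine inv_le_of_inv_le₀ (by positivity) ?_
  rw [← zpow_natCast, ← _root_.zpow_neg]
  exact (not_le.1 h2).le

theorem HvS_mem_of_ratMat {v : Fin d → ℤ} {γ : SLd d (ZInv p)}
    (h1 : ratMat γ * (ratMat γ)ᵀ = 1)
    (h2 : (fun i => (v i : ℚ)) ᵥ* ratMat γ = fun i => (v i : ℚ)) :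
    diagEmbed p d γ ∈ HvS p v := by
  have key : ∀ (K : Type) [Field K] [CharZero K] (g : SLd d K),
      g.1 = (ratMat γ).map (Rat.castHom K) → g ∈ stabSO K v := by
    intro K _ _ g hg
    constructor
    · rw [mem_SOd_iff, hg, ← Matrix.transpose_map, ← Matrix.map_mul, h1]
      exact Matrix.map_one _ (map_zero _) (map_one _)
    · have h3 : (fun i => (v i : K)) = fun i => Rat.castHom K ((fun i => (v i : ℚ)) i) := by
        ext; simp
      rw [hg, h3]
      ext j
      have h4 := congrArg (Rat.castHom K) (congrFun h2 j)
      rw [← h4]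
      simp [vecMul, dotProduct]
  exact ⟨key ℝ _ (diagEmbed_fst p γ), key ℚ_[p] _ (diagEmbed_snd p γ)⟩

/-- The determinant is `±1` and congruent to 1 modulo 4; the value `-1` would make 4 divide 2 in
`ℤ[1/p]`, where `p` is odd. -/
theorem det_eq_one_of_congr (hodd : Odd p) {σ : Matrix (Fin d) (Fin d) ℚ} (h1 : σ * σᵀ = 1)
    {Y : Matrix (Fin d) (Fin d) ℚ} (hY : ∀ i j, Y i j ∈ ZInv p) (h : σ = 1 + (4 : ℚ) • Y) :
    σ.det = 1 := by
  have hdet : σ.det * σ.det = 1 := by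
    have := congrArg Matrix.det h1
    rwa [det_mul, det_transpose, det_one] at this
  rcases mul_self_eq_one_iff.1 hdet with h2 | h2
  · exact h2
  exfalso
  let YZ : Matrix (Fin d) (Fin d) (ZInv p) := Matrix.of fun i j => ⟨Y i j, hY i j⟩
  let σZ : Matrix (Fin d) (Fin d) (ZInv p) := 1 + (4 : ZInv p) • YZ
  have hσZ : σZ.map (ZInv p).subtype = σ := by
    rw [h]
    ext i j
    have h7 : (ZInv p).subtype 4 = (4 : ℚ) := map_ofNat _ 4
    simp only [σZ, Matrix.map_apply, Matrix.add_apply, map_add, Matrix.smul_apply, smul_eq_mul,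
      map_mul, h7, Matrix.one_apply]
    split_ifs <;> simp [YZ]
  have hdZ : σZ.det = -1 := by
    apply Subtype.val_injective
    change (ZInv p).subtype _ = (-1 : ℚ)
    rw [RingHom.map_det, RingHom.mapMatrix_apply, hσZ, h2]
  let mk := Ideal.Quotient.mk (Ideal.span {(4 : ZInv p)})
  have hmk : mk σZ.det = 1 := by
    rw [RingHom.map_det]
    have : mk.mapMatrix σZ = 1 := by
      ext i j
      have h4 : mk 4 = 0 := Ideal.Quotient.eq_zero_iff_mem.2 (Ideal.mem_span_singleton_self _)
      simp only [σZ, RingHom.mapMatrix_apply, Matrix.map_apply, Matrix.add_apply, map_add,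
        Matrix.smul_apply, smul_eq_mul, map_mul, h4, zero_mul, add_zero, Matrix.one_apply]
      split_ifs <;> simp
    rw [this, det_one]
  rw [hdZ, ← map_one mk, Ideal.Quotient.eq, Ideal.mem_span_singleton] at hmk
  obtain ⟨q, hq⟩ := hmk
  have hq' : ((-2 : ℤ) : ℚ) = ((4 : ℤ) : ℚ) * (q : ℚ) := by
    have h7 : (ZInv p).subtype 4 = (4 : ℚ) := map_ofNat _ 4
    have := congrArg (ZInv p).subtype hq
    rw [map_mul, h7, map_sub, map_neg, map_one] at this
    push_cast
    rw [show (-2 : ℚ) = -1 - 1 by norm_num]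
    exact this
  have hcop : IsCoprime (4 : ℤ) (p : ℤ) := by
    have : IsCoprime ((2 : ℤ) ^ 2) (p : ℤ) :=
      IsCoprime.pow_left (Nat.isCoprime_iff_coprime.2 ((Nat.coprime_two_left).2 hodd))
    simpa using this
  have := dvd_of_eq_mul_ZInv hcop q.2 hq'
  omega

/-- Two elements of `ℍ_v(ℚ_p)` with orthogonal families of the same shape are equivalent
under `Γ₄ ∩ ℍ_v`. -/
theorem exists_Gamma4_of_congr (hodd : Odd p) {v : Fin d → ℤ} {g g' : SLd d ℚ_[p]}
    (hg : g ∈ stabSO ℚ_[p] v) {B N : ℕ}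
    {X X' Z : Matrix (Fin d) (Fin d) ℚ} (hX : ∀ i j, X i j ∈ ZInv p)
    (hZ : ∀ i j, Z i j ∈ ZInv p) {n : Fin d → ℤ}
    (hn1 : ∀ i, 1 ≤ n i) (hnB : ∀ i, n i ≤ B) (hnN : ∀ i, n i ∣ N)
    (hXn : X * Xᵀ = diagonal fun i => (n i : ℚ)) (hXn' : X' * X'ᵀ = diagonal fun i => (n i : ℚ))
    (hv : (fun i => (v i : ℚ)) ᵥ* Xᵀ = (fun i => (v i : ℚ)) ᵥ* X'ᵀ)
    (hcong : X' - X = (4 * N : ℚ) • Z)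
    (hY : NormLe 1 (X.map (Rat.castHom ℚ_[p]) * g.1))
    (hcongp : NormLe ((p : ℝ) ^ B)⁻¹
      (X'.map (Rat.castHom ℚ_[p]) * g'.1 - X.map (Rat.castHom ℚ_[p]) * g.1)) :
    ∃ γ ∈ Gamma4 p d, diagEmbed p d γ ∈ HvS p v ∧
      NormLe 1 (g⁻¹ * (diagEmbed p d γ).2 * g').1 := by
  have hn0 : ∀ i, (n i : ℚ) ≠ 0 := fun i => by
    have := hn1 i
    exact_mod_cast (by omega : n i ≠ 0)
  have hp0 : (0 : ℝ) < p := by exact_mod_cast hp.out.pos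
  have hdd : (diagonal fun i => (n i : ℚ)) * (diagonal fun i => (n i : ℚ)⁻¹) = 1 := by
    rw [diagonal_mul_diagonal]
    simp [hn0]
  set W := Xᵀ * diagonal fun i => (n i : ℚ)⁻¹ with hW
  set W' := X'ᵀ * diagonal fun i => (n i : ℚ)⁻¹ with hW'
  have hXW : X * W = 1 := by rw [hW, ← Matrix.mul_assoc, hXn, hdd]
  have hWX : W * X = 1 := mul_eq_one_comm.1 hXW
  have hXW' : X' * W' = 1 := by rw [hW', ← Matrix.mul_assoc, hXn', hdd]
  have hWX' : W' * X' = 1 := mul_eq_one_comm.1 hXW'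
  -- The rational map with `X σ = X'`. Equal Gram matrices make it orthogonal, and equal products of
  -- the two frames with `v` make it fix `v`.
  set σ := W * X' with hσ
  have hσorth : σ * σᵀ = 1 := by
    calc σ * σᵀ = W * (X' * X'ᵀ) * Wᵀ := by rw [hσ, transpose_mul W X']; simp only [Matrix.mul_assoc]
      _ = (W * X) * (W * X)ᵀ := by
        rw [hXn', ← hXn, transpose_mul W X]; simp only [Matrix.mul_assoc]
      _ = 1 := by rw [hWX, transpose_one, Matrix.mul_one]
  -- As each `n i` divides `N`, the factor `N` clears the denominators of `X⁻¹`; this turns the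
  -- congruence modulo `4N` into one modulo 4.
  have hNW : ∀ i j, ((N : ℚ) • W) i j ∈ ZInv p := by
    intro i j
    rw [Matrix.smul_apply, hW, mul_diagonal, smul_eq_mul]
    obtain ⟨e, he⟩ := hnN j
    have h1 : (N : ℚ) = n j * e := by exact_mod_cast he
    have h2 : (N : ℚ) * (Xᵀ i j * (n j : ℚ)⁻¹) = e * X j i := by
      rw [h1, transpose_apply]
      have := hn0 j
      field_simp
    rw [h2]
    exact Subring.mul_mem _ (intCast_mem_ZInv p e) (hX j i)
  have hσ4 : σ = 1 + (4 : ℚ) • (((N : ℚ) • W) * Z) := by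
    have h1 : X' = X + (4 * N : ℚ) • Z := by rw [← hcong]; abel
    rw [hσ, h1, Matrix.mul_add, hWX]
    simp only [Matrix.mul_smul, Matrix.smul_mul, smul_smul]
  have hYm := ZInv_mul_mem hNW hZ
  have hσm : ∀ i j, σ i j ∈ ZInv p := fun i j => by
    rw [hσ4, Matrix.add_apply, Matrix.smul_apply, smul_eq_mul, Matrix.one_apply]
    refine Subring.add_mem _ ?_ (Subring.mul_mem _ (intCast_mem_ZInv p 4) (hYm i j))
    split_ifs
    exacts [Subring.one_mem _, Subring.zero_mem _]
  have hσv : (fun i => (v i : ℚ)) ᵥ* σ = fun i => (v i : ℚ) := by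
    calc (fun i => (v i : ℚ)) ᵥ* σ = (fun i => (v i : ℚ)) ᵥ* W' ᵥ* X' := by
          rw [hσ, ← vecMul_vecMul, hW, hW', ← vecMul_vecMul, ← vecMul_vecMul, hv]
      _ = _ := by rw [vecMul_vecMul, hWX', vecMul_one]
  obtain ⟨γ, hγ⟩ := exists_SLd_ratMat_eq hσm (det_eq_one_of_congr hodd hσorth hYm hσ4)
  refine ⟨γ, mem_Gamma4_iff.2 ⟨by rw [hγ, hσorth], _, hYm, by rw [hγ, hσ4]⟩,
    HvS_mem_of_ratMat (by rw [hγ, hσorth]) (by rw [hγ, hσv]), ?_⟩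
  -- In `g⁻¹ σ g' - 1 = (gᵀ W)(X' g' - X g)` the first factor equals `(X g)ᵀ diag(1/n)`, of size at
  -- most `p ^ B`. The congruence modulo `p ^ B` in the second factor compensates for it.
  have hk : (g⁻¹ * (diagEmbed p d γ).2 * g').1 =
      1 + g.1ᵀ * W.map (Rat.castHom ℚ_[p]) * (X'.map (Rat.castHom ℚ_[p]) * g'.1 -
        X.map (Rat.castHom ℚ_[p]) * g.1) := by
    have h1 : (g⁻¹ * (diagEmbed p d γ).2 * g').1 =
        (g⁻¹).1 * (diagEmbed p d γ).2.1 * g'.1 := rfl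
    have h2 : W.map (Rat.castHom ℚ_[p]) * X.map (Rat.castHom ℚ_[p]) = 1 := by
      rw [← Matrix.map_mul, hWX]
      exact Matrix.map_one _ (map_zero _) (map_one _)
    rw [h1, SOd.coe_inv hg.1, diagEmbed_snd, hγ, hσ, Matrix.map_mul, Matrix.mul_sub,
      Matrix.mul_assoc _ _ (X.map _ * g.1), ← Matrix.mul_assoc (W.map _) (X.map _), h2,
      Matrix.one_mul, SOd.transpose_mul hg.1, add_sub_cancel]
    simp only [Matrix.mul_assoc]
  rw [hk]
  refine NormLe.one.add ?_
  have hV : NormLe ((p : ℝ) ^ B) (g.1ᵀ * W.map (Rat.castHom ℚ_[p])) := by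
    intro i j
    have h1 : (g.1ᵀ * W.map (Rat.castHom ℚ_[p])) i j =
        (X.map (Rat.castHom ℚ_[p]) * g.1) j i * (n j : ℚ_[p])⁻¹ := by
      have h2 : W.map (Rat.castHom ℚ_[p]) =
          (X.map (Rat.castHom ℚ_[p]))ᵀ * diagonal fun i => (n i : ℚ_[p])⁻¹ := by
        rw [hW, Matrix.map_mul, Matrix.transpose_map, diagonal_map (map_zero _)]
        congr 2
        ext i
        simp
      rw [h2, ← Matrix.mul_assoc, mul_diagonal, ← transpose_mul, transpose_apply]
    rw [h1, norm_mul]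
    refine (mul_le_mul (hY j i) (Padic.norm_intCast_inv_le (hn1 j) (hnB j)) (norm_nonneg _)
      zero_le_one).trans_eq (one_mul _)
  have := hV.mul (by positivity) (by positivity) hcongp
  rwa [mul_inv_cancel₀ (by positivity)] at this

/-- Each `g` is assigned a short orthogonal frame `X` of its lattice. The lengths, the products with
`v`, the class of `X` modulo `4N` and that of `X g` modulo `p ^ B` are finitely many data, and they
determine `g` up to `Γ₄ ∩ ℍ_v` on the left and integral matrices on the right. -/
theorem exists_finite_classes (hodd : Odd p) (v : Fin d → ℤ) :
    ∃ (D : Type) (_ : Finite D) (f : stabSO ℚ_[p] v → D), ∀ g g', f g = f g' →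
      ∃ γ ∈ Gamma4 p d, diagEmbed p d γ ∈ HvS p v ∧
        NormLe 1 ((g : SLd d ℚ_[p])⁻¹ * (diagEmbed p d γ).2 * g').1 := by
  obtain ⟨B, hB, hx⟩ := latticeOf.exists_orthogonal d d le_rfl
  -- All squared lengths `n i ≤ B` divide `B!`.
  set N : ℕ := B.factorial with hN
  set V : ℤ := (v ⬝ᵥ v) * B with hV
  have hquot : Finite (ZInv p ⧸ Ideal.span {((4 * N : ℕ) : ZInv p)}) :=
    ZInv_quotient_finite p (by positivity)
  have : NeZero (p ^ B) := ⟨pow_ne_zero _ hp.out.ne_zero⟩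
  have hex : ∀ g : stabSO ℚ_[p] v, ∃ (X : Matrix (Fin d) (Fin d) (ZInv p))
      (Y : Matrix (Fin d) (Fin d) ℤ_[p]) (n : Fin d → Set.Icc (1 : ℤ) B)
      (m : Fin d → Set.Icc (-V) V),
      (X.map (ZInv p).subtype).map (Rat.castHom ℚ_[p]) * g.1.1 = Y.map PadicInt.Coe.ringHom ∧
      (X.map (ZInv p).subtype) * (X.map (ZInv p).subtype)ᵀ =
        diagonal (fun i => ((n i : ℤ) : ℚ)) ∧
      (fun i => (v i : ℚ)) ᵥ* (X.map (ZInv p).subtype)ᵀ = fun i => ((m i : ℤ) : ℚ) := by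
    intro g
    obtain ⟨x, hxg⟩ := hx p g.1 g.2.1
    replace hxg := fun i => hxg i i.2
    have hvL : (fun i => (v i : ℚ)) ∈ latticeOf g.1.1 := by
      refine ⟨fun i => intCast_mem_ZInv p _, fun j => ?_⟩
      have h1 : (fun i => (((v i : ℚ)) : ℚ_[p])) = fun i => (v i : ℚ_[p]) := by ext; simp
      rw [h1, g.2.2]
      exact Padic.norm_int_le_one _
    choose n hn using fun i => latticeOf.dotProduct_int g.2.1 (hxg i).1 (hxg i).1
    choose m hm using fun i => latticeOf.dotProduct_int g.2.1 hvL (hxg i).1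
    obtain ⟨Y, hY⟩ := NormLe.exists_map_eq
      (A := (Matrix.of x).map (Rat.castHom ℚ_[p]) * g.1.1) (fun i j => (hxg i).1.2 j)
    have hn1 : ∀ i, 1 ≤ n i := fun i => by
      have h4 : 0 < x i ⬝ᵥ x i := by
        rcases (dotProduct_self_star_nonneg (x i)).lt_or_eq with h | h
        · simpa using h
        · exact absurd (dotProduct_self_eq_zero.1 (by simpa using h.symm)) (hxg i).2.1
      rw [hn] at h4
      have : 0 < n i := by exact_mod_cast h4
      omega
    have hnB : ∀ i, n i ≤ B := fun i => by
      have := (hxg i).2.2.1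
      rw [hn] at this
      exact_mod_cast this
    -- Cauchy–Schwarz bounds `m²` by `V`, and `|m| ≤ m²` for an integer.
    have hmV : ∀ i, |m i| ≤ V := fun i => by
      have h1 := Finset.sum_mul_sq_le_sq_mul_sq Finset.univ (fun i => (v i : ℚ)) (x i)
      have h2 : ∑ j, (v j : ℚ) * x i j = m i := hm i
      have h3 : ∑ j, x i j ^ 2 = n i := by
        rw [← hn i]; simp only [dotProduct, sq]
      have h4 : ∑ j, (v j : ℚ) ^ 2 = ((v ⬝ᵥ v : ℤ) : ℚ) := by
        simp only [dotProduct, sq]; push_cast; rfl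
      rw [h2, h3, h4] at h1
      have h5 : m i ^ 2 ≤ (v ⬝ᵥ v) * n i := by exact_mod_cast h1
      have h6 : 0 ≤ v ⬝ᵥ v := Finset.sum_nonneg fun i _ => mul_self_nonneg (v i)
      have h7 : (v ⬝ᵥ v) * n i ≤ V := mul_le_mul_of_nonneg_left (hnB i) h6
      have h8 : |m i| ≤ m i ^ 2 := by
        rw [← sq_abs]
        exact Int.le_self_sq _
      omega
    refine ⟨Matrix.of fun i j => ⟨x i j, (hxg i).1.1 j⟩, Y, fun i => ⟨n i, hn1 i, hnB i⟩,
      fun i => ⟨m i, abs_le.1 (hmV i)⟩, hY.symm, ?_, ?_⟩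
    · ext i j
      change x i ⬝ᵥ x j = _
      rw [diagonal_apply]
      split_ifs with h
      · subst h; exact hn i
      · exact (hxg i).2.2.2 j j.2 h
    · ext i
      exact hm i
  choose X Y n m hXY hXn hXm using hex
  refine ⟨(Fin d → Set.Icc (1 : ℤ) B) × (Fin d → Set.Icc (-V) V) ×
    (Fin d → Fin d → ZInv p ⧸ Ideal.span {((4 * N : ℕ) : ZInv p)}) ×
    (Fin d → Fin d → ZMod (p ^ B)), inferInstance,
    fun g => ⟨n g, m g, fun i j => Ideal.Quotient.mk _ (X g i j),
      fun i j => PadicInt.toZModPow B (Y g i j)⟩, fun g g' h => ?_⟩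
  simp only [Prod.mk.injEq] at h
  obtain ⟨hnn, hmm, hXX, hYY⟩ := h
  have hZ : ∀ i j, ∃ z : ZInv p, X g' i j - X g i j = ((4 * N : ℕ) : ZInv p) * z := fun i j => by
    have h1 := congrFun (congrFun hXX i) j
    rw [eq_comm, Ideal.Quotient.eq, Ideal.mem_span_singleton] at h1
    exact h1
  choose z hz using hZ
  refine exists_Gamma4_of_congr hodd g.2 (B := B) (N := N)
    (X := (X g).map (ZInv p).subtype) (X' := (X g').map (ZInv p).subtype)
    (Z := (Matrix.of z).map (ZInv p).subtype)
    (fun i j => Subtype.prop _) (fun i j => Subtype.prop _) (n := fun i => n g i)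
    (fun i => (n g i).2.1) (fun i => (n g i).2.2) (fun i => ?_) (hXn g) ?_ ?_ ?_ ?_ ?_
  · obtain ⟨a, ha⟩ := Int.eq_ofNat_of_zero_le (zero_le_one.trans (n g i).2.1)
    have h1 := (n g i).2
    rw [ha] at h1 ⊢
    exact_mod_cast Nat.dvd_factorial (by exact_mod_cast h1.1) (by exact_mod_cast h1.2)
  · rw [hXn g', hnn]
  · rw [hXm g, hXm g', hmm]
  · ext i j
    have h1 := congrArg (ZInv p).subtype (hz i j)
    rw [map_sub, map_mul, map_natCast] at h1
    push_cast at h1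
    exact h1
  · rw [hXY]
    exact NormLe.map_coe _
  · rw [hXY, hXY]
    intro i j
    have h1 : Y g' i j - Y g i j ∈ RingHom.ker (PadicInt.toZModPow (p := p) B) := by
      rw [RingHom.mem_ker, map_sub, congrFun (congrFun hYY i) j, sub_self]
    rw [PadicInt.ker_toZModPow, ← PadicInt.norm_le_pow_iff_mem_span_pow] at h1
    rw [_root_.zpow_neg, zpow_natCast] at h1
    have h2 : ((Y g').map PadicInt.Coe.ringHom - (Y g).map PadicInt.Coe.ringHom) i j =
        ((Y g' i j - Y g i j : ℤ_[p]) : ℚ_[p]) := by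
      rw [PadicInt.coe_sub]; rfl
    rw [h2]
    exact h1

end ClassNumber

/-! ### Covolume as a count of double cosets -/

section FundamentalDomain

/-- One coset of `K` is taken from each double coset. Every point moves into the chosen coset of its
double coset; two elements of `Γ` moving it there differ by a conjugate of an element of `K`, which
is trivial by freeness. -/
theorem IsFundamentalDomain.of_doubleCosets {G : Type*} [Group G] [TopologicalSpace G]
    [IsTopologicalGroup G] [MeasurableSpace G] [BorelSpace G] (μ : Measure G) (Γ K : Subgroup G)
    (hK : IsOpen (K : Set G)) (hfree : ∀ γ ∈ Γ, ∀ g : G, g⁻¹ * γ * g ∈ K → γ = 1) :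
    IsFundamentalDomain Γ
      (⋃ q : DoubleCoset.Quotient (Γ : Set G) K, (fun x => (Quotient.out q)⁻¹ * x) ⁻¹' (K : Set G))
      μ := by
  have hrel : ∀ q : DoubleCoset.Quotient (Γ : Set G) K, ∀ γ ∈ Γ, ∀ x : G,
      (Quotient.out q)⁻¹ * (γ * x) ∈ K → q = DoubleCoset.mk Γ K x := by
    intro q γ hγ x h
    rw [← Quotient.out_eq' q]
    refine Quotient.sound' ((DoubleCoset.rel_iff).2 ⟨γ⁻¹, Γ.inv_mem hγ, _, h, ?_⟩)
    group
  refine IsFundamentalDomain.mk' ?_ fun x => ?_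
  · refine (isOpen_iUnion fun q => hK.preimage (by fun_prop)).measurableSet.nullMeasurableSet
  · obtain ⟨a, ha, b, hb, hab⟩ := DoubleCoset.rel_iff.1
      (Quotient.exact' (Quotient.out_eq' (DoubleCoset.mk Γ K x)))
    refine ⟨⟨a⁻¹, Γ.inv_mem ha⟩, Set.mem_iUnion.2 ⟨DoubleCoset.mk Γ K x, ?_⟩, ?_⟩
    · change (Quotient.out (DoubleCoset.mk Γ K x))⁻¹ * (a⁻¹ * x) ∈ K
      convert hb using 1
      nth_rewrite 2 [hab]
      group
    · rintro ⟨γ, hγ⟩ h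
      obtain ⟨q, hq⟩ := Set.mem_iUnion.1 h
      have hq' : (Quotient.out q)⁻¹ * (γ * x) ∈ K := hq
      have hqx := hrel q γ hγ x hq'
      rw [hqx] at hq'
      set o := Quotient.out (DoubleCoset.mk Γ K x)
      have h1 : γ * a = 1 := by
        refine hfree _ (Γ.mul_mem hγ ha) o ?_
        have h2 : o⁻¹ * (γ * a) * o = (o⁻¹ * (γ * x)) * b⁻¹ := by
          rw [hab]; group
        rw [h2]
        exact K.mul_mem hq' (K.inv_mem hb)
      exact Subtype.ext (eq_inv_of_mul_eq_one_left h1)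

theorem covolume_eq_card_mul {G : Type*} [Group G] [TopologicalSpace G]
    [IsTopologicalGroup G] [MeasurableSpace G] [BorelSpace G]
    (μ : Measure G) [μ.IsMulLeftInvariant] (Γ K : Subgroup G) [Countable Γ]
    (hK : IsOpen (K : Set G)) (hfree : ∀ γ ∈ Γ, ∀ g : G, g⁻¹ * γ * g ∈ K → γ = 1)
    [Finite (DoubleCoset.Quotient (Γ : Set G) K)] :
    covolume Γ G μ = Nat.card (DoubleCoset.Quotient (Γ : Set G) K) * μ K := by
  have := Fintype.ofFinite (DoubleCoset.Quotient (Γ : Set G) K)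
  rw [(IsFundamentalDomain.of_doubleCosets μ Γ K hK hfree).covolume_eq_volume, measure_iUnion]
  · simp only [measure_preimage_mul, tsum_fintype, Finset.sum_const, Finset.card_univ,
      nsmul_eq_mul, Nat.card_eq_fintype_card]
  · intro q q' hqq'
    rw [Function.onFun, Set.disjoint_left]
    intro x hx hx'
    apply hqq'
    rw [← Quotient.out_eq' q, ← Quotient.out_eq' q']
    refine Quotient.sound' ((DoubleCoset.rel_iff).2 ⟨1, Γ.one_mem,
      (Quotient.out q)⁻¹ * x * ((Quotient.out q')⁻¹ * x)⁻¹, K.mul_mem hx (K.inv_mem hx'), ?_⟩)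
    group
  · exact fun q => (hK.preimage (by fun_prop)).measurableSet

/-- With `c` double cosets the covolume is `c μ(K)`, so the volume is `c μ(K) / μ(Θ)`. Here `0 <
μ(Θ) ≤ μ(K) < ∞`, by openness of `Θ` in `H`, inclusion in `K` and compactness of `K`. -/
theorem card_le_orbitVolume {G : Type*} [Group G] [TopologicalSpace G] [IsTopologicalGroup G]
    (Γ : Subgroup G) (g : G) (H : Subgroup G) [LocallyCompactSpace H] (Θ : Set G)
    (K : Subgroup H) [Countable ((conjBy Γ g).subgroupOf H)]
    (hK : IsOpen (K : Set H)) (hKc : IsCompact (K : Set H))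
    (hΘ : IsOpen (((↑) : H → G) ⁻¹' Θ)) (hΘ1 : (1 : G) ∈ Θ) (hΘK : ((↑) : H → G) ⁻¹' Θ ⊆ K)
    (hfree : ∀ γ ∈ (conjBy Γ g).subgroupOf H, ∀ h : H, h⁻¹ * γ * h ∈ K → γ = 1)
    [Finite (DoubleCoset.Quotient ((conjBy Γ g).subgroupOf H : Set H) K)] :
    (Nat.card (DoubleCoset.Quotient ((conjBy Γ g).subgroupOf H : Set H) K) : ℝ) ≤
      orbitVolume Γ g H Θ := by
  let _ : MeasurableSpace H := borel H
  have : BorelSpace H := ⟨rfl⟩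
  set c := Nat.card (DoubleCoset.Quotient ((conjBy Γ g).subgroupOf H : Set H) K) with hc
  let μ : Measure H := Measure.haar
  have hcov := covolume_eq_card_mul μ ((conjBy Γ g).subgroupOf H) K hK hfree
  have hvol : orbitVolume Γ g H Θ =
      (((c * μ K)⁻¹ * μ (((↑) : H → G) ⁻¹' Θ))⁻¹).toReal := by
    rw [← hcov]; rfl
  have hU0 : μ (((↑) : H → G) ⁻¹' Θ) ≠ 0 := (hΘ.measure_pos μ ⟨1, hΘ1⟩).ne'
  have hUK : μ (((↑) : H → G) ⁻¹' Θ) ≤ μ K := measure_mono hΘK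
  have hKtop : μ K ≠ ⊤ := hKc.measure_lt_top.ne
  have hUtop : μ (((↑) : H → G) ⁻¹' Θ) ≠ ⊤ := ne_top_of_le_ne_top hKtop hUK
  rw [hvol]
  simp only [ENNReal.toReal_inv, ENNReal.toReal_mul, ENNReal.toReal_natCast, mul_inv, inv_inv]
  have h1 : (μ (((↑) : H → G) ⁻¹' Θ)).toReal ≤ (μ K).toReal := ENNReal.toReal_mono hKtop hUK
  have h2 : 0 < (μ (((↑) : H → G) ⁻¹' Θ)).toReal := ENNReal.toReal_pos hU0 hUtop
  rw [mul_assoc]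
  refine le_mul_of_one_le_right (Nat.cast_nonneg _) ?_
  rw [← div_eq_mul_inv, one_le_div h2]
  exact h1

end FundamentalDomain

/-! ### The pigeonhole principle on the orbit -/

section Collision

variable {p : ℕ} [hp : Fact p.Prime] {d : ℕ}

theorem mem_conjBy {G : Type*} [Group G] {H : Subgroup G} {g x : G} :
    x ∈ conjBy H g ↔ g * x * g⁻¹ ∈ H := by
  constructor
  · rintro ⟨y, hy, rfl⟩
    simpa [mul_assoc] using hy
  · intro h
    exact ⟨_, h, by simp [mul_assoc]⟩

variable (p d) in
/-- The subgroup `SL_d(ℤ_p)` of `SL_d(ℚ_p)`. -/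
noncomputable def intSL : Subgroup (SLd d ℚ_[p]) :=
  (SpecialLinearGroup.map (n := Fin d) (PadicInt.Coe.ringHom (p := p))).range

theorem mem_intSL_iff {g : SLd d ℚ_[p]} : g ∈ intSL p d ↔ NormLe 1 g.1 := by
  constructor
  · rintro ⟨h, rfl⟩
    exact NormLe.map_coe h.1
  · intro hg
    obtain ⟨B, hB⟩ := hg.exists_map_eq
    refine ⟨⟨B, ?_⟩, Subtype.ext hB⟩
    have h1 : PadicInt.Coe.ringHom (p := p) B.det = 1 := by
      rw [RingHom.map_det, RingHom.mapMatrix_apply, hB]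
      exact g.2
    exact Subtype.val_injective h1

theorem isOpen_intSL : IsOpen (intSL p d : Set (SLd d ℚ_[p])) := by
  have h : (intSL p d : Set (SLd d ℚ_[p])) =
      ⋂ i, ⋂ j, {g | g.1 i j ∈ Metric.closedBall (0 : ℚ_[p]) 1} := by
    ext g
    simp only [SetLike.mem_coe, mem_intSL_iff, Set.mem_iInter, Set.mem_ofPred_eq,
      mem_closedBall_zero_iff]
    rfl
  rw [h]
  refine isOpen_iInter_of_finite fun i => isOpen_iInter_of_finite fun j => ?_
  exact (IsUltrametricDist.isOpen_closedBall (0 : ℚ_[p]) one_ne_zero).preimage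
    (continuous_subtype_val.matrix_elem i j)

variable (p) in
/-- The elements of the acting group whose `p`-adic component is integral. -/
noncomputable def integralPart (v : Fin d → ℤ) (k : SLd d ℝ) :
    Subgroup (conjBy (HvS p v) ((k, 1) : SLS p d)) :=
  ((⊤ : Subgroup (SLd d ℝ)).prod (intSL p d)).subgroupOf _

theorem mem_integralPart {v : Fin d → ℤ} {k : SLd d ℝ}
    {h : conjBy (HvS p v) ((k, 1) : SLS p d)} :
    h ∈ integralPart p v k ↔ NormLe 1 h.1.2.1 := by
  rw [integralPart, Subgroup.mem_subgroupOf, Subgroup.mem_prod, mem_intSL_iff]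
  exact and_iff_right (Subgroup.mem_top _)

theorem conjBy_HvS_fst {v : Fin d → ℤ} {k : SLd d ℝ} (hk : k ∈ SOd d ℝ)
    (h : conjBy (HvS p v) ((k, 1) : SLS p d)) : h.1.1 ∈ SOd d ℝ := by
  have h1 : k * h.1.1 * k⁻¹ ∈ SOd d ℝ := (mem_conjBy.1 h.2).1.1
  have h2 : h.1.1 = k⁻¹ * (k * h.1.1 * k⁻¹) * k := by group
  rw [h2]
  exact mul_mem (mul_mem (inv_mem hk) h1) hk

theorem conjBy_HvS_snd {v : Fin d → ℤ} {k : SLd d ℝ}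
    (h : conjBy (HvS p v) ((k, 1) : SLS p d)) : h.1.2 ∈ stabSO ℚ_[p] v := by
  have h1 : 1 * h.1.2 * 1⁻¹ ∈ stabSO ℚ_[p] v := (mem_conjBy.1 h.2).2
  simpa using h1

/-- Orthogonality bounds the real entries by 1 and integrality bounds the `p`-adic ones, so this is
the trace of a product of unit balls on a closed subgroup. -/
theorem isCompact_integralPart {v : Fin d → ℤ} {k : SLd d ℝ} (hk : k ∈ SOd d ℝ) :
    IsCompact (integralPart p v k : Set (conjBy (HvS p v) ((k, 1) : SLS p d))) := by
  have hcl : IsClosed (HvS p v : Set (SLS p d)) := by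
    rw [HvS, Subgroup.coe_prod]
    exact (isClosed_stabSO ℝ v).prod (isClosed_stabSO ℚ_[p] v)
  have hemb : Topology.IsClosedEmbedding
      (fun h : conjBy (HvS p v) ((k, 1) : SLS p d) => (h.1.1.1, h.1.2.1)) :=
    (SpecialLinearGroup.isClosedEmbedding_val.prodMap
      SpecialLinearGroup.isClosedEmbedding_val).comp
        (isClosed_conjBy _ hcl _).isClosedEmbedding_subtypeVal
  have hcpt : ∀ (K : Type) [NormedField K] [ProperSpace K],
      IsCompact {A : Matrix (Fin d) (Fin d) K | ∀ i j, ‖A i j‖ ≤ 1} := by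
    intro K _ _
    have h1 : {A : Matrix (Fin d) (Fin d) K | ∀ i j, ‖A i j‖ ≤ 1} =
        Set.univ.pi fun _ => Set.univ.pi fun _ => Metric.closedBall (0 : K) 1 := by
      ext A
      refine ⟨fun h i _ j _ => mem_closedBall_zero_iff.2 (h i j),
        fun h i j => mem_closedBall_zero_iff.1 (h i trivial j trivial)⟩
    rw [h1]
    exact isCompact_univ_pi fun _ => isCompact_univ_pi fun _ => isCompact_closedBall _ _
  have h2 := hemb.isCompact_preimage ((hcpt ℝ).prod (hcpt ℚ_[p]))
  convert h2 using 1
  ext h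
  rw [SetLike.mem_coe, mem_integralPart]
  exact ⟨fun h3 => ⟨fun i j => SOd.abs_le_one (conjBy_HvS_fst hk h) i j, h3⟩, fun h3 => h3.2⟩

instance countable_ZInv (p : ℕ) : Countable (ZInv p) :=
  inferInstanceAs (Countable {q : ℚ // q ∈ ZInv p})

instance countable_SLd_ZInv (p d : ℕ) : Countable (SLd d (ZInv p)) :=
  Function.Injective.countable (f := fun γ : SLd d (ZInv p) => fun i j => γ.1 i j)
    fun γ δ h => by ext i j; exact congrArg Subtype.val (congrFun (congrFun h i) j)

variable (p) in
/-- The stabilizer of the base point in the acting group. -/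
noncomputable abbrev orbitLattice (v : Fin d → ℤ) (k : SLd d ℝ) :
    Subgroup (conjBy (HvS p v) ((k, 1) : SLS p d)) :=
  (conjBy ((Gamma4 p d).map (diagEmbed p d)) ((k, 1) : SLS p d)).subgroupOf _

theorem mem_orbitLattice {v : Fin d → ℤ} {k : SLd d ℝ}
    {h : conjBy (HvS p v) ((k, 1) : SLS p d)} :
    h ∈ orbitLattice p v k ↔ ∃ γ ∈ Gamma4 p d,
      h.1 = ((k, 1) : SLS p d)⁻¹ * diagEmbed p d γ * (k, 1) := by
  rw [Subgroup.mem_subgroupOf, mem_conjBy]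
  constructor
  · rintro ⟨γ, hγ, h1⟩
    exact ⟨γ, hγ, by rw [h1]; group⟩
  · rintro ⟨γ, hγ, h1⟩
    exact ⟨γ, hγ, by rw [h1]; group⟩

instance countable_orbitLattice (v : Fin d → ℤ) (k : SLd d ℝ) :
    Countable (orbitLattice p v k) := by
  have h1 : ((conjBy ((Gamma4 p d).map (diagEmbed p d)) ((k, 1) : SLS p d) :
      Subgroup (SLS p d)) : Set (SLS p d)).Countable :=
    ((Set.to_countable (Gamma4 p d : Set (SLd d (ZInv p)))).image _).image _
  exact (h1.preimage Subtype.val_injective).to_subtype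

/-- The trace of the square is invariant under conjugation, so it is integral as soon as some
conjugate of the `p`-adic component is. -/
theorem orbitLattice_free (hodd : Odd p) (hd : d < 16) {v : Fin d → ℤ} {k : SLd d ℝ}
    {γ : conjBy (HvS p v) ((k, 1) : SLS p d)} (hγ : γ ∈ orbitLattice p v k)
    (h : conjBy (HvS p v) ((k, 1) : SLS p d)) (hK : h⁻¹ * γ * h ∈ integralPart p v k) :
    γ = 1 := by
  obtain ⟨δ, hδ, h1⟩ := mem_orbitLattice.1 hγ
  rw [mem_integralPart] at hK
  have h2 : γ.1.2 = (diagEmbed p d δ).2 := by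
    rw [h1]
    change 1⁻¹ * (diagEmbed p d δ).2 * 1 = _
    simp
  have h3 : ((h⁻¹ * γ * h : conjBy (HvS p v) ((k, 1) : SLS p d)).1.2).1 =
      (h.1.2⁻¹).1 * (diagEmbed p d δ).2.1 * h.1.2.1 := by
    rw [← h2]; rfl
  rw [h3] at hK
  have h4 : h.1.2.1 * (h.1.2⁻¹).1 = 1 := congrArg Subtype.val (mul_inv_cancel h.1.2)
  have h5 : δ = 1 := by
    refine Gamma4.eq_one_of_trace hodd hd hδ ?_
    have h6 := (hK.mul_one hK).trace zero_le_one
    have h7 : (h.1.2⁻¹).1 * (diagEmbed p d δ).2.1 * h.1.2.1 *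
        ((h.1.2⁻¹).1 * (diagEmbed p d δ).2.1 * h.1.2.1) =
        (h.1.2⁻¹).1 * ((diagEmbed p d δ).2.1 * (diagEmbed p d δ).2.1 * h.1.2.1) := by
      simp only [Matrix.mul_assoc]
      rw [← Matrix.mul_assoc h.1.2.1 (h.1.2⁻¹).1, h4, Matrix.one_mul]
    rwa [h7, trace_mul_comm, Matrix.mul_assoc, h4, Matrix.mul_one] at h6
  apply Subtype.ext
  rw [h1, h5, map_one]
  simp

/-- The group `integralPart` puts no condition on the real component, so only the `p`-adic component
of a representative matters. -/
theorem finite_doubleCosets (hodd : Odd p) (v : Fin d → ℤ) (k : SLd d ℝ) :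
    Finite (DoubleCoset.Quotient (orbitLattice p v k : Set (conjBy (HvS p v) ((k, 1) : SLS p d)))
      (integralPart p v k : Set (conjBy (HvS p v) ((k, 1) : SLS p d)))) := by
  obtain ⟨D, hD, f, hf⟩ := exists_finite_classes (p := p) hodd v
  have hsec : Function.Surjective (DoubleCoset.mk (orbitLattice p v k) (integralPart p v k)) :=
    Quotient.mk''_surjective
  refine Finite.of_injective (β := D)
    (fun q => f ⟨(Function.surjInv hsec q).1.2, conjBy_HvS_snd _⟩) fun q q' hqq' => ?_
  obtain ⟨γ, hγ, hγH, hint⟩ := hf _ _ hqq'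
  rw [← Function.surjInv_eq hsec q, ← Function.surjInv_eq hsec q']
  set a := Function.surjInv hsec q
  set b := Function.surjInv hsec q'
  let δ : conjBy (HvS p v) ((k, 1) : SLS p d) :=
    ⟨((k, 1) : SLS p d)⁻¹ * diagEmbed p d γ * (k, 1), mem_conjBy.2 (by
      have : ((k, 1) : SLS p d) * (((k, 1) : SLS p d)⁻¹ * diagEmbed p d γ * (k, 1)) *
        ((k, 1) : SLS p d)⁻¹ = diagEmbed p d γ := by group
      rwa [this])⟩
  have hδ : δ ∈ orbitLattice p v k := mem_orbitLattice.2 ⟨γ, hγ, rfl⟩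
  refine Quotient.sound' ((DoubleCoset.rel_iff).2 ⟨δ⁻¹, inv_mem hδ, a⁻¹ * δ * b, ?_, by group⟩)
  rw [mem_integralPart]
  have h1 : (a⁻¹ * δ * b).1.2 = a.1.2⁻¹ * (diagEmbed p d γ).2 * b.1.2 := by
    change a.1.2⁻¹ * (1⁻¹ * (diagEmbed p d γ).2 * 1) * b.1.2 = _
    simp
  rw [h1]
  exact hint

variable {n : ℕ}

theorem card_le_V4 (hd : n + 1 < 16) {v : Fin (n + 1) → ℤ} {k : SLd (n + 1) ℝ}
    (hadm : Admissible p v k) {Θ : Set (SOd (n + 1) ℝ)} (hΘ : IsOpen Θ) (hΘ1 : 1 ∈ Θ) :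
    (Nat.card (DoubleCoset.Quotient
      (orbitLattice p v k : Set (conjBy (HvS p v) ((k, 1) : SLS p (n + 1))))
      (integralPart p v k : Set (conjBy (HvS p v) ((k, 1) : SLS p (n + 1))))) : ℝ) ≤
      V4 p v k Θ := by
  have hodd : Odd p := by
    have := hadm.p_mod
    rw [Nat.odd_iff]; omega
  have := finite_doubleCosets hodd v k
  have hopen : IsOpen (integralPart p v k : Set (conjBy (HvS p v) ((k, 1) : SLS p (n + 1)))) :=
    (isOpen_univ.prod isOpen_intSL).preimage continuous_subtype_val
  obtain ⟨O, hO, hOΘ⟩ := isOpen_induced_iff.1 hΘ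
  -- Inside the acting group the `p`-adic component is orthogonal already, so membership in
  -- `SO_d(ℤ_p)` reduces to integrality.
  have hpre : ((↑) : conjBy (HvS p v) ((k, 1) : SLS p (n + 1)) → SLS p (n + 1)) ⁻¹'
      thetaSet p Θ = {h | h.1.1 ∈ O} ∩ integralPart p v k := by
    ext h
    rw [Set.mem_inter_iff, SetLike.mem_coe, mem_integralPart]
    constructor
    · rintro ⟨⟨θ, hθ, h1⟩, ⟨g, hg, h2⟩⟩
      refine ⟨?_, ?_⟩
      · change h.1.1 ∈ O
        rw [← h1]
        rw [← hOΘ] at hθ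
        exact hθ
      · rw [← mem_intSL_iff]
        exact ⟨g, h2⟩
    · rintro ⟨h1, h2⟩
      refine ⟨⟨⟨h.1.1, conjBy_HvS_fst hadm.k_mem h⟩, ?_, rfl⟩, ?_⟩
      · rw [← hOΘ]
        exact h1
      · obtain ⟨g, hg⟩ := mem_intSL_iff.2 h2
        refine ⟨g, ?_, hg⟩
        have h3 := SOd.mul_transpose (conjBy_HvS_snd h).1
        have h4 : h.1.2.1 = g.1.map PadicInt.Coe.ringHom := by rw [← hg]; rfl
        rw [SetLike.mem_coe, mem_SOd_iff]
        apply Matrix.map_injective (f := PadicInt.Coe.ringHom (p := p)) Subtype.val_injective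
        rw [h4] at h3
        change (g.1 * g.1ᵀ).map _ = (1 : Matrix _ _ ℤ_[p]).map _
        rw [Matrix.map_mul, Matrix.transpose_map, h3]
        exact (Matrix.map_one _ (map_zero _) (map_one _)).symm
  refine card_le_orbitVolume _ _ _ _ (integralPart p v k) hopen
    (isCompact_integralPart hadm.k_mem) ?_ ?_ ?_ (fun γ hγ h hK => orbitLattice_free hodd hd hγ h hK)
  · rw [hpre]
    exact (hO.preimage (continuous_fst.comp continuous_subtype_val)).inter hopen
  · exact ⟨⟨1, hΘ1, rfl⟩, ⟨1, one_mem _, map_one _⟩⟩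
  · rw [hpre]
    exact Set.inter_subset_right

theorem one_le_V4 (hd : n + 1 < 16) {v : Fin (n + 1) → ℤ} {k : SLd (n + 1) ℝ}
    (hadm : Admissible p v k) {Θ : Set (SOd (n + 1) ℝ)} (hΘ : IsOpen Θ) (hΘ1 : 1 ∈ Θ) :
    1 ≤ V4 p v k Θ := by
  have hodd : Odd p := by
    have := hadm.p_mod
    rw [Nat.odd_iff]; omega
  have := finite_doubleCosets hodd v k
  refine le_trans ?_ (card_le_V4 hd hadm hΘ hΘ1)
  exact_mod_cast Nat.card_pos

/-- The pigeonhole principle: more than `V₄` elements of `ℍ_v(ℚ_p)` contain two that are related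
by `Γ₄ ∩ ℍ_v` up to an integral matrix. -/
theorem exists_collision (hd : n + 1 < 16) {v : Fin (n + 1) → ℤ} {k : SLd (n + 1) ℝ}
    (hadm : Admissible p v k) {Θ : Set (SOd (n + 1) ℝ)} (hΘ : IsOpen Θ) (hΘ1 : 1 ∈ Θ)
    {ι : Type*} [Fintype ι] (hι : V4 p v k Θ < Fintype.card ι) (g : ι → SLd (n + 1) ℚ_[p])
    (hg : ∀ i, g i ∈ stabSO ℚ_[p] v) :
    ∃ i j, i ≠ j ∧ ∃ γ ∈ Gamma4 p (n + 1), diagEmbed p (n + 1) γ ∈ HvS p v ∧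
      NormLe 1 ((g i)⁻¹ * (diagEmbed p (n + 1) γ).2 * g j).1 := by
  have hodd : Odd p := by
    have := hadm.p_mod
    rw [Nat.odd_iff]; omega
  have := finite_doubleCosets hodd v k
  have hlt := (card_le_V4 hd hadm hΘ hΘ1).trans_lt hι
  let G : ι → conjBy (HvS p v) ((k, 1) : SLS p (n + 1)) := fun i =>
    ⟨(1, g i), mem_conjBy.2 ⟨by
      change k * 1 * k⁻¹ ∈ stabSO ℝ v
      simp, by
      change 1 * g i * 1⁻¹ ∈ stabSO ℚ_[p] v
      simpa using hg i⟩⟩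
  have hninj : ¬ Function.Injective
      (fun i => DoubleCoset.mk (orbitLattice p v k) (integralPart p v k) (G i)) := by
    intro hinj
    have h1 := Nat.card_le_card_of_injective _ hinj
    rw [Nat.card_eq_fintype_card] at h1
    exact absurd h1 (not_le.2 (by exact_mod_cast hlt))
  obtain ⟨i, j, hij, hne⟩ := Function.not_injective_iff.1 hninj
  obtain ⟨a, ha, b, hb, hab⟩ := DoubleCoset.rel_iff.1 (Quotient.exact' hij)
  obtain ⟨γ, hγ, h1⟩ := mem_orbitLattice.1 ha
  -- The double coset relation reads `g j = γ (g i) b`, so the integral element is `b = (g i)⁻¹ γ⁻¹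
  -- (g j)`.
  refine ⟨i, j, hne, γ⁻¹, inv_mem hγ, ?_, ?_⟩
  · rw [map_inv]
    refine inv_mem ?_
    have h2 := mem_conjBy.1 a.2
    rw [h1] at h2
    convert h2 using 1
    group
  · rw [mem_integralPart] at hb
    have h3 : b.1.2 = (g i)⁻¹ * (diagEmbed p (n + 1) γ⁻¹).2 * g j := by
      have h4 : a.1.2 = (diagEmbed p (n + 1) γ).2 := by
        rw [h1]
        change 1⁻¹ * (diagEmbed p (n + 1) γ).2 * 1 = _
        simp
      have h5 : g j = a.1.2 * g i * b.1.2 := congrArg (fun x => x.1.2) hab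
      rw [h5, h4, map_inv]
      change _ = (g i)⁻¹ * (diagEmbed p (n + 1) γ).2⁻¹ * _
      group
    rwa [h3] at hb

end Collision

/-! ### Eichler transvections and hyperbolic tori -/

section Isometries

variable {d : ℕ} {K : Type*} [Field K]

theorem mul_transpose_eq_one_of_dotProduct {M : Matrix (Fin d) (Fin d) K}
    (h : ∀ x y : Fin d → K, (x ᵥ* M) ⬝ᵥ (y ᵥ* M) = x ⬝ᵥ y) : M * Mᵀ = 1 := by
  ext i j
  have h1 := h (Pi.single i 1) (Pi.single j 1)
  rw [single_one_vecMul, single_one_vecMul, single_one_dotProduct] at h1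
  rw [Matrix.mul_apply', Matrix.one_apply]
  refine Eq.trans h1 ?_
  rw [Pi.single_apply]

theorem matrix_ext_of_vecMul {M N : Matrix (Fin d) (Fin d) K}
    (h : ∀ x : Fin d → K, x ᵥ* M = x ᵥ* N) : M = N := by
  ext i j
  have h1 := h (Pi.single i 1)
  rw [single_one_vecMul, single_one_vecMul] at h1
  exact congrFun h1 j

theorem det_one_add_vecMulVec (a b : Fin d → K) : (1 + vecMulVec a b).det = 1 + b ⬝ᵥ a := by
  rw [vecMulVec_eq Unit]
  exact det_one_add_replicateCol_mul_replicateRow a b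

/-- The Eichler transvection attached to an isotropic vector `e` and a vector `x ⊥ e`. -/
def eichler (e x : Fin d → K) : Matrix (Fin d) (Fin d) K :=
  (1 + vecMulVec e (x + (x ⬝ᵥ x / 2) • e)) * (1 + vecMulVec (-x) e)

/-- The isometry with `e ↦ s⁻¹ e` and `f ↦ s f`, for a hyperbolic pair `e, f`. -/
def hypTorus (e f : Fin d → K) (s : K) : Matrix (Fin d) (Fin d) K :=
  (1 + vecMulVec e ((s - 1) • f)) * (1 + vecMulVec f ((s⁻¹ - 1) • e))

variable {e f x : Fin d → K} {s : K}

theorem vecMul_eichler (h2 : (2 : K) ≠ 0) (hex : e ⬝ᵥ x = 0) (y : Fin d → K) :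
    y ᵥ* eichler e x = y + (y ⬝ᵥ e) • x - (y ⬝ᵥ x + (x ⬝ᵥ x / 2) * (y ⬝ᵥ e)) • e := by
  rw [eichler, ← vecMul_vecMul, vecMul_add, vecMul_one, vecMul_vecMulVec, vecMul_add, vecMul_one,
    vecMul_vecMulVec, add_dotProduct, smul_dotProduct, add_dotProduct, smul_dotProduct,
    dotProduct_neg, dotProduct_neg, dotProduct_neg, hex]
  simp only [smul_eq_mul]
  ext i
  simp only [Pi.add_apply, Pi.sub_apply, Pi.smul_apply, smul_eq_mul]
  field_simp
  ring

theorem det_eichler (hee : e ⬝ᵥ e = 0) (hex : e ⬝ᵥ x = 0) : (eichler e x).det = 1 := by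
  rw [eichler, det_mul, det_one_add_vecMulVec, det_one_add_vecMulVec, add_dotProduct,
    smul_dotProduct, dotProduct_neg, dotProduct_comm x e, hee, hex]
  simp

theorem vecMul_hypTorus (hff : f ⬝ᵥ f = 0) (y : Fin d → K) :
    y ᵥ* hypTorus e f s = y + ((s - 1) * (y ⬝ᵥ e)) • f + ((s⁻¹ - 1) * (y ⬝ᵥ f)) • e := by
  rw [hypTorus, ← vecMul_vecMul, vecMul_add, vecMul_one, vecMul_vecMulVec, vecMul_add, vecMul_one,
    vecMul_vecMulVec, add_dotProduct, smul_dotProduct, smul_dotProduct, hff]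
  simp only [smul_eq_mul, mul_zero, add_zero]
  ext i
  simp only [Pi.add_apply, Pi.smul_apply, smul_eq_mul]
  ring

theorem det_hypTorus (hs : s ≠ 0) (hef : e ⬝ᵥ f = 1) : (hypTorus e f s).det = 1 := by
  rw [hypTorus, det_mul, det_one_add_vecMulVec, det_one_add_vecMulVec, smul_dotProduct,
    smul_dotProduct, hef, dotProduct_comm f e, hef]
  simp [hs]

theorem eichler_mul_transpose (h2 : (2 : K) ≠ 0) (hee : e ⬝ᵥ e = 0) (hex : e ⬝ᵥ x = 0) :
    eichler e x * (eichler e x)ᵀ = 1 := by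
  refine mul_transpose_eq_one_of_dotProduct fun y z => ?_
  rw [vecMul_eichler h2 hex, vecMul_eichler h2 hex]
  simp only [add_dotProduct, sub_dotProduct, dotProduct_add, dotProduct_sub, smul_dotProduct,
    dotProduct_smul, smul_eq_mul, hee, hex, dotProduct_comm x e, dotProduct_comm e z,
    dotProduct_comm x z]
  field_simp
  ring

theorem hypTorus_mul_transpose (hs : s ≠ 0) (hee : e ⬝ᵥ e = 0) (hff : f ⬝ᵥ f = 0)
    (hef : e ⬝ᵥ f = 1) : hypTorus e f s * (hypTorus e f s)ᵀ = 1 := by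
  refine mul_transpose_eq_one_of_dotProduct fun y z => ?_
  rw [vecMul_hypTorus hff, vecMul_hypTorus hff]
  simp only [add_dotProduct, dotProduct_add, smul_dotProduct,
    dotProduct_smul, smul_eq_mul, hee, hff, hef, dotProduct_comm f e, dotProduct_comm e z,
    dotProduct_comm f z]
  field_simp
  ring

end Isometries

/-! ### Integral vectors, and conjugation by the torus -/

section IntVec

variable {p : ℕ} [hp : Fact p.Prime] {d : ℕ}

/-- All coordinates of the vector are `p`-adic integers. -/
def IntVec (x : Fin d → ℚ_[p]) : Prop := ∀ i, ‖x i‖ ≤ 1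

theorem IntVec.add {x y : Fin d → ℚ_[p]} (hx : IntVec x) (hy : IntVec y) : IntVec (x + y) :=
  fun i => Padic.norm_add_le_of_le (hx i) (hy i)

theorem IntVec.sub {x y : Fin d → ℚ_[p]} (hx : IntVec x) (hy : IntVec y) : IntVec (x - y) :=
  fun i => Padic.norm_sub_le_of_le (hx i) (hy i)

theorem IntVec.smul {c : ℚ_[p]} {x : Fin d → ℚ_[p]} (hc : ‖c‖ ≤ 1) (hx : IntVec x) :
    IntVec (c • x) := fun i => by
  rw [Pi.smul_apply, smul_eq_mul, norm_mul]
  exact mul_le_one₀ hc (norm_nonneg _) (hx i)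

theorem IntVec.dotProduct {x y : Fin d → ℚ_[p]} (hx : IntVec x) (hy : IntVec y) :
    ‖x ⬝ᵥ y‖ ≤ 1 := by
  simpa using Padic.norm_dotProduct_le zero_le_one zero_le_one hx hy

theorem IntVec.vecMul {x : Fin d → ℚ_[p]} {M : Matrix (Fin d) (Fin d) ℚ_[p]} (hx : IntVec x)
    (hM : NormLe 1 M) : IntVec (x ᵥ* M) := NormLe.vecMul_one hx hM

theorem IntVec.single (i : Fin d) : IntVec (Pi.single i (1 : ℚ_[p])) := fun j => by
  rw [Pi.single_apply]; split_ifs <;> simp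

theorem NormLe.of_vecMul {M : Matrix (Fin d) (Fin d) ℚ_[p]}
    (h : ∀ x : Fin d → ℚ_[p], IntVec x → IntVec (x ᵥ* M)) : NormLe 1 M := fun i j => by
  have := h _ (IntVec.single i) j
  rwa [single_one_vecMul] at this

theorem Padic.norm_mul_le_one {x y : ℚ_[p]} (hx : ‖x‖ ≤ 1) (hy : ‖y‖ ≤ 1) : ‖x * y‖ ≤ 1 := by
  rw [norm_mul]; exact mul_le_one₀ hx (norm_nonneg _) hy

theorem Padic.norm_two (hodd : Odd p) : ‖(2 : ℚ_[p])‖ = 1 := by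
  have h1 : ‖((2 : ℤ) : ℚ_[p])‖ ≤ 1 := Padic.norm_int_le_one 2
  have h2 : ¬ ‖((2 : ℤ) : ℚ_[p])‖ < 1 := by
    rw [Padic.norm_intCast_lt_one_iff]
    intro h
    have h3 : p ∣ 2 := by exact_mod_cast h
    have h4 := (Nat.prime_dvd_prime_iff_eq hp.out Nat.prime_two).1 h3
    rw [h4] at hodd
    exact absurd hodd (by decide)
  push_cast at h1 h2
  exact le_antisymm h1 (not_lt.1 h2)

theorem Padic.norm_div_two (hodd : Odd p) (x : ℚ_[p]) : ‖x / 2‖ = ‖x‖ := by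
  rw [norm_div, Padic.norm_two hodd, div_one]

variable {e f x : Fin d → ℚ_[p]} {s : ℚ_[p]}

theorem normLe_eichler (hodd : Odd p) (he : IntVec e) (hx : IntVec x) (hex : e ⬝ᵥ x = 0) :
    NormLe 1 (eichler e x) := by
  refine NormLe.of_vecMul fun y hy => ?_
  rw [vecMul_eichler two_ne_zero hex]
  refine (hy.add (hx.smul (hy.dotProduct he))).sub (he.smul ?_)
  refine Padic.norm_add_le_of_le (hy.dotProduct hx) (Padic.norm_mul_le_one ?_ (hy.dotProduct he))
  rw [Padic.norm_div_two hodd]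
  exact hx.dotProduct hx

/-- Conjugating an integral isometry by `hypTorus e f s` keeps it integral when it preserves the
line of `e` modulo `s`. -/
theorem normLe_conj_hypTorus (hodd : Odd p) (he : IntVec e) (hf : IntVec f)
    (hee : e ⬝ᵥ e = 0) (hff : f ⬝ᵥ f = 0) (hef : e ⬝ᵥ f = 1) (hs0 : s ≠ 0) (hs : ‖s‖ ≤ 1)
    {k : Matrix (Fin d) (Fin d) ℚ_[p]} (hk : NormLe 1 k) (hkk : k * kᵀ = 1)
    {ρ ρ' : ℚ_[p]} {r q : Fin d → ℚ_[p]} (hρ : ‖ρ‖ = 1) (hρ' : ‖ρ'‖ ≤ 1) (hr : IntVec r)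
    (hq : IntVec q) (hek : e ᵥ* k = ρ • e + s • r) (hek' : e ᵥ* kᵀ = ρ' • e + s • q) :
    NormLe 1 (hypTorus e f s * k * hypTorus e f s⁻¹) := by
  -- The image `e k = ρ e + s r` is isotropic, so `2 ρ s (r · e) + s² (r · r) = 0`. As `2ρ` is a
  -- unit, `s` divides `r · e`.
  have hre : ∃ c : ℚ_[p], ‖c‖ ≤ 1 ∧ r ⬝ᵥ e = s * c := by
    have h1 : (e ᵥ* k) ⬝ᵥ (e ᵥ* k) = 0 := by
      rw [← mulVec_transpose k e, dotProduct_mulVec, mulVec_transpose, vecMul_vecMul, hkk,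
        vecMul_one, hee]
    rw [hek] at h1
    simp only [add_dotProduct, dotProduct_add, smul_dotProduct, dotProduct_smul, smul_eq_mul, hee,
      dotProduct_comm e r] at h1
    have hρ0 : ρ ≠ 0 := by
      intro h
      rw [h, norm_zero] at hρ
      exact zero_ne_one hρ
    refine ⟨-(r ⬝ᵥ r / 2) / ρ, ?_, ?_⟩
    · rw [norm_div, norm_neg, Padic.norm_div_two hodd, hρ, div_one]
      exact hr.dotProduct hr
    · have h2 : s * (2 * ρ * (r ⬝ᵥ e) + s * (r ⬝ᵥ r)) = 0 := by linear_combination h1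
      have h3 := (mul_eq_zero.1 h2).resolve_left hs0
      field_simp
      linear_combination h3
  obtain ⟨c, hc, hre⟩ := hre
  refine NormLe.of_vecMul fun y hy => ?_
  -- This is the image of `y` under the first torus factor without its only possibly nonintegral
  -- part `s⁻¹ (y · f) e`. Applying `k` to that part leaves a multiple of `e` and the integral
  -- vector `(y · f) r`.
  set y₀ := y + ((s - 1) * (y ⬝ᵥ e)) • f - (y ⬝ᵥ f) • e with hy₀
  have hs1 : ‖s - 1‖ ≤ 1 := Padic.norm_sub_le_of_le hs (by simp)
  have hy₀i : IntVec y₀ :=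
    (hy.add (hf.smul (Padic.norm_mul_le_one hs1 (hy.dotProduct he)))).sub
      (he.smul (hy.dotProduct hf))
  have hy₀e : y₀ ⬝ᵥ e = s * (y ⬝ᵥ e) := by
    rw [hy₀]
    simp only [add_dotProduct, sub_dotProduct, smul_dotProduct, smul_eq_mul, hee,
      dotProduct_comm f e, hef]
    ring
  set z := y₀ ᵥ* k + (y ⬝ᵥ f) • r with hz
  have hzi : IntVec z := (hy₀i.vecMul hk).add (hr.smul (hy.dotProduct hf))
  -- The last torus factor divides the `f`-coordinate `z · e` by `s`, so `s` must divide it. This is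
  -- where the condition on `e kᵀ` enters.
  have hze : z ⬝ᵥ e = s * (ρ' * (y ⬝ᵥ e) + y₀ ⬝ᵥ q + (y ⬝ᵥ f) * c) := by
    have h1 : (y₀ ᵥ* k) ⬝ᵥ e = y₀ ⬝ᵥ (e ᵥ* kᵀ) := by
      rw [← dotProduct_mulVec, vecMul_transpose]
    rw [hz, add_dotProduct, smul_dotProduct, h1, hek', hre]
    simp only [dotProduct_add, dotProduct_smul, smul_eq_mul, hy₀e]
    ring
  have hyT : y ᵥ* hypTorus e f s = y₀ + (s⁻¹ * (y ⬝ᵥ f)) • e := by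
    rw [vecMul_hypTorus hff, hy₀]
    ext i
    simp only [Pi.add_apply, Pi.sub_apply, Pi.smul_apply, smul_eq_mul]
    ring
  have hyTk : y ᵥ* hypTorus e f s ᵥ* k = z + (s⁻¹ * (y ⬝ᵥ f) * ρ) • e := by
    rw [hyT, add_vecMul, smul_vecMul, hek, hz]
    ext i
    simp only [Pi.add_apply, Pi.smul_apply, smul_eq_mul]
    field_simp
    ring
  have hfin : y ᵥ* (hypTorus e f s * k * hypTorus e f s⁻¹) =
      z + ((1 - s) * (ρ' * (y ⬝ᵥ e) + y₀ ⬝ᵥ q + (y ⬝ᵥ f) * c)) • f + ((s - 1) * (z ⬝ᵥ f)) • e +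
        ((y ⬝ᵥ f) * ρ) • e := by
    rw [← vecMul_vecMul, ← vecMul_vecMul, hyTk, vecMul_hypTorus hff]
    simp only [add_dotProduct, smul_dotProduct, smul_eq_mul, hee, hef, hze, inv_inv]
    ext i
    simp only [Pi.add_apply, Pi.smul_apply, smul_eq_mul]
    field_simp
    ring
  rw [hfin]
  have hs1' : ‖1 - s‖ ≤ 1 := Padic.norm_sub_le_of_le (by simp) hs
  refine ((hzi.add (hf.smul (Padic.norm_mul_le_one hs1' ?_))).add
    (he.smul (Padic.norm_mul_le_one hs1 (hzi.dotProduct hf)))).add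
      (he.smul (Padic.norm_mul_le_one (hy.dotProduct hf) hρ.le))
  exact Padic.norm_add_le_of_le (Padic.norm_add_le_of_le
    (Padic.norm_mul_le_one hρ' (hy.dotProduct he)) (hy₀i.dotProduct hq))
      (Padic.norm_mul_le_one (hy.dotProduct hf) hc)

end IntVec

/-! ### The translates `u(c) a(s)` and their separation -/

section HyperbolicTranslates

variable {p : ℕ} [hp : Fact p.Prime] {d : ℕ} {e f y : Fin d → ℚ_[p]} {s : ℚ_[p]}

theorem hypTorus_mul_inv (hs : s ≠ 0) (hee : e ⬝ᵥ e = 0) (hff : f ⬝ᵥ f = 0)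
    (hef : e ⬝ᵥ f = 1) : hypTorus e f s * hypTorus e f s⁻¹ = 1 := by
  refine matrix_ext_of_vecMul fun y => ?_
  rw [← vecMul_vecMul, vecMul_hypTorus hff, vecMul_hypTorus hff, vecMul_one]
  simp only [add_dotProduct, smul_dotProduct, smul_eq_mul, hee, hff, hef, dotProduct_comm f e,
    inv_inv]
  ext i
  simp only [Pi.add_apply, Pi.smul_apply, smul_eq_mul]
  field_simp
  ring

/-- Multiplication by `eichler e (c • y)` followed by `hypTorus e f s`. -/
noncomputable def hypTranslate (e f y : Fin d → ℚ_[p]) (s c : ℚ_[p]) :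
    Matrix (Fin d) (Fin d) ℚ_[p] :=
  eichler e (c • y) * hypTorus e f s

theorem vecMul_hypTranslate (hff : f ⬝ᵥ f = 0) (hee : e ⬝ᵥ e = 0) (hef : e ⬝ᵥ f = 1)
    (hey : e ⬝ᵥ y = 0) (hfy : f ⬝ᵥ y = 0) (c : ℚ_[p]) (w : Fin d → ℚ_[p]) :
    w ᵥ* hypTranslate e f y s c =
      w + (c * (w ⬝ᵥ e)) • y - (c * (w ⬝ᵥ y) + c ^ 2 * (y ⬝ᵥ y) / 2 * (w ⬝ᵥ e)) • e +
        ((s - 1) * (w ⬝ᵥ e)) • f +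
        ((s⁻¹ - 1) * (w ⬝ᵥ f - c * (w ⬝ᵥ y) - c ^ 2 * (y ⬝ᵥ y) / 2 * (w ⬝ᵥ e))) • e := by
  have hex : e ⬝ᵥ (c • y) = 0 := by rw [dotProduct_smul, hey, smul_zero]
  rw [hypTranslate, ← vecMul_vecMul, vecMul_eichler two_ne_zero hex, vecMul_hypTorus hff]
  simp only [add_dotProduct, sub_dotProduct, smul_dotProduct, dotProduct_smul, smul_eq_mul, hee,
    hef, dotProduct_comm y e, hey, dotProduct_comm y f, hfy]
  ext i
  simp only [Pi.add_apply, Pi.sub_apply, Pi.smul_apply, smul_eq_mul]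
  ring

theorem hypTranslate_mul_transpose (hs : s ≠ 0) (hee : e ⬝ᵥ e = 0) (hff : f ⬝ᵥ f = 0)
    (hef : e ⬝ᵥ f = 1) (hey : e ⬝ᵥ y = 0) (c : ℚ_[p]) :
    hypTranslate e f y s c * (hypTranslate e f y s c)ᵀ = 1 := by
  have hex : e ⬝ᵥ (c • y) = 0 := by rw [dotProduct_smul, hey, smul_zero]
  rw [hypTranslate, transpose_mul, Matrix.mul_assoc, ← Matrix.mul_assoc (hypTorus e f s),
    hypTorus_mul_transpose hs hee hff hef, Matrix.one_mul,
    eichler_mul_transpose two_ne_zero hee hex]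

theorem normLe_hypTranslate (hodd : Odd p) (hs : s ≠ 0) (hs1 : ‖s‖ ≤ 1) (he : IntVec e)
    (hf : IntVec f) (hy : IntVec y) (hff : f ⬝ᵥ f = 0) (hey : e ⬝ᵥ y = 0) {c : ℚ_[p]}
    (hc : ‖c‖ ≤ 1) : NormLe ‖s⁻¹‖ (hypTranslate e f y s c) := by
  have hex : e ⬝ᵥ (c • y) = 0 := by rw [dotProduct_smul, hey, smul_zero]
  have hinv : 1 ≤ ‖s⁻¹‖ := by
    rw [norm_inv]
    exact (one_le_inv₀ (norm_pos_iff.2 hs)).2 hs1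
  have hT : NormLe ‖s⁻¹‖ (hypTorus e f s) := by
    intro i j
    have h1 : hypTorus e f s i j =
        (Pi.single i 1 + ((s - 1) * (Pi.single i 1 ⬝ᵥ e)) • f - (Pi.single i 1 ⬝ᵥ f) • e :
          Fin d → ℚ_[p]) j + s⁻¹ * ((Pi.single i 1 ⬝ᵥ f) * e j) := by
      have h2 := congrFun (vecMul_hypTorus (e := e) (s := s) hff (Pi.single i 1)) j
      rw [single_one_vecMul] at h2
      refine Eq.trans h2 ?_
      simp only [Pi.add_apply, Pi.sub_apply, Pi.smul_apply, smul_eq_mul]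
      ring
    rw [h1]
    have hsi := IntVec.single (p := p) (d := d) i
    refine Padic.norm_add_le_of_le ((((hsi.add (hf.smul (Padic.norm_mul_le_one
      (Padic.norm_sub_le_of_le hs1 (by simp)) (hsi.dotProduct he)))).sub
        (he.smul (hsi.dotProduct hf))) j).trans hinv) ?_
    rw [norm_mul]
    exact mul_le_of_le_one_right (norm_nonneg _)
      (Padic.norm_mul_le_one (hsi.dotProduct hf) (he j))
  have := (normLe_eichler hodd he (hy.smul hc) hex).mul zero_le_one (norm_nonneg _) hT
  rwa [one_mul] at this

theorem norm_sub_le_of_hypTranslate (hodd : Odd p) (hs : s ≠ 0) (hf : IntVec f)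
    (hee : e ⬝ᵥ e = 0) (hff : f ⬝ᵥ f = 0)
    (hef : e ⬝ᵥ f = 1) (hey : e ⬝ᵥ y = 0) (hfy : f ⬝ᵥ y = 0) (hyy : ‖y ⬝ᵥ y‖ = 1)
    {c c' : ℚ_[p]} {M : Matrix (Fin d) (Fin d) ℚ_[p]} (hM : NormLe 1 M)
    (h : hypTranslate e f y s c * M = hypTranslate e f y s c') : ‖c' - c‖ ≤ ‖s‖ := by
  -- This is the image of `f` under the inverse of the transvection with parameter `c`. The first
  -- translate sends it to `s f`; the second sends it to a vector whose product with `f` is `-s⁻¹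
  -- (c' - c)² (y · y) / 2`. Comparing the two through the integral `M` gives `|c' - c|² ≤ |s|²`.
  set u : Fin d → ℚ_[p] := f - c • y - (c ^ 2 * (y ⬝ᵥ y) / 2) • e with hu
  have hue : u ⬝ᵥ e = 1 := by
    simp only [hu, sub_dotProduct, smul_dotProduct, smul_eq_mul, hee, dotProduct_comm f e, hef,
      dotProduct_comm y e, hey]
    ring
  have huf : u ⬝ᵥ f = -(c ^ 2 * (y ⬝ᵥ y) / 2) := by
    simp only [hu, sub_dotProduct, smul_dotProduct, smul_eq_mul, hff, hef,
      dotProduct_comm y f, hfy]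
    ring
  have huy : u ⬝ᵥ y = -(c * (y ⬝ᵥ y)) := by
    simp only [hu, sub_dotProduct, smul_dotProduct, smul_eq_mul, hfy, hey]
    ring
  have h1 : u ᵥ* hypTranslate e f y s c = s • f := by
    rw [vecMul_hypTranslate hff hee hef hey hfy, hue, huf, huy, hu]
    ext i
    simp only [Pi.add_apply, Pi.sub_apply, Pi.smul_apply, smul_eq_mul]
    field_simp
    ring
  have h2 : (u ᵥ* hypTranslate e f y s c') ⬝ᵥ f = -(s⁻¹ * ((c' - c) ^ 2 * (y ⬝ᵥ y) / 2)) := by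
    rw [vecMul_hypTranslate hff hee hef hey hfy, hue, huf, huy]
    simp only [add_dotProduct, sub_dotProduct, smul_dotProduct, smul_eq_mul, hff, hef, huf,
      dotProduct_comm y f, hfy]
    field_simp
    ring
  have h3 : s * ((f ᵥ* M) ⬝ᵥ f) = -(s⁻¹ * ((c' - c) ^ 2 * (y ⬝ᵥ y) / 2)) := by
    rw [← h2, ← h, ← vecMul_vecMul, h1, smul_vecMul, smul_dotProduct, smul_eq_mul]
  have h4 := congrArg norm h3
  rw [norm_mul, norm_neg, norm_mul, Padic.norm_div_two hodd, norm_mul, hyy, mul_one, norm_pow,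
    norm_inv] at h4
  have hspos : 0 < ‖s‖ := norm_pos_iff.2 hs
  have h5 : ‖c' - c‖ ^ 2 ≤ ‖s‖ ^ 2 := by
    have h6 : ‖c' - c‖ ^ 2 = ‖s‖ ^ 2 * ‖(f ᵥ* M) ⬝ᵥ f‖ := by
      field_simp at h4
      linarith
    rw [h6]
    exact mul_le_of_le_one_right (by positivity) ((hf.vecMul hM).dotProduct hf)
  exact (sq_le_sq₀ (norm_nonneg _) hspos.le).1 h5

/-- An isometry that fixes a vector in general position with respect to two translates and
relates them up to an integral matrix is itself integral. -/
theorem normLe_of_fixes (hodd : Odd p) (he : IntVec e) (hf : IntVec f) (hy : IntVec y)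
    (hs0 : s ≠ 0) (hs : ‖s‖ ≤ 1) (hee : e ⬝ᵥ e = 0) (hff : f ⬝ᵥ f = 0)
    (hef : e ⬝ᵥ f = 1) (hey : e ⬝ᵥ y = 0) (hfy : f ⬝ᵥ y = 0) {w : Fin d → ℚ_[p]}
    (hw : IntVec w) {c c' : ℚ_[p]} (hc : ‖c‖ ≤ 1) (hc' : ‖c'‖ ≤ 1)
    (hC : ‖w ⬝ᵥ f - c * (w ⬝ᵥ y) - c ^ 2 * (y ⬝ᵥ y) / 2 * (w ⬝ᵥ e)‖ = 1)
    (hC' : ‖w ⬝ᵥ f - c' * (w ⬝ᵥ y) - c' ^ 2 * (y ⬝ᵥ y) / 2 * (w ⬝ᵥ e)‖ = 1)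
    {γ k : Matrix (Fin d) (Fin d) ℚ_[p]} (hγw : w ᵥ* γ = w) (hk : NormLe 1 k)
    (hkk : k * kᵀ = 1) (hγ : γ * hypTranslate e f y s c' = hypTranslate e f y s c * k) :
    NormLe 1 γ := by
  -- The transvection gives `w` the `e`-coordinate displayed here, and the torus divides it by `s`.
  -- After scaling by `s` this multiple of `e` is all that remains modulo `s`.
  have hRc : ∀ c : ℚ_[p], ‖c‖ ≤ 1 → ∃ R : Fin d → ℚ_[p], IntVec R ∧
      s • (w ᵥ* hypTranslate e f y s c) =
        (w ⬝ᵥ f - c * (w ⬝ᵥ y) - c ^ 2 * (y ⬝ᵥ y) / 2 * (w ⬝ᵥ e)) • e + s • R := by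
    intro c hc
    have hc2 : ‖c ^ 2 * (y ⬝ᵥ y) / 2 * (w ⬝ᵥ e)‖ ≤ 1 := by
      refine Padic.norm_mul_le_one ?_ (hw.dotProduct he)
      rw [Padic.norm_div_two hodd]
      exact Padic.norm_mul_le_one (by rw [norm_pow]; exact pow_le_one₀ (norm_nonneg _) hc)
        (hy.dotProduct hy)
    have hcy : ‖c * (w ⬝ᵥ y)‖ ≤ 1 := Padic.norm_mul_le_one hc (hw.dotProduct hy)
    refine ⟨w + (c * (w ⬝ᵥ e)) • y - (c * (w ⬝ᵥ y) + c ^ 2 * (y ⬝ᵥ y) / 2 * (w ⬝ᵥ e)) • e +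
        ((s - 1) * (w ⬝ᵥ e)) • f -
        (w ⬝ᵥ f - c * (w ⬝ᵥ y) - c ^ 2 * (y ⬝ᵥ y) / 2 * (w ⬝ᵥ e)) • e, ?_, ?_⟩
    · refine (((hw.add (hy.smul (Padic.norm_mul_le_one hc (hw.dotProduct he)))).sub
        (he.smul (Padic.norm_add_le_of_le hcy hc2))).add (hf.smul (Padic.norm_mul_le_one
          (Padic.norm_sub_le_of_le hs (by simp)) (hw.dotProduct he)))).sub
            (he.smul (Padic.norm_sub_le_of_le (Padic.norm_sub_le_of_le (hw.dotProduct hf) hcy) hc2))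
    · rw [vecMul_hypTranslate hff hee hef hey hfy]
      ext i
      simp only [Pi.add_apply, Pi.sub_apply, Pi.smul_apply, smul_eq_mul]
      field_simp
      ring
  obtain ⟨R, hR, hRe⟩ := hRc c hc
  obtain ⟨R', hR', hRe'⟩ := hRc c' hc'
  set C := w ⬝ᵥ f - c * (w ⬝ᵥ y) - c ^ 2 * (y ⬝ᵥ y) / 2 * (w ⬝ᵥ e)
  set C' := w ⬝ᵥ f - c' * (w ⬝ᵥ y) - c' ^ 2 * (y ⬝ᵥ y) / 2 * (w ⬝ᵥ e)
  have hne : ∀ x : ℚ_[p], ‖x‖ = 1 → x ≠ 0 := fun x h h0 => by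
    rw [h0, norm_zero] at h
    exact zero_ne_one h
  -- As `γ` fixes `w`, the matrix `k` sends the first translate of `w` to the second. Since `C` and
  -- `C'` are units, both `k` and `kᵀ` therefore preserve the line of `e` modulo `s`.
  have key : (C • e + s • R) ᵥ* k = C' • e + s • R' := by
    rw [← hRe, ← hRe', smul_vecMul, vecMul_vecMul, ← hγ, ← vecMul_vecMul, hγw]
  have key' : (C' • e + s • R') ᵥ* kᵀ = C • e + s • R := by
    rw [← key, vecMul_vecMul, hkk, vecMul_one]
  have hdiv : ∀ {A A' : ℚ_[p]} {r r' : Fin d → ℚ_[p]} {m : Matrix (Fin d) (Fin d) ℚ_[p]},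
      ‖A‖ = 1 → (A • e + s • r) ᵥ* m = A' • e + s • r' →
      e ᵥ* m = (A' / A) • e + s • (A⁻¹ • (r' - r ᵥ* m)) := by
    intro A A' r r' m hA h
    have hA0 := hne A hA
    rw [add_vecMul, smul_vecMul, smul_vecMul] at h
    have h1 : A • (e ᵥ* m) = A' • e + s • r' - s • (r ᵥ* m) := by rw [← h]; abel
    rw [← inv_smul_smul₀ hA0 (e ᵥ* m), h1]
    ext i
    simp only [Pi.add_apply, Pi.sub_apply, Pi.smul_apply, smul_eq_mul]
    field_simp
    ring
  have hTkT : NormLe 1 (hypTorus e f s * k * hypTorus e f s⁻¹) := by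
    refine normLe_conj_hypTorus hodd he hf hee hff hef hs0 hs hk hkk
      (ρ := C' / C) (ρ' := C / C') ?_ ?_ ?_ ?_ (hdiv hC key) (hdiv hC' key')
    · rw [norm_div, hC, hC', div_one]
    · rw [norm_div, hC, hC', div_one]
    · exact (hR'.sub (hR.vecMul hk)).smul (by rw [norm_inv, hC, inv_one])
    · exact (hR.sub (hR'.vecMul hk.transpose)).smul (by rw [norm_inv, hC', inv_one])
  have hex : ∀ c : ℚ_[p], e ⬝ᵥ (c • y) = 0 := fun c => by rw [dotProduct_smul, hey, smul_zero]
  have hγeq : γ = eichler e (c • y) * (hypTorus e f s * k * hypTorus e f s⁻¹) *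
      (eichler e (c' • y))ᵀ := by
    have h1 : γ * hypTranslate e f y s c' * (hypTorus e f s⁻¹ * (eichler e (c' • y))ᵀ) = γ := by
      rw [hypTranslate, Matrix.mul_assoc, Matrix.mul_assoc, ← Matrix.mul_assoc (hypTorus e f s),
        hypTorus_mul_inv hs0 hee hff hef, Matrix.one_mul,
        eichler_mul_transpose two_ne_zero hee (hex c'), Matrix.mul_one]
    rw [← h1, hγ, hypTranslate]
    simp only [Matrix.mul_assoc]
  rw [hγeq]
  exact ((normLe_eichler hodd he (hy.smul hc) (hex c)).mul_one hTkT).mul_one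
    (normLe_eichler hodd he (hy.smul hc') (hex c')).transpose

end HyperbolicTranslates

/-! ### Rational fixed vectors and their `p`-adic projections -/

section FixedVectors

variable {p : ℕ} {d : ℕ}

theorem mem_fixedSpace_iff {γ : SLd d (ZInv p)} {w : Fin d → ℚ} :
    w ∈ fixedSpace p γ ↔ w ᵥ* ratMat γ = w := by
  rw [fixedSpace, Module.End.mem_eigenspace_iff, one_smul]
  rfl

variable [hp : Fact p.Prime]

theorem vecMul_diagEmbed_of_mem_fixedSpace {γ : SLd d (ZInv p)} {w : Fin d → ℚ}
    (h : w ∈ fixedSpace p γ) :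
    (fun i => (w i : ℚ_[p])) ᵥ* (diagEmbed p d γ).2.1 = fun i => (w i : ℚ_[p]) := by
  ext i
  have h1 := congrArg (Rat.castHom ℚ_[p]) (congrFun (mem_fixedSpace_iff.1 h) i)
  rw [RingHom.map_vecMul] at h1
  exact h1

theorem Gamma4.eq_one_of_normLe (hodd : Odd p) (hd : d < 16) {γ : SLd d (ZInv p)}
    (hγ : γ ∈ Gamma4 p d) (hn : NormLe 1 (diagEmbed p d γ).2.1) : γ = 1 :=
  Gamma4.eq_one_of_trace hodd hd hγ ((hn.mul_one hn).trace zero_le_one)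

theorem exists_unit_normalization {w : Fin d → ℚ_[p]} (hw : w ≠ 0) :
    ∃ a : ℚ_[p], IntVec (a • w) ∧ ∃ j, (a • w) j = 1 := by
  obtain ⟨j, hj⟩ := Function.ne_iff.1 hw
  have : Nonempty (Fin d) := ⟨j⟩
  obtain ⟨i, hi⟩ := Finite.exists_max fun i => ‖w i‖
  have hwi : w i ≠ 0 := norm_pos_iff.1 ((norm_pos_iff.2 hj).trans_le (hi j))
  refine ⟨(w i)⁻¹, fun k => ?_, i, inv_mul_cancel₀ hwi⟩
  rw [Pi.smul_apply, smul_eq_mul, norm_mul, norm_inv]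
  exact (inv_mul_le_one₀ (norm_pos_iff.2 hwi)).2 (hi k)

theorem cast_sub_smul_ne_zero {v : Fin d → ℤ} {w : Fin d → ℚ} (hw : w ∉ lineOf v) (c : ℚ) :
    (fun i => (w i : ℚ_[p])) - (c : ℚ_[p]) • (fun i => (v i : ℚ_[p])) ≠ 0 := fun h => by
  refine hw (Submodule.mem_span_singleton.2 ⟨c, ?_⟩)
  ext i
  have h1 : (w i : ℚ_[p]) - (c : ℚ_[p]) * (v i : ℚ_[p]) = 0 := congrFun h i
  have h2 : (w i : ℚ_[p]) = ((c * v i : ℚ) : ℚ_[p]) := by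
    push_cast
    linear_combination h1
  exact (Rat.cast_injective h2).symm

/-- A rational vector outside `ℚ v` yields an integral and primitive `p`-adic vector orthogonal
to `v` that is fixed by every element of the stabilizer of `v` that fixes the given vector. -/
theorem exists_orthogonal_intVec {v : Fin d → ℤ} (hv : v ⬝ᵥ v ≠ 0) {w : Fin d → ℚ}
    (hw : w ∉ lineOf v) :
    ∃ u : Fin d → ℚ_[p], IntVec u ∧ (∃ j, u j = 1) ∧ u ⬝ᵥ (fun i => (v i : ℚ_[p])) = 0 ∧
      u ⬝ᵥ u ≠ 0 ∧
      ∀ γ : SLd d (ZInv p), diagEmbed p d γ ∈ HvS p v → w ∈ fixedSpace p γ →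
        u ᵥ* (diagEmbed p d γ).2.1 = u := by
  -- Coefficient of the orthogonal projection of `w` to `ℚv`. An element of the stabilizer of `v`
  -- that fixes `w` also fixes the difference.
  set c : ℚ := (w ⬝ᵥ fun i => (v i : ℚ)) / ((v ⬝ᵥ v : ℤ) : ℚ) with hc
  obtain ⟨a, ha, j, hj⟩ := exists_unit_normalization (cast_sub_smul_ne_zero (p := p) hw c)
  refine ⟨_, ha, ⟨j, hj⟩, ?_, ?_, fun γ hγ hwγ => ?_⟩
  · have h0 : ((v ⬝ᵥ v : ℤ) : ℚ) ≠ 0 := by exact_mod_cast hv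
    have h1 : (w ⬝ᵥ fun i => (v i : ℚ)) = c * ((v ⬝ᵥ v : ℤ) : ℚ) := by
      rw [hc]; field_simp
    have h2 := congrArg (Rat.cast : ℚ → ℚ_[p]) h1
    simp only [dotProduct] at h2
    push_cast at h2
    rw [smul_dotProduct, sub_dotProduct, smul_dotProduct, smul_eq_mul, smul_eq_mul]
    simp only [dotProduct]
    rw [h2, sub_self, mul_zero]
  · have ha0 : a ≠ 0 := fun h => by
      rw [h, zero_smul, Pi.zero_apply] at hj
      exact zero_ne_one hj
    have h1 := cast_sub_smul_ne_zero (p := p) hw c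
    have h2 : (fun i => (w i : ℚ_[p])) - (c : ℚ_[p]) • (fun i => (v i : ℚ_[p])) =
        fun i => ((w i - c * v i : ℚ) : ℚ_[p]) := by
      ext i
      simp
    rw [h2] at h1 ⊢
    rw [smul_dotProduct, dotProduct_smul]
    refine smul_ne_zero ha0 (smul_ne_zero ha0 fun h3 => h1 ?_)
    -- Isotropic vectors may exist over `ℚ_p`, so anisotropy is deduced from positivity over `ℚ`,
    -- before scaling.
    have h4 : (∑ i, (w i - c * v i) * (w i - c * v i) : ℚ) = 0 := by
      apply Rat.cast_injective (α := ℚ_[p])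
      push_cast
      simpa [dotProduct] using h3
    ext i
    have h5 := (Finset.sum_eq_zero_iff_of_nonneg (fun i _ => mul_self_nonneg _)).1 h4 i
      (Finset.mem_univ i)
    rw [mul_self_eq_zero.1 h5, Rat.cast_zero, Pi.zero_apply]
  · have h1 : (fun i => (v i : ℚ_[p])) ᵥ* (diagEmbed p d γ).2.1 = fun i => (v i : ℚ_[p]) :=
      hγ.2.2
    rw [smul_vecMul, sub_vecMul, smul_vecMul, h1, vecMul_diagEmbed_of_mem_fixedSpace hwγ]

end FixedVectors

/-! ### Hyperbolic frames and the choice of a residue class -/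

section HyperbolicFrame

variable {p : ℕ} [hp : Fact p.Prime] {d : ℕ}

/-- A hyperbolic pair `e, f` together with unit vectors `y i` orthogonal to it, all integral and
orthogonal to `v`, whose span contains the integral vectors orthogonal to `v`. -/
structure IsHyperbolicFrame {r : ℕ} (v e f : Fin d → ℚ_[p]) (y : Fin r → Fin d → ℚ_[p]) :
    Prop where
  int_e : IntVec e
  int_f : IntVec f
  int_y : ∀ i, IntVec (y i)
  e_e : e ⬝ᵥ e = 0
  f_f : f ⬝ᵥ f = 0
  e_f : e ⬝ᵥ f = 1
  e_y : ∀ i, e ⬝ᵥ y i = 0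
  f_y : ∀ i, f ⬝ᵥ y i = 0
  y_y : ∀ i, ‖y i ⬝ᵥ y i‖ = 1
  v_e : v ⬝ᵥ e = 0
  v_f : v ⬝ᵥ f = 0
  v_y : ∀ i, v ⬝ᵥ y i = 0
  bound : ∀ (w : Fin d → ℚ_[p]) (c : ℝ), 0 ≤ c → w ⬝ᵥ v = 0 → ‖w ⬝ᵥ e‖ ≤ c → ‖w ⬝ᵥ f‖ ≤ c →
    (∀ i, ‖w ⬝ᵥ y i‖ ≤ c) → ∀ j, ‖w j‖ ≤ c

theorem Padic.norm_le_inv_of_lt_one {x : ℚ_[p]} (h : ‖x‖ < 1) : ‖x‖ ≤ (p : ℝ)⁻¹ := by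
  have h1 := (Padic.norm_le_pow_iff_norm_lt_pow_add_one x (-1)).2 (by simpa using h)
  simpa using h1

theorem Padic.norm_add_lt_one {x y : ℚ_[p]} (hx : ‖x‖ < 1) (hy : ‖y‖ < 1) : ‖x + y‖ < 1 :=
  (Padic.nonarchimedean x y).trans_lt (max_lt hx hy)

/-- Modulo the odd prime `p`, a polynomial of degree at most 2 that vanishes at `0`, `1` and `-1`
has only zero coefficients. -/
theorem exists_norm_quadratic_eq_one (hodd : Odd p) {a b c q : ℚ_[p]} (ha : ‖a‖ ≤ 1)
    (hb : ‖b‖ ≤ 1) (hc : ‖c‖ ≤ 1) (hq : ‖q‖ = 1) (h : ¬ (‖a‖ < 1 ∧ ‖b‖ < 1 ∧ ‖c‖ < 1)) :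
    ∃ τ : ℚ_[p], ‖τ‖ ≤ 1 ∧ ‖a - τ * b - τ ^ 2 * q / 2 * c‖ = 1 := by
  have hle : ∀ τ : ℚ_[p], ‖τ‖ ≤ 1 → ‖a - τ * b - τ ^ 2 * q / 2 * c‖ ≤ 1 := fun τ hτ => by
    refine Padic.norm_sub_le_of_le (Padic.norm_sub_le_of_le ha (Padic.norm_mul_le_one hτ hb)) (Padic.norm_mul_le_one ?_ hc)
    rw [Padic.norm_div_two hodd, norm_mul, hq, mul_one, norm_pow]
    exact pow_le_one₀ (norm_nonneg _) hτ
  by_contra! hne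
  have hlt : ∀ τ : ℚ_[p], ‖τ‖ ≤ 1 → ‖a - τ * b - τ ^ 2 * q / 2 * c‖ < 1 := fun τ hτ =>
    lt_of_le_of_ne (hle τ hτ) (hne τ hτ)
  have h0 := hlt 0 (by simp)
  have h1 := hlt 1 (by simp)
  have h2 := hlt (-1) (by simp)
  have ha' : ‖a‖ < 1 := by simpa using h0
  have hneg : ∀ x : ℚ_[p], ‖x‖ < 1 → ‖-x‖ < 1 := fun x hx => by rwa [norm_neg]
  refine h ⟨ha', ?_, ?_⟩
  · have := Padic.norm_add_lt_one h2 (hneg _ h1)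
    rw [show a - -1 * b - (-1) ^ 2 * q / 2 * c + -(a - 1 * b - 1 ^ 2 * q / 2 * c) = 2 * b by ring,
      norm_mul, Padic.norm_two hodd, one_mul] at this
    exact this
  · have h3 := Padic.norm_add_lt_one (hneg _ h1) (hneg _ h2)
    have h4 := Padic.norm_add_lt_one h3 (Padic.norm_add_lt_one ha' ha')
    rw [show -(a - 1 * b - 1 ^ 2 * q / 2 * c) + -(a - -1 * b - (-1) ^ 2 * q / 2 * c) + (a + a) =
      q * c by ring, norm_mul, hq, one_mul] at h4
    exact h4

/-- The residue of the polynomial modulo `p` depends only on the residue of its argument. -/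
theorem norm_quadratic_eq_one_of_norm_sub_lt (hodd : Odd p) {a b c q τ τ' : ℚ_[p]}
    (hb : ‖b‖ ≤ 1) (hc : ‖c‖ ≤ 1) (hq : ‖q‖ ≤ 1) (hτ : ‖τ‖ ≤ 1) (hτ' : ‖τ'‖ ≤ 1)
    (hlt : ‖τ - τ'‖ < 1) (h : ‖a - τ * b - τ ^ 2 * q / 2 * c‖ = 1) :
    ‖a - τ' * b - τ' ^ 2 * q / 2 * c‖ = 1 := by
  have h1 : ‖(τ - τ') * (b + (τ + τ') * q / 2 * c)‖ < 1 := by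
    rw [norm_mul]
    refine mul_lt_one_of_nonneg_of_lt_one_left (norm_nonneg _) hlt ?_
    refine Padic.norm_add_le_of_le hb (Padic.norm_mul_le_one ?_ hc)
    rw [Padic.norm_div_two hodd]
    exact Padic.norm_mul_le_one (Padic.norm_add_le_of_le hτ hτ') hq
  rw [show a - τ' * b - τ' ^ 2 * q / 2 * c = (a - τ * b - τ ^ 2 * q / 2 * c) +
    (τ - τ') * (b + (τ + τ') * q / 2 * c) by ring, Padic.add_eq_max_of_ne, h, max_eq_left h1.le]
  rw [h]
  exact h1.ne'

end HyperbolicFrame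

/-! ### A small element of `Γ₄` that moves a given vector -/

section ExistsNotFixing

variable {p : ℕ} [hp : Fact p.Prime] {n : ℕ}

theorem exists_Gamma4_not_fixing {r : ℕ} [NeZero r] (hd : n + 1 < 16) {v : Fin (n + 1) → ℤ}
    {k : SLd (n + 1) ℝ} (hadm : Admissible p v k) {Θ : Set (SOd (n + 1) ℝ)} (hΘ : IsOpen Θ)
    (hΘ1 : 1 ∈ Θ) {e f : Fin (n + 1) → ℚ_[p]} {y : Fin r → Fin (n + 1) → ℚ_[p]}
    (hF : IsHyperbolicFrame (fun i => (v i : ℚ_[p])) e f y) {w : Fin (n + 1) → ℚ}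
    (hw : w ∉ lineOf v) :
    ∃ γ ∈ Gamma4 p (n + 1), diagEmbed p (n + 1) γ ∈ HvS p v ∧ w ∉ fixedSpace p γ ∧
      NormLe ((p : ℝ) ^ 4 * V4 p v k Θ ^ 2) (diagEmbed p (n + 1) γ).2.1 := by
  have hodd : Odd p := Nat.odd_iff.2 (by have := hadm.p_mod; omega)
  have hp1 : (1 : ℝ) < p := by exact_mod_cast hp.out.one_lt
  have hp0 : (0 : ℝ) < p := one_pos.trans hp1
  have hv0 : v ⬝ᵥ v ≠ 0 := fun h => hadm.not_dvd (h ▸ dvd_zero _)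
  obtain ⟨u, hu, ⟨j₀, hj₀⟩, huv, -, huγ⟩ := exists_orthogonal_intVec (p := p) hv0 hw
  -- Otherwise all products of `u` with the frame would be divisible by `p`, hence all coordinates
  -- of `u`, one of which is 1.
  obtain ⟨i, hi⟩ : ∃ i, ¬ (‖u ⬝ᵥ f‖ < 1 ∧ ‖u ⬝ᵥ y i‖ < 1 ∧ ‖u ⬝ᵥ e‖ < 1) := by
    by_contra! h
    have h1 := hF.bound u (p : ℝ)⁻¹ (inv_nonneg.2 hp0.le) huv
      (Padic.norm_le_inv_of_lt_one (h 0).2.2) (Padic.norm_le_inv_of_lt_one (h 0).1)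
      (fun i => Padic.norm_le_inv_of_lt_one (h i).2.1) j₀
    rw [hj₀, norm_one] at h1
    exact absurd h1 (not_le.2 (inv_lt_one_of_one_lt₀ hp1))
  have hq := hF.y_y i
  obtain ⟨τ, hτ, hCτ⟩ := exists_norm_quadratic_eq_one hodd (hu.dotProduct hF.int_f)
    (hu.dotProduct (hF.int_y i)) (hu.dotProduct hF.int_e) hq hi
  -- Here `p ^ N ≤ V₄ < p ^ (N + 1)`, so `p ^ (N + 1)` translates force a collision.
  obtain ⟨N, hN1, hN2⟩ := exists_nat_pow_near (one_le_V4 hd hadm hΘ hΘ1) hp1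
  -- The parameters `τ + p t` stay in the residue class of `τ`, so separating `p ^ (N + 1)` of them
  -- takes one more power of `p`. The two translates then bound `γ` by `p ^ (2N + 4) ≤ p ^ 4 V₄²`.
  set s : ℚ_[p] := (p : ℚ_[p]) ^ (N + 2) with hs
  have hp0' : (p : ℚ_[p]) ≠ 0 := by exact_mod_cast hp.out.ne_zero
  have hs0 : s ≠ 0 := pow_ne_zero _ hp0'
  have hsn : ‖s‖ = ((p : ℝ) ^ (N + 2))⁻¹ := by
    rw [hs, norm_pow, Padic.norm_p, inv_pow]
  have hs1 : ‖s‖ ≤ 1 := by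
    rw [hsn]
    exact inv_le_one_of_one_le₀ (one_le_pow₀ hp1.le)
  set c : Fin (p ^ (N + 1)) → ℚ_[p] := fun t => τ + p * ((t : ℕ) : ℤ) with hcdef
  have hpt : ∀ t : ℤ, ‖(p : ℚ_[p]) * (t : ℚ_[p])‖ < 1 := fun t => by
    rw [norm_mul]
    exact mul_lt_one_of_nonneg_of_lt_one_left (norm_nonneg _) Padic.norm_p_lt_one
      (Padic.norm_int_le_one t)
  have hc : ∀ t, ‖c t‖ ≤ 1 := fun t => Padic.norm_add_le_of_le hτ (hpt _).le
  have hC : ∀ t, ‖u ⬝ᵥ f - c t * (u ⬝ᵥ y i) - c t ^ 2 * (y i ⬝ᵥ y i) / 2 * (u ⬝ᵥ e)‖ = 1 :=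
    fun t => norm_quadratic_eq_one_of_norm_sub_lt hodd
      (hu.dotProduct (hF.int_y i)) (hu.dotProduct hF.int_e) hq.le hτ (hc t) (by
        rw [hcdef, sub_add_cancel_left, norm_neg]
        exact hpt _) hCτ
  have hTT : ∀ t, hypTranslate e f (y i) s (c t) * (hypTranslate e f (y i) s (c t))ᵀ = 1 :=
    fun t => hypTranslate_mul_transpose hs0 hF.e_e hF.f_f hF.e_f (hF.e_y i) (c t)
  have hdet : ∀ t, (hypTranslate e f (y i) s (c t)).det = 1 := fun t => by
    rw [hypTranslate, det_mul, det_eichler hF.e_e, det_hypTorus hs0 hF.e_f, one_mul]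
    rw [dotProduct_smul, hF.e_y, smul_zero]
  let g : Fin (p ^ (N + 1)) → SLd (n + 1) ℚ_[p] := fun t => ⟨_, hdet t⟩
  have hgSO : ∀ t, g t ∈ SOd (n + 1) ℚ_[p] := fun t => mem_SOd_iff.2 (hTT t)
  have hg : ∀ t, g t ∈ stabSO ℚ_[p] v := fun t => by
    refine ⟨hgSO t, ?_⟩
    change _ ᵥ* hypTranslate e f (y i) s (c t) = _
    rw [vecMul_hypTranslate hF.f_f hF.e_e hF.e_f (hF.e_y i) (hF.f_y i), hF.v_e, hF.v_f, hF.v_y]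
    simp
  obtain ⟨a, b, hab, γ, hγ, hγv, hk⟩ := exists_collision hd hadm hΘ hΘ1
    (by rw [Fintype.card_fin]; exact_mod_cast hN2) g hg
  set K : SLd (n + 1) ℚ_[p] := (g a)⁻¹ * (diagEmbed p (n + 1) γ).2 * g b with hK
  have hKSO : K ∈ SOd (n + 1) ℚ_[p] :=
    mul_mem (mul_mem (inv_mem (hgSO a)) hγv.2.1) (hgSO b)
  have hγK : (diagEmbed p (n + 1) γ).2.1 * hypTranslate e f (y i) s (c b) =
      hypTranslate e f (y i) s (c a) * K.1 := by
    have : (diagEmbed p (n + 1) γ).2 * g b = g a * K := by rw [hK]; group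
    exact congrArg Subtype.val this
  refine ⟨γ, hγ, hγv, fun hwγ => hab ?_, ?_⟩
  · have hint := normLe_of_fixes hodd hF.int_e hF.int_f (hF.int_y i) hs0 hs1 hF.e_e hF.f_f hF.e_f
      (hF.e_y i) (hF.f_y i) hu (hc a) (hc b) (hC a) (hC b) (huγ γ hγv hwγ) hk
      (SOd.mul_transpose hKSO) hγK
    have hγ1 := Gamma4.eq_one_of_normLe hodd hd hγ hint
    rw [hγ1, map_one] at hγK
    have h1 := norm_sub_le_of_hypTranslate hodd hs0 hF.int_f hF.e_e hF.f_f hF.e_f (hF.e_y i)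
      (hF.f_y i) hq hk (hγK.symm.trans (Matrix.one_mul _))
    rw [hcdef, hsn] at h1
    simp only at h1
    rw [add_sub_add_left_eq_sub, ← mul_sub, norm_mul, Padic.norm_p, pow_succ' (p : ℝ) (N + 1),
      mul_inv, mul_le_mul_iff_right₀ (inv_pos.2 hp0), ← Int.cast_sub] at h1
    have h2 : ((p : ℝ) ^ (N + 1))⁻¹ = (p : ℝ) ^ (-((N + 1 : ℕ) : ℤ)) := by
      rw [_root_.zpow_neg, zpow_natCast]
    rw [h2, Padic.norm_int_le_pow_iff_dvd] at h1
    have h3 : ((a : ℕ) : ℤ) ≡ ((b : ℕ) : ℤ) [ZMOD ((p ^ (N + 1) : ℕ) : ℤ)] :=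
      Int.modEq_iff_dvd.2 (by exact_mod_cast h1)
    have h4 := Nat.ModEq.eq_of_lt_of_lt (Int.natCast_modEq_iff.1 h3) a.2 b.2
    exact Fin.ext h4
  · have hnT : ∀ t, NormLe ((p : ℝ) ^ (N + 2)) (hypTranslate e f (y i) s (c t)) := fun t => by
      have := normLe_hypTranslate hodd hs0 hs1 hF.int_e hF.int_f (hF.int_y i) hF.f_f (hF.e_y i)
        (hc t)
      rwa [norm_inv, hsn, inv_inv] at this
    have h1 : (diagEmbed p (n + 1) γ).2.1 =
        hypTranslate e f (y i) s (c a) * K.1 * (hypTranslate e f (y i) s (c b))ᵀ := by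
      rw [← hγK, Matrix.mul_assoc, hTT, Matrix.mul_one]
    rw [h1]
    have hpp : (0 : ℝ) ≤ (p : ℝ) ^ (N + 2) := by positivity
    refine (((hnT a).mul hpp zero_le_one hk).mul (by positivity) hpp (hnT b).transpose).mono ?_
    have h2 : (p : ℝ) ^ (N + 2) * 1 * (p : ℝ) ^ (N + 2) = (p : ℝ) ^ 4 * ((p : ℝ) ^ N) ^ 2 := by
      ring
    rw [h2]
    gcongr

end ExistsNotFixing

/-! ### Cutting the common fixed space down to a line -/

section Descent

variable {p : ℕ} {d : ℕ}

/-- If `γ - 1` had rank at most one, then `γ = 1 + a bᵀ`; determinant one forces `a · b = 0`, so `tr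
γ = d`, and positivity gives `γ = 1`. -/
theorem finrank_fixedSpace_add_two_le {γ : SLd d (ZInv p)} (hγ : γ ∈ Gamma4 p d) (h1 : γ ≠ 1) :
    Module.finrank ℚ (fixedSpace p γ) + 2 ≤ d := by
  by_contra hlt
  apply h1
  apply ratMat_injective
  set N : Matrix (Fin d) (Fin d) ℚ := ratMat γ - 1 with hN
  have hker : fixedSpace p γ = LinearMap.ker (vecMulLinear N) := by
    ext w
    rw [mem_fixedSpace_iff, LinearMap.mem_ker, vecMulLinear_apply, hN, vecMul_sub, vecMul_one,
      sub_eq_zero]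
  have h2 := LinearMap.finrank_range_add_finrank_ker (vecMulLinear N)
  rw [← hker, Module.finrank_fin_fun] at h2
  obtain ⟨b, hb⟩ := finrank_le_one_iff.1
    (show Module.finrank ℚ (LinearMap.range (vecMulLinear N)) ≤ 1 by omega)
  have hrow : ∀ i, ∃ a : ℚ, ∀ j, a * b.1 j = N i j := fun i => by
    obtain ⟨a, ha⟩ := hb ⟨Pi.single i 1 ᵥ* N, LinearMap.mem_range_self (vecMulLinear N) _⟩
    refine ⟨a, fun j => ?_⟩
    have h3 : a • b.1 = Pi.single i 1 ᵥ* N := congrArg Subtype.val ha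
    rw [single_one_vecMul] at h3
    exact congrFun h3 j
  choose a ha using hrow
  have hNab : N = vecMulVec a b.1 := by
    ext i j
    rw [vecMulVec_apply, ha]
  have hγN : ratMat γ = 1 + vecMulVec a b.1 := by rw [← hNab, hN]; abel
  have htr : (ratMat γ).trace = d := by
    have h3 := ratMat_det γ
    rw [hγN, det_one_add_vecMulVec] at h3
    rw [hγN, trace_add, trace_one, trace_vecMulVec, Fintype.card_fin, dotProduct_comm]
    linarith
  have h4 := trace_sub_one_mul_transpose (mem_Gamma4_iff.1 hγ).1
  rw [htr, sub_self, mul_zero] at h4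
  rw [ratMat_one]
  ext i j
  have h5 := (Finset.sum_eq_zero_iff_of_nonneg
    (fun i _ => Finset.sum_nonneg fun j _ => sq_nonneg _)).1 h4 i (Finset.mem_univ i)
  have h6 := (Finset.sum_eq_zero_iff_of_nonneg (fun j _ => sq_nonneg _)).1 h5 j (Finset.mem_univ j)
  have h7 := pow_eq_zero_iff two_ne_zero |>.1 h6
  exact sub_eq_zero.1 h7

theorem finrank_lineOf {v : Fin d → ℤ} (hv : v ≠ 0) : Module.finrank ℚ (lineOf v) = 1 := by
  refine finrank_span_singleton fun h => hv ?_
  ext i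
  have := congrFun h i
  simpa using this

/-- The first element leaves dimension at most `m + 1`. While the common fixed space is larger than
the line, an element moving one of its vectors outside the line lowers the dimension; `m` further
steps reach dimension 1. -/
theorem exists_iInf_fixedSpace_eq_lineOf {m : ℕ} {v : Fin (m + 3) → ℤ} (hv : v ≠ 0)
    (P : SLd (m + 3) (ZInv p) → Prop) (hP : ∀ γ, P γ → γ ∈ Gamma4 p (m + 3))
    (hPv : ∀ γ, P γ → lineOf v ≤ fixedSpace p γ)
    (hex : ∀ w, w ∉ lineOf v → ∃ γ, P γ ∧ w ∉ fixedSpace p γ) :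
    ∃ γ : Fin (m + 1) → SLd (m + 3) (ZInv p), (∀ i, P (γ i)) ∧
      (⨅ i, fixedSpace p (γ i)) = lineOf v := by
  have key : ∀ l : ℕ, ∃ γ : Fin (l + 1) → SLd (m + 3) (ZInv p), (∀ i, P (γ i)) ∧
      (Module.finrank ℚ (⨅ i, fixedSpace p (γ i) : Submodule ℚ (Fin (m + 3) → ℚ)) + l + 2 ≤ m + 3 ∨
        (⨅ i, fixedSpace p (γ i)) ≤ lineOf v) := by
    intro l
    induction l with
    | zero =>
      obtain ⟨w, hw⟩ : ∃ w, w ∉ lineOf v := by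
        by_contra! h
        have h1 := finrank_lineOf hv
        rw [(Submodule.eq_top_iff'.2 h), finrank_top, Module.finrank_fin_fun] at h1
        omega
      obtain ⟨γ, hγ, hwγ⟩ := hex w hw
      refine ⟨fun _ => γ, fun _ => hγ, Or.inl ?_⟩
      rw [iInf_const]
      refine finrank_fixedSpace_add_two_le (hP γ hγ) fun h => hwγ ?_
      rw [mem_fixedSpace_iff, h, ratMat_one, vecMul_one]
    | succ l ih =>
      obtain ⟨γ, hγ, h⟩ := ih
      by_cases hle : (⨅ i, fixedSpace p (γ i)) ≤ lineOf v
      -- The line has been reached early; repeating an element keeps the prescribed number.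
      · refine ⟨Fin.cons (γ 0) γ, Fin.forall_fin_succ.2 ⟨hγ 0, hγ⟩, Or.inr (le_trans ?_ hle)⟩
        exact le_iInf fun i => iInf_le (fun i => fixedSpace p ((Fin.cons (γ 0) γ : Fin (l + 2) →
          SLd (m + 3) (ZInv p)) i)) i.succ
      · obtain ⟨w, hw, hwv⟩ := SetLike.not_le_iff_exists.1 hle
        obtain ⟨γ', hγ', hwγ'⟩ := hex w hwv
        refine ⟨Fin.cons γ' γ, Fin.forall_fin_succ.2 ⟨hγ', hγ⟩, Or.inl ?_⟩
        have hlt : (⨅ i, fixedSpace p ((Fin.cons γ' γ : Fin (l + 2) → SLd (m + 3) (ZInv p)) i)) <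
            ⨅ i, fixedSpace p (γ i) := by
          refine lt_of_le_of_ne ?_ fun heq => ?_
          · exact le_iInf fun i => iInf_le (fun i => fixedSpace p ((Fin.cons γ' γ : Fin (l + 2) →
              SLd (m + 3) (ZInv p)) i)) i.succ
          · rw [← heq, Submodule.mem_iInf] at hw
            exact hwγ' (hw 0)
        have h1 := Submodule.finrank_lt_finrank_of_lt hlt
        have h2 := h.resolve_right hle
        omega
  obtain ⟨γ, hγ, h⟩ := key m
  refine ⟨γ, hγ, ?_⟩
  have hle : lineOf v ≤ ⨅ i, fixedSpace p (γ i) := le_iInf fun i => hPv _ (hγ i)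
  rcases h with h | h
  · exact (Submodule.eq_of_le_of_finrank_le hle (by rw [finrank_lineOf hv]; omega)).symm
  · exact le_antisymm h hle

end Descent

/-! ### Generators from a hyperbolic frame -/

section Conclusion

variable {p : ℕ} [hp : Fact p.Prime]

theorem lineOf_le_fixedSpace {d : ℕ} {v : Fin d → ℤ} {γ : SLd d (ZInv p)}
    (h : diagEmbed p d γ ∈ HvS p v) : lineOf v ≤ fixedSpace p γ := by
  rw [lineOf, Submodule.span_singleton_le_iff_mem, mem_fixedSpace_iff]
  ext i
  apply Rat.cast_injective (α := ℚ_[p])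
  have h1 := congrFun h.2.2 i
  have h2 := RingHom.map_vecMul (Rat.castHom ℚ_[p]) (ratMat γ) (fun i => (v i : ℚ)) i
  refine Eq.trans h2 (Eq.trans ?_ (h1.trans ?_))
  · rw [diagEmbed_snd]
    congr 1
  · simp

/-- A hyperbolic frame for `v` provides small elements of `Γ₄` that fix exactly `ℚ v`. -/
theorem exists_small_generators {m r : ℕ} [NeZero r] (hd : m + 3 < 16) {v : Fin (m + 3) → ℤ}
    {k : SLd (m + 3) ℝ} (hadm : Admissible p v k) {Θ : Set (SOd (m + 3) ℝ)} (hΘ : IsOpen Θ)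
    (hΘ1 : 1 ∈ Θ) {e f : Fin (m + 3) → ℚ_[p]} {y : Fin r → Fin (m + 3) → ℚ_[p]}
    (hF : IsHyperbolicFrame (fun i => (v i : ℚ_[p])) e f y) :
    ∃ γ : Fin (m + 1) → SLd (m + 3) (ZInv p),
      (∀ i, γ i ∈ Gamma4 p (m + 3) ∧ diagEmbed p (m + 3) (γ i) ∈ HvS p v) ∧
      (⨅ i, fixedSpace p (γ i)) = lineOf v ∧
      ∀ i, maxNorm (diagEmbed p (m + 3) (γ i)).1.1 ≤ 1 ∧
        maxNorm (diagEmbed p (m + 3) (γ i)).2.1 ≤ (p : ℝ) ^ 4 * V4 p v k Θ ^ 2 := by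
  have hv : v ≠ 0 := fun h => hadm.not_dvd (by rw [h, zero_dotProduct]; exact dvd_zero _)
  obtain ⟨γ, hγ, h⟩ := exists_iInf_fixedSpace_eq_lineOf hv
    (fun γ => γ ∈ Gamma4 p (m + 3) ∧ diagEmbed p (m + 3) γ ∈ HvS p v ∧
      NormLe ((p : ℝ) ^ 4 * V4 p v k Θ ^ 2) (diagEmbed p (m + 3) γ).2.1)
    (fun γ h => h.1) (fun γ h => lineOf_le_fixedSpace h.2.1) (fun w hw => by
      obtain ⟨γ, h1, h2, h3, h4⟩ := exists_Gamma4_not_fixing hd hadm hΘ hΘ1 hF hw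
      exact ⟨γ, ⟨h1, h2, h4⟩, h3⟩)
  exact ⟨γ, fun i => ⟨(hγ i).1, (hγ i).2.1⟩, h, fun i =>
    ⟨maxNorm_le (SOd.abs_le_one (hγ i).2.1.1.1), maxNorm_le (hγ i).2.2⟩⟩

end Conclusion

/-! ### Entries of the block embedding -/

section BlockEmbed

variable {n : ℕ} {R : Type*} [CommRing R]

theorem blockEmbed_castSucc_castSucc (s : SLd n R) (i j : Fin n) :
    (blockEmbed n R s).1 i.castSucc j.castSucc = s.1 i j := by
  change reindex finSumFinEquiv finSumFinEquiv (fromBlocks s.1 0 0 1) _ _ = _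
  rw [reindex_apply, submatrix_apply]
  have h (i : Fin n) : finSumFinEquiv.symm i.castSucc = (Sum.inl i : Fin n ⊕ Fin 1) :=
    finSumFinEquiv_symm_apply_castAdd i
  rw [h, h, fromBlocks_apply₁₁]

theorem blockEmbed_castSucc_last (s : SLd n R) (i : Fin n) :
    (blockEmbed n R s).1 i.castSucc (Fin.last n) = 0 := by
  change reindex finSumFinEquiv finSumFinEquiv (fromBlocks s.1 0 0 1) _ _ = _
  rw [reindex_apply, submatrix_apply]
  have h : finSumFinEquiv.symm i.castSucc = (Sum.inl i : Fin n ⊕ Fin 1) :=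
    finSumFinEquiv_symm_apply_castAdd i
  have h' : finSumFinEquiv.symm (Fin.last n) = (Sum.inr 0 : Fin n ⊕ Fin 1) :=
    finSumFinEquiv_symm_apply_natAdd (m := n) (0 : Fin 1)
  rw [h, h', fromBlocks_apply₁₂, Matrix.zero_apply]

theorem blockEmbed_last_castSucc (s : SLd n R) (i : Fin n) :
    (blockEmbed n R s).1 (Fin.last n) i.castSucc = 0 := by
  change reindex finSumFinEquiv finSumFinEquiv (fromBlocks s.1 0 0 1) _ _ = _
  rw [reindex_apply, submatrix_apply]
  have h : finSumFinEquiv.symm i.castSucc = (Sum.inl i : Fin n ⊕ Fin 1) :=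
    finSumFinEquiv_symm_apply_castAdd i
  have h' : finSumFinEquiv.symm (Fin.last n) = (Sum.inr 0 : Fin n ⊕ Fin 1) :=
    finSumFinEquiv_symm_apply_natAdd (m := n) (0 : Fin 1)
  rw [h, h', fromBlocks_apply₂₁, Matrix.zero_apply]

theorem blockEmbed_last_last (s : SLd n R) :
    (blockEmbed n R s).1 (Fin.last n) (Fin.last n) = 1 := by
  change reindex finSumFinEquiv finSumFinEquiv (fromBlocks s.1 0 0 1) _ _ = _
  rw [reindex_apply, submatrix_apply]
  have h' : finSumFinEquiv.symm (Fin.last n) = (Sum.inr 0 : Fin n ⊕ Fin 1) :=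
    finSumFinEquiv_symm_apply_natAdd (m := n) (0 : Fin 1)
  rw [h', fromBlocks_apply₂₂, Matrix.one_apply_eq]

end BlockEmbed

/-! ### Integral bases adapted to a `ℤ_p`-conjugacy -/

section AdaptedBasis

variable {p : ℕ} [hp : Fact p.Prime] {n : ℕ}

/-- The rows of `I` are a basis of `ℤ_p^{n+1}` whose Gram matrix, and the coordinates of `v` in
this basis, are invariant under the block embedding of `G`. -/
structure IsAdaptedBasis (v : Fin (n + 1) → ℚ_[p]) (G : Subgroup (SLd n ℚ_[p]))
    (M I : Matrix (Fin (n + 1)) (Fin (n + 1)) ℚ_[p]) : Prop where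
  int_M : NormLe 1 M
  int_I : NormLe 1 I
  mul_eq : M * I = 1
  gram : ∀ s ∈ G, (blockEmbed n _ s).1 * (I * Iᵀ) * (blockEmbed n _ s).1ᵀ = I * Iᵀ
  coord : ∀ s ∈ G, v ᵥ* M ᵥ* (blockEmbed n _ s).1 = v ᵥ* M

/-- Conjugation by `M = h` carries the block group into the stabilizer of `v`, so the form and `v`,
rewritten in the basis `I = h⁻¹`, become invariant. An inclusion in the stabilizer is enough, which
also covers the group generated by its unipotents. -/
theorem exists_isAdaptedBasis {v : Fin (n + 1) → ℤ} {H : Subgroup (SLd (n + 1) ℚ_[p])}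
    (hH : H ≤ stabSO ℚ_[p] v) {G : Subgroup (SLd n ℚ_[p])}
    (h : IsZpConj H (G.map (blockEmbed n ℚ_[p]))) :
    ∃ M I, IsAdaptedBasis (fun i => (v i : ℚ_[p])) G M I := by
  obtain ⟨h, hconj⟩ := h
  set M := h.1.map PadicInt.Coe.ringHom with hM
  set I := (h⁻¹).1.map PadicInt.Coe.ringHom with hI
  have hMI : M * I = 1 := by
    rw [hM, hI, ← Matrix.map_mul, Units.mul_inv]
    exact Matrix.map_one _ (map_zero _) (map_one _)
  have hIM : I * M = 1 := mul_eq_one_comm.1 hMI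
  have key : ∀ s ∈ G, ∃ g ∈ stabSO ℚ_[p] v, g.1 = M * (blockEmbed n ℚ_[p] s).1 * I := fun s hs => by
    refine ⟨⟨M * (blockEmbed n ℚ_[p] s).1 * I, ?_⟩, hH ((hconj _).2
      ⟨_, Subgroup.mem_map_of_mem _ hs, rfl⟩), rfl⟩
    rw [det_mul, det_mul, (blockEmbed n ℚ_[p] s).2, _root_.mul_one, ← det_mul, hMI, det_one]
  refine ⟨M, I, NormLe.map_coe _, NormLe.map_coe _, hMI, fun s hs => ?_, fun s hs => ?_⟩
  · obtain ⟨g, ⟨hg, -⟩, hgs⟩ := key s hs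
    have h1 := SOd.mul_transpose hg
    have h2 : I * g.1 = (blockEmbed n ℚ_[p] s).1 * I := by
      rw [hgs, ← Matrix.mul_assoc, ← Matrix.mul_assoc, hIM, Matrix.one_mul]
    calc (blockEmbed n _ s).1 * (I * Iᵀ) * (blockEmbed n _ s).1ᵀ
        = ((blockEmbed n _ s).1 * I) * ((blockEmbed n _ s).1 * I)ᵀ := by
          rw [transpose_mul]; simp only [Matrix.mul_assoc]
      _ = I * Iᵀ := by
          rw [← h2, transpose_mul, ← Matrix.mul_assoc, Matrix.mul_assoc I, h1, Matrix.mul_one]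
  · obtain ⟨g, ⟨-, hg⟩, hgs⟩ := key s hs
    have h2 : g.1 * M = M * (blockEmbed n ℚ_[p] s).1 := by
      rw [hgs, Matrix.mul_assoc, hIM, Matrix.mul_one]
    rw [vecMul_vecMul, ← h2, ← vecMul_vecMul, hg]

variable {v : Fin (n + 1) → ℚ_[p]} {G : Subgroup (SLd n ℚ_[p])}
  {M I : Matrix (Fin (n + 1)) (Fin (n + 1)) ℚ_[p]}

namespace IsAdaptedBasis

theorem mul_eq' (h : IsAdaptedBasis v G M I) : I * M = 1 := mul_eq_one_comm.1 h.mul_eq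

theorem gram_mul (h : IsAdaptedBasis v G M I) : (I * Iᵀ) * (Mᵀ * M) = 1 := by
  rw [Matrix.mul_assoc, ← Matrix.mul_assoc Iᵀ, ← transpose_mul, h.mul_eq, transpose_one,
    Matrix.one_mul, h.mul_eq']

theorem gram_apply_comm (i j : Fin (n + 1)) : (I * Iᵀ) i j = (I * Iᵀ) j i := by
  have h : (I * Iᵀ)ᵀ = I * Iᵀ := by rw [transpose_mul, transpose_transpose]
  exact congrFun (congrFun h j) i

/-- A row of the Gram matrix with a single nonzero entry has a unit there. -/
theorem norm_gram_eq_one (h : IsAdaptedBasis v G M I) {i j : Fin (n + 1)}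
    (hij : ∀ k, k ≠ j → (I * Iᵀ) i k = 0) : ‖(I * Iᵀ) i j‖ = 1 := by
  refine le_antisymm (h.int_I.mul_one h.int_I.transpose i j) ?_
  -- The inverse `Mᵀ M` of the Gram matrix is integral as well; a diagonal entry of their product
  -- shows that the single entry has an integral inverse.
  have h1 := congrFun (congrFun h.gram_mul i) i
  rw [Matrix.mul_apply, Finset.sum_eq_single j (fun k _ hk => by rw [hij k hk, zero_mul])
    (fun hj => absurd (Finset.mem_univ _) hj), Matrix.one_apply_eq] at h1
  have h2 := congrArg norm h1
  rw [norm_mul, norm_one] at h2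
  have h3 : ‖(Mᵀ * M) j i‖ ≤ 1 := h.int_M.transpose.mul_one h.int_M j i
  rw [← h2]
  exact mul_le_of_le_one_right (norm_nonneg _) h3

theorem gram_castSucc (h : IsAdaptedBasis v G M I) {s : SLd n ℚ_[p]} (hs : s ∈ G) :
    s.1 * (I * Iᵀ).submatrix Fin.castSucc Fin.castSucc * s.1ᵀ =
      (I * Iᵀ).submatrix Fin.castSucc Fin.castSucc := by
  ext i j
  have h1 := congrFun (congrFun (h.gram s hs) i.castSucc) j.castSucc
  rw [submatrix_apply, ← h1]
  simp only [Matrix.mul_apply (M := (blockEmbed n ℚ_[p] s).1), Matrix.mul_apply (M := s.1),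
    Matrix.mul_apply (N := (blockEmbed n ℚ_[p] s).1ᵀ), Matrix.mul_apply (N := s.1ᵀ),
    Fin.sum_univ_castSucc, transpose_apply, blockEmbed_castSucc_castSucc, blockEmbed_castSucc_last,
    submatrix_apply, mul_zero, zero_mul, add_zero]

theorem gram_last (h : IsAdaptedBasis v G M I) {s : SLd n ℚ_[p]} (hs : s ∈ G) :
    s.1 *ᵥ (fun i => (I * Iᵀ) i.castSucc (Fin.last n)) =
      fun i => (I * Iᵀ) i.castSucc (Fin.last n) := by
  ext i
  have h1 := congrFun (congrFun (h.gram s hs) i.castSucc) (Fin.last n)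
  rw [← h1]
  simp only [Matrix.mul_apply (M := (blockEmbed n ℚ_[p] s).1), mulVec, dotProduct,
    Matrix.mul_apply (N := (blockEmbed n ℚ_[p] s).1ᵀ),
    Fin.sum_univ_castSucc, transpose_apply, blockEmbed_castSucc_castSucc, blockEmbed_castSucc_last,
    blockEmbed_last_castSucc, blockEmbed_last_last, mul_zero, zero_mul, add_zero,
    Finset.sum_const_zero, zero_add, mul_one]

theorem coord_castSucc (h : IsAdaptedBasis v G M I) {s : SLd n ℚ_[p]} (hs : s ∈ G) :
    (fun i : Fin n => (v ᵥ* M) i.castSucc) ᵥ* s.1 = fun i : Fin n => (v ᵥ* M) i.castSucc := by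
  ext i
  have h1 := congrFun (h.coord s hs) i.castSucc
  rw [← h1]
  conv_rhs => rw [Matrix.vecMul, dotProduct, Fin.sum_univ_castSucc]
  simp only [blockEmbed_castSucc_castSucc, blockEmbed_last_castSucc, mul_zero, add_zero]
  rfl

/-- If the coordinate vector of `v` is supported at the last place, then `v` is a multiple of the
last basis vector. -/
theorem eq_smul_last (h : IsAdaptedBasis v G M I) (hu : ∀ i : Fin n, (v ᵥ* M) i.castSucc = 0) :
    v = (v ᵥ* M) (Fin.last n) • I (Fin.last n) := by
  have h1 : v = v ᵥ* M ᵥ* I := by rw [vecMul_vecMul, h.mul_eq, vecMul_one]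
  conv_lhs => rw [h1]
  ext j
  rw [vecMul, dotProduct, Fin.sum_univ_castSucc]
  simp [hu]

theorem vecMul_transpose_vecMul_transpose (h : IsAdaptedBasis v G M I) (w : Fin (n + 1) → ℚ_[p]) :
    w ᵥ* Iᵀ ᵥ* Mᵀ = w := by
  rw [vecMul_vecMul, ← transpose_mul, h.mul_eq, transpose_one, vecMul_one]

theorem norm_le_of_dotProduct (h : IsAdaptedBasis v G M I) {w : Fin (n + 1) → ℚ_[p]} {c : ℝ}
    (hc : 0 ≤ c) (hw : ∀ i, ‖w ⬝ᵥ I i‖ ≤ c) (j : Fin (n + 1)) : ‖w j‖ ≤ c := by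
  rw [← h.vecMul_transpose_vecMul_transpose w]
  have := h.int_M.transpose.vecMul (x := w ᵥ* Iᵀ) hc zero_le_one (fun i => hw i) j
  rwa [_root_.mul_one] at this

end IsAdaptedBasis

end AdaptedBasis

/-! ### Monomial matrices -/

section MonomialIsometries

variable {n : ℕ} {K : Type*} [Field K]

/-- The monomial matrix with entry `ε i` at `(i, σ i)`. -/
def monomialMatrix (ε : Fin n → K) (σ : Equiv.Perm (Fin n)) : Matrix (Fin n) (Fin n) K :=
  diagonal ε * σ.permMatrix K

theorem monomialMatrix_mulVec (ε : Fin n → K) (σ : Equiv.Perm (Fin n)) (x : Fin n → K) (i : Fin n) :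
    (monomialMatrix ε σ *ᵥ x) i = ε i * x (σ i) := by
  rw [monomialMatrix, ← mulVec_mulVec, permMatrix_mulVec, mulVec_diagonal, Function.comp_apply]

theorem monomialMatrix_conj_apply (ε : Fin n → K) (σ : Equiv.Perm (Fin n))
    (B : Matrix (Fin n) (Fin n) K) (i j : Fin n) :
    (monomialMatrix ε σ * B * (monomialMatrix ε σ)ᵀ) i j = ε i * ε j * B (σ i) (σ j) := by
  have h1 : (monomialMatrix ε σ * B * (monomialMatrix ε σ)ᵀ) i j =
      (monomialMatrix ε σ *ᵥ ((monomialMatrix ε σ * B) i)) j := by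
    simp only [Matrix.mul_apply (N := (monomialMatrix ε σ)ᵀ), mulVec, dotProduct, transpose_apply,
      mul_comm]
  have h2 (k : Fin n) : (monomialMatrix ε σ * B) i k = (monomialMatrix ε σ *ᵥ fun l => B l k) i :=
    rfl
  rw [h1, monomialMatrix_mulVec, h2, monomialMatrix_mulVec]
  ring

theorem vecMul_monomialMatrix (ε : Fin n → K) (σ : Equiv.Perm (Fin n)) (x : Fin n → K) (i : Fin n) :
    (x ᵥ* monomialMatrix ε σ) (σ i) = ε i * x i := by
  rw [monomialMatrix, ← vecMul_vecMul, vecMul_permMatrix, Function.comp_apply,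
    Equiv.symm_apply_apply, vecMul_diagonal, mul_comm]

theorem det_monomialMatrix (ε : Fin n → K) (σ : Equiv.Perm (Fin n)) :
    (monomialMatrix ε σ).det = (∏ i, ε i) * ((Equiv.Perm.sign σ : ℤ) : K) := by
  rw [monomialMatrix, det_mul, det_diagonal, det_permutation]

end MonomialIsometries

/-! ### A hyperbolic frame from the forms `2xy + z²` and `2xy + z² + ηw²` -/

section HyperbolicDiagonal

variable {r : ℕ} {K : Type*} [Field K]

/-- The Gram matrix of the orthogonal sum of the hyperbolic plane `2 x y` and a diagonal form. -/
def hypDiagonal (a : Fin (r + 2) → K) : Matrix (Fin (r + 2)) (Fin (r + 2)) K :=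
  Matrix.of fun i j => if j = Equiv.swap 0 1 i then a i else 0

theorem swap_succ_succ (i : Fin r) :
    Equiv.swap (0 : Fin (r + 2)) 1 i.succ.succ = i.succ.succ :=
  Equiv.swap_apply_of_ne_of_ne (Fin.succ_ne_zero _)
    (fun h => Fin.succ_ne_zero i (Fin.succ_injective _ h))

theorem hypDiagonal_torus_mem {a : Fin (r + 2) → K} {x : K} (hx : x ≠ 0) :
    ∃ s ∈ SOForm (hypDiagonal a),
      s.1 = monomialMatrix (Fin.cons x (Fin.cons x⁻¹ fun _ => 1)) 1 := by
  refine ⟨⟨monomialMatrix (Fin.cons x (Fin.cons x⁻¹ fun _ => 1)) 1, ?_⟩, ?_, rfl⟩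
  · rw [det_monomialMatrix, Fin.prod_univ_succ, Fin.prod_univ_succ]
    simp [hx]
  · change monomialMatrix _ 1 * hypDiagonal a * (monomialMatrix _ 1)ᵀ = hypDiagonal a
    ext i j
    rw [monomialMatrix_conj_apply, Equiv.Perm.one_apply, Equiv.Perm.one_apply, hypDiagonal,
      Matrix.of_apply]
    split_ifs with h
    · rw [h]
      refine Fin.cases ?_ (fun i => Fin.cases ?_ (fun i => ?_) i) i
      · simp [hx]
      · simp [hx]
      · rw [swap_succ_succ]
        simp
    · rw [mul_zero]

/-- Exchanging the two isotropic vectors has determinant `-1`; the sign at `m` restores determinant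
1. -/
theorem hypDiagonal_swap_mem {a : Fin (r + 2) → K} (ha : a 0 = a 1) {m : Fin (r + 2)}
    (hm0 : m ≠ 0) (hm1 : m ≠ 1) :
    ∃ s ∈ SOForm (hypDiagonal a),
      s.1 = monomialMatrix (fun i => if i = m then -1 else 1) (Equiv.swap 0 1) := by
  refine ⟨⟨monomialMatrix (fun i => if i = m then -1 else 1) (Equiv.swap 0 1), ?_⟩, ?_, rfl⟩
  · rw [det_monomialMatrix, Finset.prod_ite_eq' Finset.univ m, Equiv.Perm.sign_swap (by simp)]
    simp
  · change monomialMatrix _ _ * hypDiagonal a * (monomialMatrix _ _)ᵀ = hypDiagonal a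
    ext i j
    rw [monomialMatrix_conj_apply, hypDiagonal, Matrix.of_apply, Matrix.of_apply]
    simp only [Equiv.swap_apply_self]
    have hmm : Equiv.swap 0 1 m = m := Equiv.swap_apply_of_ne_of_ne hm0 hm1
    have haa : a (Equiv.swap 0 1 i) = a i := by
      rw [Equiv.swap_apply_def]
      split_ifs with h h'
      · rw [h, ha]
      · rw [h', ha]
      · rfl
    by_cases h : j = Equiv.swap 0 1 i
    · have h1 : Equiv.swap 0 1 j = i := by rw [h, Equiv.swap_apply_self]
      have h2 : j = m ↔ i = m := by
        rw [h]
        constructor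
        · intro h3
          rw [← hmm, ← h3, Equiv.swap_apply_self]
        · intro h3
          rw [h3, hmm]
      rw [if_pos h1, if_pos h, haa]
      simp only [h2]
      split_ifs <;> ring
    · rw [if_neg h, if_neg (c := Equiv.swap 0 1 j = i)
        (fun h1 => h (by rw [← h1, Equiv.swap_apply_self])), mul_zero]

variable {p : ℕ} [hp : Fact p.Prime]

theorem eq_zero_of_mul_eq_self {x b : ℚ_[p]} (hx : x ≠ 1) (h : x * b = b) : b = 0 := by
  by_contra hb
  exact hx (mul_right_cancel₀ hb (h.trans (_root_.one_mul b).symm))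

namespace IsAdaptedBasis

variable {a : Fin (r + 2) → ℚ_[p]} {v : Fin (r + 3) → ℚ_[p]}
  {M I : Matrix (Fin (r + 3)) (Fin (r + 3)) ℚ_[p]}

/-- The torus element with weights `p, p⁻¹, 1, …, 1` kills every entry of nontrivial weight.
Off-diagonal entries between diagonal places are killed by the isometry that changes the sign of
only one of them. -/
theorem hypDiagonal_gram (ha : a 0 = a 1) (h : IsAdaptedBasis v (SOForm (hypDiagonal a)) M I)
    (i j : Fin (r + 2)) (hij : j ≠ Equiv.swap 0 1 i) :
    (I * Iᵀ) i.castSucc j.castSucc = 0 := by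
  have hp1 : (p : ℚ_[p]) ≠ 1 := by exact_mod_cast hp.out.one_lt.ne'
  have hp0 : (p : ℚ_[p]) ≠ 0 := by exact_mod_cast hp.out.ne_zero
  have hpp : (p : ℚ_[p]) * p ≠ 1 := by
    exact_mod_cast (Nat.one_lt_mul_iff.2 ⟨hp.out.pos, hp.out.pos, Or.inl hp.out.one_lt⟩).ne'
  have hpp' : (p : ℚ_[p])⁻¹ * (p : ℚ_[p])⁻¹ ≠ 1 := by
    rw [← mul_inv]
    exact inv_ne_one.2 hpp
  obtain ⟨s, hs, hst⟩ := hypDiagonal_torus_mem (a := a) hp0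
  have hT (i j : Fin (r + 2)) := congrFun (congrFun (h.gram_castSucc hs) i) j
  simp only [hst, monomialMatrix_conj_apply, Equiv.Perm.one_apply, submatrix_apply] at hT
  revert hij
  refine Fin.cases ?_ (fun i => Fin.cases ?_ (fun i => ?_) i) i <;>
    refine Fin.cases ?_ (fun j => Fin.cases ?_ (fun j => ?_) j) j <;> intro hij
  · exact eq_zero_of_mul_eq_self (by simpa using hpp) (hT _ _)
  · simp at hij
  · exact eq_zero_of_mul_eq_self (by simpa using hp1) (hT _ _)
  · simp at hij
  · exact eq_zero_of_mul_eq_self hpp' (hT _ _)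
  · exact eq_zero_of_mul_eq_self (by simpa using hp1) (hT _ _)
  · exact eq_zero_of_mul_eq_self (by simpa using hp1) (hT _ _)
  · exact eq_zero_of_mul_eq_self (by simpa using hp1) (hT _ _)
  · rw [swap_succ_succ] at hij
    obtain ⟨s, hs, hst⟩ := hypDiagonal_swap_mem ha (m := i.succ.succ) (Fin.succ_ne_zero _)
      (fun h => Fin.succ_ne_zero i (Fin.succ_injective _ h))
    have hR := congrFun (congrFun (h.gram_castSucc hs) i.succ.succ) j.succ.succ
    rw [hst, monomialMatrix_conj_apply, swap_succ_succ, swap_succ_succ, if_pos rfl, if_neg hij] at hR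
    exact eq_zero_of_mul_eq_self (by norm_num) hR

theorem hypDiagonal_gram_last (ha : a 0 = a 1)
    (h : IsAdaptedBasis v (SOForm (hypDiagonal a)) M I) (i : Fin (r + 2)) :
    (I * Iᵀ) i.castSucc (Fin.last (r + 2)) = 0 := by
  have hp1 : (p : ℚ_[p]) ≠ 1 := by exact_mod_cast hp.out.one_lt.ne'
  have hp0 : (p : ℚ_[p]) ≠ 0 := by exact_mod_cast hp.out.ne_zero
  obtain ⟨s, hs, hst⟩ := hypDiagonal_torus_mem (a := a) hp0
  have hT (i : Fin (r + 2)) := congrFun (h.gram_last hs) i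
  simp only [hst, monomialMatrix_mulVec, Equiv.Perm.one_apply] at hT
  refine Fin.cases ?_ (fun i => Fin.cases ?_ (fun i => ?_) i) i
  · exact eq_zero_of_mul_eq_self (by simpa using hp1) (hT _)
  · exact eq_zero_of_mul_eq_self (by simpa using hp1) (hT _)
  · obtain ⟨s, hs, hst⟩ := hypDiagonal_swap_mem ha (m := i.succ.succ) (Fin.succ_ne_zero _)
      (fun h => Fin.succ_ne_zero i (Fin.succ_injective _ h))
    have hR := congrFun (h.gram_last hs) i.succ.succ
    rw [hst, monomialMatrix_mulVec, swap_succ_succ, if_pos rfl] at hR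
    exact eq_zero_of_mul_eq_self (by norm_num) hR

theorem hypDiagonal_coord (ha : a 0 = a 1)
    (h : IsAdaptedBasis v (SOForm (hypDiagonal a)) M I) (i : Fin (r + 2)) :
    (v ᵥ* M) i.castSucc = 0 := by
  have hp1 : (p : ℚ_[p]) ≠ 1 := by exact_mod_cast hp.out.one_lt.ne'
  have hp0 : (p : ℚ_[p]) ≠ 0 := by exact_mod_cast hp.out.ne_zero
  obtain ⟨s, hs, hst⟩ := hypDiagonal_torus_mem (a := a) hp0
  have hT (i : Fin (r + 2)) := congrFun (h.coord_castSucc hs) ((1 : Equiv.Perm (Fin (r + 2))) i)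
  simp only [hst, vecMul_monomialMatrix] at hT
  refine Fin.cases ?_ (fun i => Fin.cases ?_ (fun i => ?_) i) i
  · exact eq_zero_of_mul_eq_self (by simpa using hp1) (hT _)
  · exact eq_zero_of_mul_eq_self (by simpa using hp1) (hT _)
  · obtain ⟨s, hs, hst⟩ := hypDiagonal_swap_mem ha (m := i.succ.succ) (Fin.succ_ne_zero _)
      (fun h => Fin.succ_ne_zero i (Fin.succ_injective _ h))
    have hR := congrFun (h.coord_castSucc hs) (Equiv.swap 0 1 i.succ.succ)
    rw [hst, vecMul_monomialMatrix, swap_succ_succ, if_pos rfl] at hR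
    exact eq_zero_of_mul_eq_self (by norm_num) hR

/-- The rows of `I` already have the right shape. Unimodularity makes the nonzero Gram entries
units, so rescaling the second row by a unit gives a hyperbolic pair, and `v` is a nonzero multiple
of the last row. -/
theorem exists_isHyperbolicFrame (ha : a 0 = a 1) (hv : v ≠ 0)
    (h : IsAdaptedBasis v (SOForm (hypDiagonal a)) M I) :
    ∃ (e f : Fin (r + 3) → ℚ_[p]) (y : Fin r → Fin (r + 3) → ℚ_[p]),
      IsHyperbolicFrame v e f y := by
  have hlast := h.eq_smul_last (h.hypDiagonal_coord ha)
  set β := (v ᵥ* M) (Fin.last (r + 2)) with hβ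
  have hβ0 : β ≠ 0 := fun h0 => hv (by rw [hlast, h0, zero_smul])
  have hG (i j : Fin (r + 3)) : I i ⬝ᵥ I j = (I * Iᵀ) i j := rfl
  have hgl (i : Fin (r + 2)) : v ⬝ᵥ I i.castSucc = 0 := by
    rw [hlast, smul_dotProduct, hG, gram_apply_comm, h.hypDiagonal_gram_last ha, smul_zero]
  have hun (i : Fin (r + 2)) : ‖(I * Iᵀ) i.castSucc (Equiv.swap 0 1 i).castSucc‖ = 1 := by
    refine h.norm_gram_eq_one fun k => ?_
    refine Fin.lastCases ?_ (fun k hk => ?_) k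
    · exact fun _ => h.hypDiagonal_gram_last ha i
    · exact h.hypDiagonal_gram ha i k fun hk' => hk (by rw [hk'])
  set b := (I * Iᵀ) (Fin.castSucc 0) (Fin.castSucc 1) with hb
  have hb1 : ‖b‖ = 1 := by
    have := hun 0
    rwa [Equiv.swap_apply_left] at this
  have hb0 : b ≠ 0 := fun h0 => by simp [h0] at hb1
  have hbi : ‖b⁻¹‖ = 1 := by rw [norm_inv, hb1, inv_one]
  have hss (i : Fin r) : Equiv.swap (0 : Fin (r + 2)) 1 i.succ.succ = i.succ.succ := swap_succ_succ i
  refine ⟨I (Fin.castSucc 0), b⁻¹ • I (Fin.castSucc 1), fun i => I i.succ.succ.castSucc,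
    ⟨h.int_I _, (IntVec.smul hbi.le (h.int_I _)), fun i => h.int_I _, ?_, ?_, ?_, ?_, ?_, ?_, hgl _,
      ?_, fun i => hgl _, ?_⟩⟩
  · exact h.hypDiagonal_gram ha 0 0 (by simp)
  · rw [smul_dotProduct, dotProduct_smul, hG, h.hypDiagonal_gram ha 1 1 (by simp), smul_zero,
      smul_zero]
  · rw [dotProduct_smul, hG, smul_eq_mul, ← hb, inv_mul_cancel₀ hb0]
  · exact fun i => h.hypDiagonal_gram ha 0 i.succ.succ (by
      simpa using (Fin.succ_injective _).ne (Fin.succ_ne_zero i))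
  · exact fun i => by
      rw [smul_dotProduct, hG, h.hypDiagonal_gram ha 1 i.succ.succ (by simp), smul_zero]
  · exact fun i => by
      have := hun i.succ.succ
      rwa [hss] at this
  · rw [dotProduct_smul, hgl, smul_zero]
  · intro w c hc hwv hwe hwf hwy
    refine h.norm_le_of_dotProduct hc fun i => ?_
    refine Fin.lastCases ?_ (fun i => ?_) i
    · rw [hlast, dotProduct_smul, smul_eq_mul] at hwv
      rwa [(mul_eq_zero.1 hwv).resolve_left hβ0, norm_zero]
    · refine Fin.cases hwe (fun i => Fin.cases ?_ (fun i => hwy i) i) i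
      rw [dotProduct_smul, smul_eq_mul, norm_mul, hbi, _root_.one_mul] at hwf
      exact hwf

end IsAdaptedBasis

theorem form21_eq_hypDiagonal (K : Type*) [Field K] :
    form21 K = hypDiagonal (r := 1) ![1, 1, 1] := by
  ext i j
  fin_cases i <;> fin_cases j <;> simp [form21, hypDiagonal, Equiv.swap_apply_def]

theorem form31_eq_hypDiagonal {K : Type*} [Field K] (η : K) :
    form31 η = hypDiagonal (r := 2) ![1, 1, 1, η] := by
  ext i j
  fin_cases i <;> fin_cases j <;> simp [form31, hypDiagonal, Equiv.swap_apply_def]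

theorem intCast_vec_ne_zero {d : ℕ} {v : Fin d → ℤ} (hv : v ≠ 0) :
    (fun i => (v i : ℚ_[p])) ≠ 0 := fun h => hv (funext fun i => by
  simpa using congrFun h i)

theorem exists_frame_of_isZpConj {a : Fin (r + 2) → ℚ_[p]} (ha : a 0 = a 1)
    {v : Fin (r + 3) → ℤ} (hv : v ≠ 0)
    (h : IsZpConj (stabSO ℚ_[p] v) ((SOForm (hypDiagonal a)).map (blockEmbed (r + 2) ℚ_[p]))) :
    ∃ (e f : Fin (r + 3) → ℚ_[p]) (y : Fin r → Fin (r + 3) → ℚ_[p]),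
      IsHyperbolicFrame (fun i => (v i : ℚ_[p])) e f y := by
  obtain ⟨M, I, hMI⟩ := exists_isAdaptedBasis le_rfl h
  exact hMI.exists_isHyperbolicFrame ha (intCast_vec_ne_zero hv)

end HyperbolicDiagonal

/-! ### Generators for the two diagonal types -/

section IsotropicCases

theorem exists_generators_of_isZpConj_hypDiagonal {p : ℕ} [Fact p.Prime] {r : ℕ} [NeZero r]
    (hd : r + 3 < 16) {v : Fin (r + 3) → ℤ} {k : SLd (r + 3) ℝ} (hadm : Admissible p v k)
    {Θ : Set (SOd (r + 3) ℝ)} (hΘ : IsOpen Θ) (hΘ1 : 1 ∈ Θ) {a : Fin (r + 2) → ℚ_[p]}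
    (ha : a 0 = a 1)
    (h : IsZpConj (stabSO ℚ_[p] v) ((SOForm (hypDiagonal a)).map (blockEmbed (r + 2) ℚ_[p]))) :
    ∃ γ : Fin (r + 1) → SLd (r + 3) (ZInv p),
      (∀ i, γ i ∈ Gamma4 p (r + 3) ∧ diagEmbed p (r + 3) (γ i) ∈ HvS p v) ∧
      (⨅ i, fixedSpace p (γ i)) = lineOf v ∧
      ∀ i, maxNorm (diagEmbed p (r + 3) (γ i)).1.1 ≤ 1 ∧
        maxNorm (diagEmbed p (r + 3) (γ i)).2.1 ≤ (p : ℝ) ^ 4 * V4 p v k Θ ^ 2 := by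
  have hv : v ≠ 0 := fun h => hadm.not_dvd (by rw [h, zero_dotProduct]; exact dvd_zero _)
  obtain ⟨e, f, y, hF⟩ := exists_frame_of_isZpConj ha hv h
  exact exists_small_generators hd hadm hΘ hΘ1 hF

end IsotropicCases

/-! ### The split quaternary form as the determinant on `2 × 2` matrices -/

section SplitQuaternary

variable {K : Type*} [Field K]

/-- Left multiplication by a `2 × 2` matrix on the vectors of the form `2xy + 2zw`, viewed as
`2 × 2` matrices with the determinant form. -/
def leftMat (α β γ δ : K) : Matrix (Fin 4) (Fin 4) K :=
  !![α, 0, 0, -γ; 0, δ, β, 0; 0, γ, α, 0; -β, 0, 0, δ]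

/-- Right multiplication by a traceless `2 × 2` matrix on the vectors of the form `2xy + 2zw`. -/
def rightMat (r : Fin 3 → K) : Matrix (Fin 4) (Fin 4) K :=
  !![r 2, 0, r 1, 0; 0, -r 2, 0, -r 0; r 0, 0, -r 2, 0; 0, -r 1, 0, r 2]

theorem det_leftMat (α β γ δ : K) : (leftMat α β γ δ).det = (α * δ - β * γ) ^ 2 := by
  simp [leftMat, det_succ_row_zero, Fin.sum_univ_succ, Fin.succAbove]
  ring

theorem leftMat_conj_form22 (α β γ δ : K) :
    leftMat α β γ δ * form22 K * (leftMat α β γ δ)ᵀ = (α * δ - β * γ) • form22 K := by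
  ext i j
  fin_cases i <;> fin_cases j <;>
    simp [leftMat, form22, Matrix.mul_apply, Fin.sum_univ_succ] <;> ring

/-- The order is reversed because the matrices act on row vectors. -/
theorem leftMat_mul (α β γ δ α' β' γ' δ' : K) :
    leftMat α β γ δ * leftMat α' β' γ' δ' = leftMat (α' * α + β' * γ) (α' * β + β' * δ)
      (γ' * α + δ' * γ) (γ' * β + δ' * δ) := by
  ext i j
  fin_cases i <;> fin_cases j <;>
    simp [leftMat, Matrix.mul_apply, Fin.sum_univ_succ] <;> ring

/-- A row vector `x` corresponds to the `2 × 2` matrix with rows `(x 0, x 2)` and `(-x 3, x 1)`. The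
claim is the associativity of matrix multiplication. -/
theorem rightMat_mul_leftMat (r : Fin 3 → K) (α β γ δ : K) :
    rightMat r * leftMat α β γ δ = leftMat α β γ δ * rightMat r := by
  ext i j
  fin_cases i <;> fin_cases j <;>
    simp [leftMat, rightMat, Matrix.mul_apply, Fin.sum_univ_succ] <;> ring

theorem form22_mul_self : form22 K * form22 K = 1 := by
  ext i j
  fin_cases i <;> fin_cases j <;> simp [form22, Matrix.mul_apply, Fin.sum_univ_succ]

theorem rightMat_mul_form22 (r : Fin 3 → K) :
    rightMat r * form22 K =
      !![0, r 2, 0, r 1; -r 2, 0, -r 0, 0; 0, r 0, 0, -r 2; -r 1, 0, r 2, 0] := by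
  ext i j
  fin_cases i <;> fin_cases j <;> simp [rightMat, form22, Matrix.mul_apply, Fin.sum_univ_succ]

/-- The Pfaffian dual of an alternating `4 × 4` matrix. -/
def pfaffianDual (Z : Matrix (Fin 4) (Fin 4) K) : Matrix (Fin 4) (Fin 4) K :=
  !![0, Z 2 3, -Z 1 3, Z 1 2; -Z 2 3, 0, Z 0 3, -Z 0 2; Z 1 3, -Z 0 3, 0, Z 0 1;
    -Z 1 2, Z 0 2, -Z 0 1, 0]

theorem pfaffianDual_add (Z W : Matrix (Fin 4) (Fin 4) K) :
    pfaffianDual (Z + W) = pfaffianDual Z + pfaffianDual W := by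
  ext i j
  fin_cases i <;> fin_cases j <;> simp [pfaffianDual] <;> ring

/-- The alternating matrix `y zᵀ - z yᵀ`. -/
def wedge (y z : Fin 4 → K) : Matrix (Fin 4) (Fin 4) K := vecMulVec y z - vecMulVec z y

theorem mul_wedge_mul_transpose (A : Matrix (Fin 4) (Fin 4) K) (y z : Fin 4 → K) :
    A * wedge y z * Aᵀ = wedge (A *ᵥ y) (A *ᵥ z) := by
  rw [wedge, Matrix.mul_sub, Matrix.sub_mul, mul_vecMulVec, mul_vecMulVec, vecMulVec_mul,
    vecMulVec_mul, vecMul_transpose, vecMul_transpose, wedge]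

/-- On decomposable bivectors the Pfaffian dual is given by a determinant, so its behaviour under
linear maps follows from multiplicativity. -/
theorem dotProduct_pfaffianDual_wedge (x y z w : Fin 4 → K) :
    x ⬝ᵥ pfaffianDual (wedge y z) *ᵥ w = (Matrix.of ![x, w, y, z]).det := by
  simp [det_succ_row_zero, Fin.sum_univ_succ, Fin.succAbove, pfaffianDual, wedge, vecMulVec_apply,
    dotProduct, mulVec]
  ring

theorem det_of_mulVec (A : Matrix (Fin 4) (Fin 4) K) (x y z w : Fin 4 → K) :
    (Matrix.of ![A *ᵥ x, A *ᵥ y, A *ᵥ z, A *ᵥ w]).det = A.det * (Matrix.of ![x, y, z, w]).det := by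
  have h : Matrix.of ![A *ᵥ x, A *ᵥ y, A *ᵥ z, A *ᵥ w] = Matrix.of ![x, y, z, w] * Aᵀ := by
    ext i j
    rw [mul_apply_eq_vecMul, vecMul_transpose]
    fin_cases i <;> rfl
  rw [h, det_mul, det_transpose, mul_comm]

theorem transpose_mul_pfaffianDual_wedge_mul (A : Matrix (Fin 4) (Fin 4) K) (y z : Fin 4 → K) :
    Aᵀ * pfaffianDual (A * wedge y z * Aᵀ) * A = A.det • pfaffianDual (wedge y z) := by
  rw [mul_wedge_mul_transpose]
  refine matrix_ext_of_vecMul fun x => ?_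
  ext j
  have h := dotProduct_pfaffianDual_wedge (A *ᵥ x) (A *ᵥ y) (A *ᵥ z) (A *ᵥ Pi.single j 1)
  rw [det_of_mulVec, ← dotProduct_pfaffianDual_wedge] at h
  rw [← dotProduct_single_one (x ᵥ* _) j, ← dotProduct_single_one (x ᵥ* _) j,
    ← dotProduct_mulVec, ← dotProduct_mulVec, smul_mulVec, dotProduct_smul, smul_eq_mul, ← h,
    ← mulVec_mulVec, ← mulVec_mulVec, dotProduct_mulVec x, vecMul_transpose]

theorem rightMat_mul_form22_eq_wedge (r : Fin 3 → K) :
    rightMat r * form22 K = wedge ![1, 0, 0, 0] ![0, r 2, 0, r 1] +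
      wedge ![0, 0, 1, 0] ![0, r 0, 0, -r 2] := by
  rw [rightMat_mul_form22]
  ext i j
  fin_cases i <;> fin_cases j <;> simp [wedge]

theorem transpose_mul_pfaffianDual_mul (A : Matrix (Fin 4) (Fin 4) K) (r : Fin 3 → K) :
    Aᵀ * pfaffianDual (A * (rightMat r * form22 K) * Aᵀ) * A =
      A.det • pfaffianDual (rightMat r * form22 K) := by
  rw [rightMat_mul_form22_eq_wedge, Matrix.mul_add, Matrix.add_mul, pfaffianDual_add,
    pfaffianDual_add, Matrix.mul_add, Matrix.add_mul, transpose_mul_pfaffianDual_wedge_mul,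
    transpose_mul_pfaffianDual_wedge_mul, smul_add]

theorem pfaffianDual_rightMat (r : Fin 3 → K) :
    pfaffianDual (rightMat r * form22 K) = form22 K * (rightMat r * form22 K) * form22 K := by
  rw [rightMat_mul_form22]
  ext i j
  fin_cases i <;> fin_cases j <;>
    simp [form22, pfaffianDual, Matrix.mul_apply, Fin.sum_univ_succ]

/-- An alternating matrix that equals its Pfaffian dual up to conjugation by the form is a right
multiplication. -/
theorem exists_eq_rightMat_mul {Z : Matrix (Fin 4) (Fin 4) K} (h2 : (2 : K) ≠ 0) (hZ : Zᵀ = -Z)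
    (h : pfaffianDual Z = form22 K * Z * form22 K) :
    Z = rightMat ![Z 2 1, Z 0 3, Z 0 1] * form22 K := by
  have hs (i j : Fin 4) : Z j i = -Z i j := congrFun (congrFun hZ i) j
  have hd (i : Fin 4) : Z i i = 0 := by
    have h1 : 2 * Z i i = 0 := by linear_combination hs i i
    exact (mul_eq_zero.1 h1).resolve_left h2
  have h02 := congrFun (congrFun h 1) 3
  have h13 := congrFun (congrFun h 0) 2
  have h01 := congrFun (congrFun h 0) 1
  simp [pfaffianDual, form22, Matrix.mul_apply, vecMul, dotProduct, Fin.sum_univ_succ] at h02 h13 h01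
  have h02' : Z 0 2 = 0 :=
    (mul_eq_zero.1 (show 2 * Z 0 2 = 0 by linear_combination -h02)).resolve_left h2
  have h13' : Z 1 3 = 0 :=
    (mul_eq_zero.1 (show 2 * Z 1 3 = 0 by linear_combination -h13)).resolve_left h2
  have h20 : Z 2 0 = 0 := by rw [hs 0 2, h02', neg_zero]
  have h31 : Z 3 1 = 0 := by rw [hs 1 3, h13', neg_zero]
  have h23 : Z 2 3 = -Z 0 1 := by rw [h01, hs 0 1]
  have h32 : Z 3 2 = Z 0 1 := by rw [hs 2 3, h23, neg_neg]
  rw [rightMat_mul_form22]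
  ext i j
  fin_cases i <;> fin_cases j <;>
    simp [hd, h02', h13', h20, h31, h23, h32, hs 0 1, hs 2 1, hs 0 3]

theorem inv_eq_form22_mul_transpose {k : SLd 4 K} (hk : k ∈ SOForm (form22 K)) :
    (k⁻¹).1 = form22 K * k.1ᵀ * form22 K := by
  have hk' : k.1 * form22 K * k.1ᵀ = form22 K := hk
  have h1 : (k⁻¹).1 * k.1 = 1 := congrArg Subtype.val (inv_mul_cancel k)
  calc (k⁻¹).1 = (k⁻¹).1 * (form22 K * form22 K) := by rw [form22_mul_self, Matrix.mul_one]
    _ = (k⁻¹).1 * (k.1 * form22 K * k.1ᵀ * form22 K) := by rw [hk']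
    _ = ((k⁻¹).1 * k.1) * (form22 K * k.1ᵀ * form22 K) := by simp only [Matrix.mul_assoc]
    _ = _ := by rw [h1, Matrix.one_mul]

/-- Proper isometries of the form `2xy + 2zw` normalize the right multiplications. -/
theorem exists_rightMat_mul_eq (h2 : (2 : K) ≠ 0) {k : SLd 4 K} (hk : k ∈ SOForm (form22 K))
    (r : Fin 3 → K) : ∃ r' : Fin 3 → K, rightMat r * k.1 = k.1 * rightMat r' ∧
      ∀ i, ∃ a b, r' i = ((k⁻¹).1 * (rightMat r * form22 K) * (k⁻¹).1ᵀ) a b := by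
  set κ := (k⁻¹).1 with hκ
  set J := form22 K with hJ
  set X := rightMat r * J with hX
  have hJJ : J * J = 1 := form22_mul_self
  have hkκ : k.1 * κ = 1 := congrArg Subtype.val (mul_inv_cancel k)
  have hκκ : κ * J * κᵀ = J := inv_mem hk
  have hκk : κ * k.1 = 1 := congrArg Subtype.val (inv_mul_cancel k)
  have hJκ : J * κᵀ = k.1 * J := by
    calc J * κᵀ = (k.1 * κ) * J * κᵀ := by rw [hkκ, Matrix.one_mul]
      _ = k.1 * (κ * J * κᵀ) := by simp only [Matrix.mul_assoc]
      _ = k.1 * J := by rw [hκκ]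
  have hκJκ : κᵀ * J * κ = J := by
    calc κᵀ * J * κ = (J * J) * κᵀ * J * κ := by rw [hJJ, Matrix.one_mul]
      _ = J * (J * κᵀ) * J * κ := by simp only [Matrix.mul_assoc]
      _ = J * k.1 * (J * J) * κ := by rw [hJκ]; simp only [Matrix.mul_assoc]
      _ = J := by rw [hJJ, Matrix.mul_one, Matrix.mul_assoc, hkκ, Matrix.mul_one]
  set Z := κ * X * κᵀ with hZdef
  have hXt : Xᵀ = -X := by
    rw [hX, rightMat_mul_form22]
    ext i j
    fin_cases i <;> fin_cases j <;> simp
  have hZt : Zᵀ = -Z := by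
    rw [hZdef, transpose_mul, transpose_mul, transpose_transpose, hXt, ← Matrix.mul_assoc,
      Matrix.mul_neg, Matrix.neg_mul]
  have hconj (W : Matrix (Fin 4) (Fin 4) K) : k.1ᵀ * (κᵀ * W * κ) * k.1 = W := by
    calc k.1ᵀ * (κᵀ * W * κ) * k.1 = (κ * k.1)ᵀ * W * (κ * k.1) := by
          rw [transpose_mul]; simp only [Matrix.mul_assoc]
      _ = W := by rw [hκk, transpose_one, Matrix.one_mul, Matrix.mul_one]
  -- The involution `Z ↦ J (pfaffianDual Z) J` is a Hodge star on alternating matrices, and the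
  -- matrices `rightMat r * J` form its eigenspace for 1. Isometries of determinant one commute with
  -- the star, so `Z = κ X κᵀ` stays in that eigenspace.
  have hdual : pfaffianDual Z = J * Z * J := by
    rw [← hconj (pfaffianDual Z), ← hconj (J * Z * J)]
    congr 2
    rw [transpose_mul_pfaffianDual_mul κ r, (k⁻¹).2, one_smul, pfaffianDual_rightMat]
    calc J * X * J = (κᵀ * J * κ) * X * (κᵀ * J * κ) := by rw [hκJκ]
      _ = κᵀ * (J * Z * J) * κ := by rw [hZdef]; simp only [Matrix.mul_assoc]
  have hZr := exists_eq_rightMat_mul h2 hZt hdual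
  refine ⟨![Z 2 1, Z 0 3, Z 0 1], ?_, fun i => ?_⟩
  · have h1 : k.1 * Z = rightMat r * k.1 * J := by
      calc k.1 * Z = (k.1 * κ) * rightMat r * (J * κᵀ) := by
            rw [hZdef, hX]; simp only [Matrix.mul_assoc]
        _ = rightMat r * k.1 * J := by
            rw [hkκ, Matrix.one_mul, hJκ, Matrix.mul_assoc]
    calc rightMat r * k.1 = rightMat r * k.1 * J * J := by
          rw [Matrix.mul_assoc _ J, hJJ, Matrix.mul_one]
      _ = k.1 * (rightMat ![Z 2 1, Z 0 3, Z 0 1] * J) * J := by rw [← h1, ← hZr]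
      _ = _ := by simp only [Matrix.mul_assoc, hJJ, Matrix.mul_one]
  · fin_cases i
    exacts [⟨2, 1, rfl⟩, ⟨0, 3, rfl⟩, ⟨0, 1, rfl⟩]

/-- The matrix with rows `x` and its images under the basic right multiplications. -/
def rightFrame (x : Fin 4 → K) : Matrix (Fin 4) (Fin 4) K :=
  Matrix.of (Fin.cons x fun i => x ᵥ* rightMat (Pi.single i 1))

theorem vecMul_rightMat_eq (x : Fin 4 → K) (r : Fin 3 → K) :
    x ᵥ* rightMat r = ![x 0 * r 2 + x 2 * r 0, -(x 1 * r 2) - x 3 * r 1, x 0 * r 1 - x 2 * r 2,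
      x 3 * r 2 - x 1 * r 0] := by
  ext j
  rw [vecMul, dotProduct, Fin.sum_univ_four]
  fin_cases j <;> simp [rightMat] <;> ring

/-- For an anisotropic vector, the vector and its images under the basic right multiplications
therefore form a basis when 2 is invertible. -/
theorem det_rightFrame (x : Fin 4 → K) :
    (rightFrame x).det = -2 * (x 0 * x 1 + x 2 * x 3) ^ 2 := by
  have h : rightFrame x = Matrix.of ![x, x ᵥ* rightMat (Pi.single 0 1),
      x ᵥ* rightMat (Pi.single 1 1), x ᵥ* rightMat (Pi.single 2 1)] := by
    ext i j
    fin_cases i <;> rfl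
  rw [h]
  simp only [vecMul_rightMat_eq]
  simp [det_succ_row_zero, Fin.sum_univ_succ, Fin.succAbove]
  ring

theorem dotProduct_form22_mulVec (x : Fin 4 → K) :
    x ⬝ᵥ form22 K *ᵥ x = 2 * (x 0 * x 1 + x 2 * x 3) := by
  simp [form22, dotProduct, mulVec, Fin.sum_univ_succ]
  ring

theorem vecMul_rightMat (x : Fin 4 → K) (r : Fin 3 → K) :
    x ᵥ* rightMat r = ∑ i, r i • (x ᵥ* rightMat (Pi.single i 1)) := by
  simp only [vecMul_rightMat_eq, Fin.sum_univ_three]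
  ext j
  fin_cases j <;> simp <;> ring

end SplitQuaternary

/-! ### Integrality of the trace from one fixed anisotropic vector -/

section TraceBound

variable {p : ℕ} [hp : Fact p.Prime]

theorem normLe_rightMat {r : Fin 3 → ℚ_[p]} (hr : ∀ i, ‖r i‖ ≤ 1) : NormLe 1 (rightMat r) := by
  intro i j
  fin_cases i <;> fin_cases j <;> simp [rightMat, hr]

theorem normLe_form22 : NormLe 1 (form22 ℚ_[p]) := by
  intro i j
  fin_cases i <;> fin_cases j <;> simp [form22]

/-- An isometry `s = g k g'⁻¹`, with `k` integral and `g, g'` commuting with the right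
multiplications, has integral trace of its square as soon as it fixes an anisotropic vector. -/
theorem norm_trace_mul_self_le {s k : SLd 4 ℚ_[p]} (hk : k ∈ SOForm (form22 ℚ_[p]))
    (hki : NormLe 1 k.1) {g g' : SLd 4 ℚ_[p]}
    (hg : ∀ r, rightMat r * g.1 = g.1 * rightMat r)
    (hg' : ∀ r, rightMat r * g'.1 = g'.1 * rightMat r) (hs : s * g' = g * k)
    {x : Fin 4 → ℚ_[p]} (hx : x ᵥ* s.1 = x) (hxx : x ⬝ᵥ form22 ℚ_[p] *ᵥ x ≠ 0) :
    ‖(s.1 * s.1).trace‖ ≤ 1 := by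
  have hs' : s.1 * g'.1 = g.1 * k.1 := congrArg Subtype.val hs
  have hg'' : g'.1 * (g'⁻¹).1 = 1 := congrArg Subtype.val (mul_inv_cancel g')
  have hκ : NormLe 1 (k⁻¹).1 := by
    rw [inv_eq_form22_mul_transpose hk]
    exact (normLe_form22.mul_one hki.transpose).mul_one normLe_form22
  -- Right multiplications pass through `g` and `g'` unchanged and through `k` with integral
  -- coefficients, hence through `s` in the same way.
  have hex : ∀ i : Fin 3, ∃ r' : Fin 3 → ℚ_[p], (∀ j, ‖r' j‖ ≤ 1) ∧
      rightMat (Pi.single i 1) * s.1 = s.1 * rightMat r' := fun i => by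
    obtain ⟨r', hr', hent⟩ := exists_rightMat_mul_eq two_ne_zero hk (Pi.single i 1)
    refine ⟨r', fun j => ?_, ?_⟩
    · obtain ⟨a, b, hab⟩ := hent j
      rw [hab]
      exact (hκ.mul_one ((normLe_rightMat (IntVec.single i)).mul_one normLe_form22)).mul_one
        hκ.transpose a b
    · have h1 : rightMat (Pi.single i 1) * s.1 * g'.1 = s.1 * rightMat r' * g'.1 := by
        rw [Matrix.mul_assoc, hs', ← Matrix.mul_assoc, hg, Matrix.mul_assoc, hr',
          ← Matrix.mul_assoc, ← hs', Matrix.mul_assoc, Matrix.mul_assoc, hg']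
      calc rightMat (Pi.single i 1) * s.1
          = rightMat (Pi.single i 1) * s.1 * g'.1 * (g'⁻¹).1 := by
            rw [Matrix.mul_assoc _ g'.1, hg'', Matrix.mul_one]
        _ = s.1 * rightMat r' := by rw [h1, Matrix.mul_assoc _ g'.1, hg'', Matrix.mul_one]
  choose r' hr' hsr using hex
  set N : Matrix (Fin 4) (Fin 4) ℚ_[p] :=
    Matrix.of (Fin.cons (Pi.single 0 1) fun i => Fin.cons 0 (r' i)) with hN
  have hNi : NormLe 1 N := by
    intro i j
    refine Fin.cases ?_ (fun i => ?_) i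
    · exact IntVec.single (p := p) (d := 4) 0 j
    · refine Fin.cases ?_ (fun j => ?_) j
      · simp [hN]
      · simpa [hN] using hr' i j
  -- Since `x s = x`, also `x R s = x s R' = x R'`. So in the basis `rightFrame x` the matrix of `s`
  -- is the integral matrix `N`.
  have hPs : rightFrame x * s.1 = N * rightFrame x := by
    ext i j
    rw [mul_apply_eq_vecMul, mul_apply_eq_vecMul]
    refine congrFun ?_ j
    refine Fin.cases ?_ (fun i => ?_) i
    · change x ᵥ* s.1 = Pi.single 0 1 ᵥ* rightFrame x
      rw [hx, single_one_vecMul]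
      rfl
    · change x ᵥ* rightMat (Pi.single i 1) ᵥ* s.1 = (Fin.cons 0 (r' i) : Fin 4 → ℚ_[p]) ᵥ* _
      rw [vecMul_vecMul, hsr, ← vecMul_vecMul, hx, vecMul_rightMat]
      ext l
      refine Eq.trans ?_ (Fin.sum_univ_succ _).symm
      rw [Finset.sum_apply]
      simp [rightFrame]
  have hdet : IsUnit (rightFrame x).det := by
    rw [isUnit_iff_ne_zero, det_rightFrame]
    rw [dotProduct_form22_mulVec] at hxx
    exact mul_ne_zero (neg_ne_zero.2 two_ne_zero)
      (pow_ne_zero _ fun h => hxx (by rw [h, mul_zero]))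
  have hsN : s.1 * s.1 = (rightFrame x)⁻¹ * (N * N * rightFrame x) := by
    rw [Matrix.mul_assoc N, ← hPs, ← Matrix.mul_assoc N, ← hPs, Matrix.mul_assoc,
      nonsing_inv_mul_cancel_left _ _ hdet]
  rw [hsN, trace_mul_comm, Matrix.mul_assoc, mul_nonsing_inv _ hdet, Matrix.mul_one]
  exact (hNi.mul_one hNi).trace zero_le_one

end TraceBound

/-! ### Invariants of the left unipotents -/

section LeftGroup

variable {K : Type*} [Field K]

/-- Left multiplication by a `2 × 2` matrix of determinant one, as an element of `SL_4`. -/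
def leftSL (α β γ δ : K) (h : α * δ - β * γ = 1) : SLd 4 K :=
  ⟨leftMat α β γ δ, by rw [det_leftMat, h, one_pow]⟩

theorem coe_leftSL (α β γ δ : K) (h : α * δ - β * γ = 1) :
    (leftSL α β γ δ h).1 = leftMat α β γ δ := rfl

theorem leftSL_mem (α β γ δ : K) (h : α * δ - β * γ = 1) :
    leftSL α β γ δ h ∈ SOForm (form22 K) := by
  change leftMat α β γ δ * form22 K * (leftMat α β γ δ)ᵀ = form22 K
  rw [leftMat_conj_form22, h, one_smul]

theorem isNilpotent_leftMat_sub_one (β γ : K) (h : β * γ = 0) :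
    IsNilpotent (leftMat 1 β γ 1 - 1) := by
  have h1 : leftMat 1 β γ 1 - 1 = leftMat 0 β γ 0 := by
    ext i j
    fin_cases i <;> fin_cases j <;> simp [leftMat]
  refine ⟨2, ?_⟩
  rw [pow_two, h1, leftMat_mul]
  ext i j
  fin_cases i <;> fin_cases j <;> simp [leftMat, h, mul_comm γ β]

theorem leftSL_mem_plusSubgroup (β γ : K) (h : β * γ = 0) :
    leftSL 1 β γ 1 (by rw [h]; ring) ∈ plusSubgroup (SOForm (form22 K)) :=
  Subgroup.subset_closure ⟨leftSL_mem _ _ _ _ _, isNilpotent_leftMat_sub_one β γ h⟩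

/-- A symmetric form that is invariant under the left unipotents is a multiple of `2xy + 2zw`. -/
theorem eq_smul_form22_of_invariant {B : Matrix (Fin 4) (Fin 4) K} (h2 : (2 : K) ≠ 0)
    (hB : Bᵀ = B) (hβ : leftMat 1 1 0 1 * B * (leftMat 1 1 0 1)ᵀ = B)
    (hγ : leftMat 1 0 1 1 * B * (leftMat 1 0 1 1)ᵀ = B) : B = B 0 1 • form22 K := by
  have hs (i j : Fin 4) : B j i = B i j := congrFun (congrFun hB i) j
  have e1 (i j : Fin 4) := congrFun (congrFun hβ i) j
  have e2 (i j : Fin 4) := congrFun (congrFun hγ i) j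
  have a1 := e1 2 1
  have a2 := e1 0 1
  have a3 := e1 0 3
  have a4 := e1 1 1
  have a5 := e1 3 3
  have a6 := e1 1 3
  have a7 := e2 0 3
  have a8 := e2 2 1
  have a9 := e2 0 1
  simp [leftMat, Matrix.mul_apply, vecMul, dotProduct, Fin.sum_univ_four, hs 0 1, hs 0 2, hs 0 3,
    hs 1 2, hs 1 3, hs 2 3] at a1 a2 a3 a4 a5 a6 a7 a8 a9
  have b4 : B 1 2 = 0 := (mul_eq_zero.1 (show 2 * B 1 2 = 0 by
    linear_combination a4 - a1)).resolve_left h2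
  have b5 : B 0 3 = 0 := (mul_eq_zero.1 (show 2 * B 0 3 = 0 by
    linear_combination -a5 + a3)).resolve_left h2
  have b6 : B 2 3 = B 0 1 := by linear_combination a6 + a2
  ext i j
  fin_cases i <;> fin_cases j <;>
    simp [form22, a1, a2, a3, b4, b5, b6, a7, a8, a9, hs 0 1, hs 0 2, hs 0 3, hs 1 2, hs 1 3, hs 2 3]

/-- The two unipotents generate a group acting on two copies of a two-dimensional representation
that has no nonzero invariant vector. -/
theorem eq_zero_of_leftMat_mulVec {b : Fin 4 → K} (h1 : leftMat 1 1 0 1 *ᵥ b = b)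
    (h2 : leftMat 1 0 1 1 *ᵥ b = b) : b = 0 := by
  ext j
  have e1 := congrFun h1
  have e2 := congrFun h2
  have a1 := e1 1
  have a2 := e1 3
  have a3 := e2 0
  have a4 := e2 2
  simp [leftMat, mulVec, dotProduct, Fin.sum_univ_succ] at a1 a2 a3 a4
  fin_cases j <;> assumption

theorem eq_zero_of_vecMul_leftMat {b : Fin 4 → K} (h1 : b ᵥ* leftMat 1 1 0 1 = b)
    (h2 : b ᵥ* leftMat 1 0 1 1 = b) : b = 0 := by
  ext j
  have e1 := congrFun h1
  have e2 := congrFun h2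
  have a1 := e1 0
  have a2 := e1 2
  have a3 := e2 1
  have a4 := e2 3
  simp [leftMat, vecMul, dotProduct, Fin.sum_univ_four] at a1 a2 a3 a4
  fin_cases j <;> assumption

end LeftGroup

/-! ### Integral bases in the split case, and the full stabilizer in them -/

section SplitBasis

variable {p : ℕ} [hp : Fact p.Prime]

/-- The rows of `I` are a basis of `ℤ_p^5` in which the quadratic form is the orthogonal sum of a
multiple of `2xy + 2zw` and the line of `v`, which is spanned by the last basis vector. -/
structure IsSplitBasis (v : Fin 5 → ℚ_[p]) (M I : Matrix (Fin 5) (Fin 5) ℚ_[p]) (c : ℚ_[p]) :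
    Prop where
  int_M : NormLe 1 M
  int_I : NormLe 1 I
  mul_eq : M * I = 1
  gram : (I * Iᵀ).submatrix Fin.castSucc Fin.castSucc = c • form22 ℚ_[p]
  gram_last : ∀ i : Fin 4, (I * Iᵀ) i.castSucc (Fin.last 4) = 0
  coord : ∀ i : Fin 4, (v ᵥ* M) i.castSucc = 0
  coord_last : (v ᵥ* M) (Fin.last 4) ≠ 0
  c_ne : c ≠ 0
  last_ne : (I * Iᵀ) (Fin.last 4) (Fin.last 4) ≠ 0

theorem form22_zero_apply (K : Type*) [Field K] {k : Fin 4} (hk : k ≠ 1) : form22 K 0 k = 0 := by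
  fin_cases k
  exacts [rfl, absurd rfl hk, rfl, rfl]

/-- Two left unipotents suffice: their only invariant symmetric forms are the multiples of `2xy +
2zw`, and they have no nonzero invariant row or column vectors. This fixes the Gram matrix and the
coordinates of `v`. -/
theorem IsAdaptedBasis.isSplitBasis {v : Fin 5 → ℚ_[p]} (hv : v ≠ 0)
    {M I : Matrix (Fin 5) (Fin 5) ℚ_[p]}
    (h : IsAdaptedBasis v (plusSubgroup (SOForm (form22 ℚ_[p]))) M I) :
    IsSplitBasis v M I ((I * Iᵀ) (Fin.castSucc 0) (Fin.castSucc 1)) := by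
  have hβ := leftSL_mem_plusSubgroup (1 : ℚ_[p]) 0 (by ring)
  have hγ := leftSL_mem_plusSubgroup (0 : ℚ_[p]) 1 (by ring)
  have g1 := h.gram_castSucc hβ
  have g2 := h.gram_castSucc hγ
  have l1 := h.gram_last hβ
  have l2 := h.gram_last hγ
  have c1 := h.coord_castSucc hβ
  have c2 := h.coord_castSucc hγ
  rw [coe_leftSL] at g1 g2 l1 l2 c1 c2
  have hs : ((I * Iᵀ).submatrix Fin.castSucc (Fin.castSucc : Fin 4 → Fin 5))ᵀ =
      (I * Iᵀ).submatrix Fin.castSucc Fin.castSucc := by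
    ext i j
    exact gram_apply_comm _ _
  have hgram := eq_smul_form22_of_invariant two_ne_zero hs g1 g2
  have hlast := eq_zero_of_leftMat_mulVec l1 l2
  have hcoord := eq_zero_of_vecMul_leftMat c1 c2
  have hcoord' (i : Fin 4) : (v ᵥ* M) i.castSucc = 0 := congrFun hcoord i
  have hlast' (i : Fin 4) : (I * Iᵀ) i.castSucc (Fin.last 4) = 0 := congrFun hlast i
  have hne : ∀ x : ℚ_[p], ‖x‖ = 1 → x ≠ 0 := fun x h h0 => by
    rw [h0, norm_zero] at h
    exact zero_ne_one h
  have hβ0 : (v ᵥ* M) (Fin.last 4) ≠ 0 := fun h0 => hv (by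
    rw [h.eq_smul_last hcoord', h0, zero_smul])
  have hc : ‖(I * Iᵀ) (Fin.castSucc 0) (Fin.castSucc 1)‖ = 1 := by
    refine h.norm_gram_eq_one fun k => ?_
    refine Fin.lastCases (fun _ => hlast' 0) (fun k hk => ?_) k
    have h1 := congrFun (congrFun hgram 0) k
    rw [submatrix_apply] at h1
    rw [h1, Matrix.smul_apply, form22_zero_apply _ fun h => hk (by rw [h]), smul_zero]
  have hb : ‖(I * Iᵀ) (Fin.last 4) (Fin.last 4)‖ = 1 := by
    refine h.norm_gram_eq_one fun k => ?_
    refine Fin.lastCases (fun hk => absurd rfl hk) (fun k _ => ?_) k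
    rw [IsAdaptedBasis.gram_apply_comm]
    exact hlast' k
  exact ⟨h.int_M, h.int_I, h.mul_eq, hgram, hlast', hcoord', hβ0, hne _ hc, hne _ hb⟩

variable {n : ℕ}

theorem blockEmbed_injective {R : Type*} [CommRing R] :
    Function.Injective (blockEmbed n R) := fun s t h => by
  ext i j
  rw [← blockEmbed_castSucc_castSucc, h, blockEmbed_castSucc_castSucc]

theorem trace_blockEmbed {R : Type*} [CommRing R] (s : SLd n R) :
    (blockEmbed n R s).1.trace = s.1.trace + 1 := by
  rw [Matrix.trace, Fin.sum_univ_castSucc]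
  simp only [diag_apply, blockEmbed_castSucc_castSucc, blockEmbed_last_last]
  rfl

theorem normLe_blockEmbed {a : ℝ} (ha : 1 ≤ a) {s : SLd n ℚ_[p]} (hs : NormLe a s.1) :
    NormLe a (blockEmbed n ℚ_[p] s).1 := fun i j => by
  have ha0 : 0 ≤ a := zero_le_one.trans ha
  refine Fin.lastCases ?_ (fun i => ?_) i <;> refine Fin.lastCases ?_ (fun j => ?_) j
  · rwa [blockEmbed_last_last, norm_one]
  · rwa [blockEmbed_last_castSucc, norm_zero]
  · rwa [blockEmbed_castSucc_last, norm_zero]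
  · rw [blockEmbed_castSucc_castSucc]
    exact hs i j

/-- A matrix whose last row and column are those of the identity is a block embedding. -/
theorem exists_eq_blockEmbed {R : Type*} [CommRing R] {Q : Matrix (Fin (n + 1)) (Fin (n + 1)) R}
    (hdet : Q.det = 1) (hrow : Q (Fin.last n) = Pi.single (Fin.last n) 1)
    (hcol : ∀ i : Fin n, Q i.castSucc (Fin.last n) = 0) :
    ∃ s : SLd n R, s.1 = Q.submatrix Fin.castSucc Fin.castSucc ∧ (blockEmbed n R s).1 = Q := by
  have h1 : (Q.submatrix Fin.castSucc Fin.castSucc).det = 1 := by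
    rw [det_succ_row Q (Fin.last n), Fin.sum_univ_castSucc, hrow] at hdet
    simp only [Fin.succAbove_last, Pi.single_eq_same, ← two_mul, Fin.val_last, pow_mul] at hdet
    simpa [Pi.single_apply, Fin.castSucc_ne_last] using hdet
  obtain ⟨s, hs⟩ : ∃ s : SLd n R, s.1 = Q.submatrix Fin.castSucc Fin.castSucc := ⟨⟨_, h1⟩, rfl⟩
  refine ⟨s, hs, ?_⟩
  ext i j
  refine Fin.lastCases ?_ (fun i => ?_) i <;> refine Fin.lastCases ?_ (fun j => ?_) j
  · rw [blockEmbed_last_last, hrow, Pi.single_eq_same]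
  · rw [blockEmbed_last_castSucc, hrow, Pi.single_eq_of_ne (Fin.castSucc_ne_last j)]
  · rw [blockEmbed_castSucc_last, hcol]
  · rw [blockEmbed_castSucc_castSucc, hs, submatrix_apply]

namespace IsSplitBasis

variable {v : Fin 5 → ℚ_[p]} {M I : Matrix (Fin 5) (Fin 5) ℚ_[p]} {c : ℚ_[p]}

theorem mul_eq' (h : IsSplitBasis v M I c) : I * M = 1 := mul_eq_one_comm.1 h.mul_eq

theorem gram_last' (h : IsSplitBasis v M I c) (i : Fin 4) :
    (I * Iᵀ) (Fin.last 4) i.castSucc = 0 := by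
  rw [IsAdaptedBasis.gram_apply_comm, h.gram_last]

theorem vecMul_eq (h : IsSplitBasis v M I c) :
    v ᵥ* M = (v ᵥ* M) (Fin.last 4) • Pi.single (Fin.last 4) 1 := by
  ext i
  refine Fin.lastCases ?_ (fun i => ?_) i
  · simp
  · rw [h.coord, Pi.smul_apply, Pi.single_eq_of_ne (Fin.castSucc_ne_last i), smul_zero]

theorem gram_apply (h : IsSplitBasis v M I c) (i j : Fin 4) :
    (I * Iᵀ) i.castSucc j.castSucc = c * form22 ℚ_[p] i j := congrFun (congrFun h.gram i) j

theorem blockEmbed_mul_gram (h : IsSplitBasis v M I c) {s : SLd 4 ℚ_[p]}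
    (hs : s ∈ SOForm (form22 ℚ_[p])) :
    (blockEmbed 4 _ s).1 * (I * Iᵀ) * (blockEmbed 4 _ s).1ᵀ = I * Iᵀ := by
  have hs' : s.1 * (c • form22 ℚ_[p]) * s.1ᵀ = c • form22 ℚ_[p] := by
    rw [Matrix.mul_smul, Matrix.smul_mul]
    exact congrArg _ hs
  ext i j
  refine Fin.lastCases ?_ (fun i => ?_) i <;> refine Fin.lastCases ?_ (fun j => ?_) j
  · simp only [Matrix.mul_apply (M := (blockEmbed 4 ℚ_[p] s).1),
      Matrix.mul_apply (N := (blockEmbed 4 ℚ_[p] s).1ᵀ), Fin.sum_univ_castSucc, transpose_apply,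
      blockEmbed_last_castSucc, blockEmbed_last_last, mul_zero, zero_mul, zero_add,
      Finset.sum_const_zero, mul_one, one_mul]
  · simp only [Matrix.mul_apply (M := (blockEmbed 4 ℚ_[p] s).1),
      Matrix.mul_apply (N := (blockEmbed 4 ℚ_[p] s).1ᵀ), Fin.sum_univ_castSucc, transpose_apply,
      blockEmbed_last_castSucc, blockEmbed_last_last, blockEmbed_castSucc_last, h.gram_last',
      mul_zero, zero_mul, zero_add, Finset.sum_const_zero]
  · simp only [Matrix.mul_apply (M := (blockEmbed 4 ℚ_[p] s).1),
      Matrix.mul_apply (N := (blockEmbed 4 ℚ_[p] s).1ᵀ), Fin.sum_univ_castSucc, transpose_apply,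
      blockEmbed_last_castSucc, blockEmbed_last_last, blockEmbed_castSucc_last, h.gram_last,
      mul_zero, zero_mul, zero_add, Finset.sum_const_zero]
  · rw [← submatrix_apply (I * Iᵀ) Fin.castSucc Fin.castSucc i j, h.gram, ← hs', ← h.gram]
    simp only [Matrix.mul_apply (M := (blockEmbed 4 ℚ_[p] s).1), Matrix.mul_apply (M := s.1),
      Matrix.mul_apply (N := (blockEmbed 4 ℚ_[p] s).1ᵀ), Matrix.mul_apply (N := s.1ᵀ),
      Fin.sum_univ_castSucc, transpose_apply, blockEmbed_castSucc_castSucc,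
      blockEmbed_castSucc_last, submatrix_apply, mul_zero, zero_mul, add_zero]

theorem vecMul_blockEmbed (h : IsSplitBasis v M I c) (s : SLd 4 ℚ_[p]) :
    v ᵥ* M ᵥ* (blockEmbed 4 _ s).1 = v ᵥ* M := by
  rw [h.vecMul_eq, smul_vecMul, single_one_vecMul]
  congr 1
  ext i
  refine Fin.lastCases ?_ (fun i => ?_) i
  · rw [Pi.single_eq_same]
    exact blockEmbed_last_last s
  · rw [Pi.single_eq_of_ne (Fin.castSucc_ne_last i)]
    exact blockEmbed_last_castSucc s i

end IsSplitBasis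

variable {v : Fin 5 → ℤ} {M I : Matrix (Fin 5) (Fin 5) ℚ_[p]} {c : ℚ_[p]}

namespace IsSplitBasis

theorem exists_stabSO (h : IsSplitBasis (fun i => (v i : ℚ_[p])) M I c) {s : SLd 4 ℚ_[p]}
    (hs : s ∈ SOForm (form22 ℚ_[p])) :
    ∃ g ∈ stabSO ℚ_[p] v, g.1 = M * (blockEmbed 4 _ s).1 * I := by
  refine ⟨⟨M * (blockEmbed 4 _ s).1 * I, ?_⟩, ⟨mem_SOd_iff.2 ?_, ?_⟩, rfl⟩
  · rw [det_mul, det_mul, (blockEmbed 4 ℚ_[p] s).2, _root_.mul_one, ← det_mul, h.mul_eq, det_one]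
  · calc M * (blockEmbed 4 _ s).1 * I * (M * (blockEmbed 4 _ s).1 * I)ᵀ
        = M * ((blockEmbed 4 _ s).1 * (I * Iᵀ) * (blockEmbed 4 _ s).1ᵀ) * Mᵀ := by
          rw [transpose_mul, transpose_mul]; simp only [Matrix.mul_assoc]
      _ = (M * I) * (M * I)ᵀ := by
          rw [h.blockEmbed_mul_gram hs, transpose_mul]; simp only [Matrix.mul_assoc]
      _ = 1 := by rw [h.mul_eq, transpose_one, Matrix.mul_one]
  · change _ ᵥ* (M * (blockEmbed 4 _ s).1 * I) = _
    rw [← vecMul_vecMul, ← vecMul_vecMul, h.vecMul_blockEmbed, vecMul_vecMul, h.mul_eq, vecMul_one]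

/-- Although the basis comes from the groups generated by unipotents, it describes the whole
stabilizer: an isometry fixing `v` fixes the last basis vector and preserves its orthogonal
complement. -/
theorem exists_blockEmbed (h : IsSplitBasis (fun i => (v i : ℚ_[p])) M I c)
    {g : SLd 5 ℚ_[p]} (hg : g ∈ stabSO ℚ_[p] v) :
    ∃ s ∈ SOForm (form22 ℚ_[p]), (blockEmbed 4 _ s).1 = I * g.1 * M := by
  obtain ⟨hgO, hgv⟩ := hg
  have hcan : I * g.1 * M * I = I * g.1 := by rw [Matrix.mul_assoc, h.mul_eq, Matrix.mul_one]
  have hQ : I * g.1 * M * (I * Iᵀ) * (I * g.1 * M)ᵀ = I * Iᵀ := by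
    calc I * g.1 * M * (I * Iᵀ) * (I * g.1 * M)ᵀ
        = (I * g.1 * M * I) * (I * g.1 * M * I)ᵀ := by
          simp only [transpose_mul, Matrix.mul_assoc]
      _ = I * (g.1 * g.1ᵀ) * Iᵀ := by rw [hcan, transpose_mul]; simp only [Matrix.mul_assoc]
      _ = I * Iᵀ := by rw [SOd.mul_transpose hgO, Matrix.mul_one]
  have hrow : (I * g.1 * M) (Fin.last 4) = Pi.single (Fin.last 4) 1 := by
    have h1 : (fun i => (v i : ℚ_[p])) ᵥ* M ᵥ* (I * g.1 * M) = (fun i => (v i : ℚ_[p])) ᵥ* M := by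
      rw [vecMul_vecMul, ← Matrix.mul_assoc, ← Matrix.mul_assoc, h.mul_eq, Matrix.one_mul,
        ← vecMul_vecMul, hgv]
    rw [h.vecMul_eq, smul_vecMul, single_one_vecMul] at h1
    exact smul_right_injective _ h.coord_last h1
  have hcol (i : Fin 4) : (I * g.1 * M) i.castSucc (Fin.last 4) = 0 := by
    have h1 := congrFun (congrFun hQ i.castSucc) (Fin.last 4)
    rw [h.gram_last, Matrix.mul_apply] at h1
    simp only [transpose_apply, hrow] at h1
    rw [Finset.sum_eq_single (Fin.last 4) (fun k _ hk => by rw [Pi.single_eq_of_ne hk, mul_zero])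
      (fun hk => absurd (Finset.mem_univ _) hk), Pi.single_eq_same, _root_.mul_one,
      Matrix.mul_apply, Fin.sum_univ_castSucc] at h1
    simp only [h.gram_last, mul_zero, Finset.sum_const_zero, zero_add] at h1
    exact (mul_eq_zero.1 h1).resolve_right h.last_ne
  have hdet : (I * g.1 * M).det = 1 := by
    rw [det_mul, det_mul, g.2, _root_.mul_one, ← det_mul, h.mul_eq', det_one]
  obtain ⟨s, -, hs⟩ := exists_eq_blockEmbed hdet hrow hcol
  refine ⟨s, ?_, hs⟩
  rw [← hs] at hQ
  change s.1 * form22 ℚ_[p] * s.1ᵀ = form22 ℚ_[p]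
  refine smul_right_injective _ h.c_ne ?_
  change c • (s.1 * form22 ℚ_[p] * s.1ᵀ) = c • form22 ℚ_[p]
  rw [← Matrix.smul_mul, ← Matrix.mul_smul, ← h.gram]
  ext i j
  have h1 := congrFun (congrFun hQ i.castSucc) j.castSucc
  rw [submatrix_apply, ← h1]
  simp only [Matrix.mul_apply (M := (blockEmbed 4 ℚ_[p] s).1), Matrix.mul_apply (M := s.1),
    Matrix.mul_apply (N := (blockEmbed 4 ℚ_[p] s).1ᵀ), Matrix.mul_apply (N := s.1ᵀ),
    Fin.sum_univ_castSucc, transpose_apply, blockEmbed_castSucc_castSucc,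
    blockEmbed_castSucc_last, submatrix_apply, mul_zero, zero_mul, add_zero]

/-- The coordinates of a vector orthogonal to `v` that is fixed by an isometry. -/
theorem exists_fixed_coordinates (h : IsSplitBasis (fun i => (v i : ℚ_[p])) M I c)
    {g : SLd 5 ℚ_[p]} {s : SLd 4 ℚ_[p]} (hs : (blockEmbed 4 _ s).1 = I * g.1 * M)
    {u : Fin 5 → ℚ_[p]} (huv : u ⬝ᵥ (fun i => (v i : ℚ_[p])) = 0) (huu : u ⬝ᵥ u ≠ 0)
    (hu : u ᵥ* g.1 = u) :
    ∃ x : Fin 4 → ℚ_[p], x ᵥ* s.1 = x ∧ x ⬝ᵥ form22 ℚ_[p] *ᵥ x ≠ 0 := by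
  set u' := u ᵥ* M with hu'
  have hu'I : u = u' ᵥ* I := by rw [hu', vecMul_vecMul, h.mul_eq, vecMul_one]
  have hu's : u' ᵥ* (blockEmbed 4 _ s).1 = u' := by
    rw [hs, hu', vecMul_vecMul, ← Matrix.mul_assoc, ← Matrix.mul_assoc, h.mul_eq, Matrix.one_mul,
      ← vecMul_vecMul, hu]
  have hdot (z : Fin 5 → ℚ_[p]) : u ⬝ᵥ (z ᵥ* I) = u' ⬝ᵥ (I * Iᵀ) *ᵥ z := by
    rw [hu'I, ← mulVec_transpose I z, dotProduct_mulVec, dotProduct_mulVec, vecMul_vecMul]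
  -- Orthogonality to `v` is orthogonality to the last basis vector, which is anisotropic.
  have hlast : u' (Fin.last 4) = 0 := by
    have hv : (fun i => (v i : ℚ_[p])) = (fun i => (v i : ℚ_[p])) ᵥ* M ᵥ* I := by
      rw [vecMul_vecMul, h.mul_eq, vecMul_one]
    rw [hv, hdot, h.vecMul_eq, mulVec_smul, dotProduct_smul, mulVec_single_one] at huv
    have h1 := (smul_eq_zero.1 huv).resolve_left h.coord_last
    rw [dotProduct, Fin.sum_univ_castSucc] at h1
    simp only [col_apply, h.gram_last, mul_zero, Finset.sum_const_zero, zero_add] at h1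
    exact (mul_eq_zero.1 h1).resolve_right h.last_ne
  refine ⟨fun i => u' i.castSucc, ?_, fun h0 => huu ?_⟩
  · ext i
    have h1 := congrFun hu's i.castSucc
    rw [vecMul, dotProduct, Fin.sum_univ_castSucc, blockEmbed_last_castSucc, mul_zero,
      add_zero] at h1
    simp only [blockEmbed_castSucc_castSucc] at h1
    exact h1
  · have h1 := hdot u'
    rw [← hu'I] at h1
    rw [h1, dotProduct, Fin.sum_univ_castSucc, hlast, zero_mul, add_zero]
    have h2 (i : Fin 4) : ((I * Iᵀ) *ᵥ u') i.castSucc =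
        c * (form22 ℚ_[p] *ᵥ fun i => u' i.castSucc) i := by
      rw [mulVec, dotProduct, Fin.sum_univ_castSucc, hlast, mul_zero, add_zero, mulVec,
        dotProduct, Finset.mul_sum]
      exact Finset.sum_congr rfl fun j _ => by rw [h.gram_apply, mul_assoc]
    simp only [h2]
    rw [dotProduct] at h0
    rw [← mul_zero c, ← h0, Finset.mul_sum]
    exact Finset.sum_congr rfl fun j _ => by ring

end IsSplitBasis

end SplitBasis

/-! ### Left translates and their separation -/

section SplitTranslates

variable {p : ℕ} [hp : Fact p.Prime]

theorem normLe_leftMat {a : ℝ} (ha : 0 ≤ a) {α β γ δ : ℚ_[p]} (hα : ‖α‖ ≤ a) (hβ : ‖β‖ ≤ a)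
    (hγ : ‖γ‖ ≤ a) (hδ : ‖δ‖ ≤ a) : NormLe a (leftMat α β γ δ) := by
  intro i j
  fin_cases i <;> fin_cases j <;> simp [leftMat, *]

/-- The left multiplication by `diag (z⁻¹, z)` followed by the unipotent with parameter `t`. -/
noncomputable def splitTranslate {z : ℚ_[p]} (hz : z ≠ 0) (t : ℚ_[p]) : SLd 4 ℚ_[p] :=
  leftSL z⁻¹ (t * z⁻¹) 0 z (by rw [inv_mul_cancel₀ hz]; ring)

theorem coe_splitTranslate {z : ℚ_[p]} (hz : z ≠ 0) (t : ℚ_[p]) :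
    (splitTranslate hz t).1 = leftMat z⁻¹ (t * z⁻¹) 0 z := rfl

theorem rightMat_mul_splitTranslate {z : ℚ_[p]} (hz : z ≠ 0) (t : ℚ_[p]) (r : Fin 3 → ℚ_[p]) :
    rightMat r * (splitTranslate hz t).1 = (splitTranslate hz t).1 * rightMat r := by
  rw [coe_splitTranslate, rightMat_mul_leftMat]

theorem coe_splitTranslate_inv {z : ℚ_[p]} (hz : z ≠ 0) (t : ℚ_[p]) :
    ((splitTranslate hz t)⁻¹).1 = leftMat z (-(t * z⁻¹)) 0 z⁻¹ := by
  have h : leftMat z (-(t * z⁻¹)) 0 z⁻¹ * (splitTranslate hz t).1 = 1 := by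
    rw [coe_splitTranslate, leftMat_mul]
    ext i j
    fin_cases i <;> fin_cases j <;> simp [leftMat, hz, mul_comm]
  have h1 : (splitTranslate hz t).1 * ((splitTranslate hz t)⁻¹).1 = 1 :=
    congrArg Subtype.val (mul_inv_cancel (splitTranslate hz t))
  rw [← Matrix.mul_one (leftMat z (-(t * z⁻¹)) 0 z⁻¹), ← h1, ← Matrix.mul_assoc, h, Matrix.one_mul]

theorem splitTranslate_mem {z : ℚ_[p]} (hz : z ≠ 0) (t : ℚ_[p]) :
    splitTranslate hz t ∈ SOForm (form22 ℚ_[p]) := leftSL_mem _ _ _ _ _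

theorem normLe_splitTranslate {z : ℚ_[p]} (hz : z ≠ 0) (hz1 : ‖z‖ ≤ 1) {t : ℚ_[p]}
    (ht : ‖t‖ ≤ 1) : NormLe ‖z‖⁻¹ (splitTranslate hz t).1 := by
  have hpos : 0 < ‖z‖ := norm_pos_iff.2 hz
  have h1 : ‖z‖ ≤ ‖z‖⁻¹ := hz1.trans ((one_le_inv₀ hpos).2 hz1)
  rw [coe_splitTranslate]
  refine normLe_leftMat (inv_nonneg.2 hpos.le) (norm_inv z).le ?_ ?_ h1
  · rw [norm_mul, norm_inv]
    exact mul_le_of_le_one_left (inv_nonneg.2 hpos.le) ht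
  · rw [norm_zero]
    exact inv_nonneg.2 hpos.le

theorem normLe_splitTranslate_inv {z : ℚ_[p]} (hz : z ≠ 0) (hz1 : ‖z‖ ≤ 1) {t : ℚ_[p]}
    (ht : ‖t‖ ≤ 1) : NormLe ‖z‖⁻¹ ((splitTranslate hz t)⁻¹).1 := by
  have hpos : 0 < ‖z‖ := norm_pos_iff.2 hz
  have h1 : ‖z‖ ≤ ‖z‖⁻¹ := hz1.trans ((one_le_inv₀ hpos).2 hz1)
  rw [coe_splitTranslate_inv]
  refine normLe_leftMat (inv_nonneg.2 hpos.le) h1 ?_ ?_ (norm_inv z).le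
  · rw [norm_neg, norm_mul, norm_inv]
    exact mul_le_of_le_one_left (inv_nonneg.2 hpos.le) ht
  · rw [norm_zero]
    exact inv_nonneg.2 hpos.le

/-- The torus acts on the unipotent parameter through `z²`, so one entry of the quotient is `(t' -
t) z⁻²`. -/
theorem norm_sub_le_of_splitTranslate {z : ℚ_[p]} (hz : z ≠ 0) {t t' : ℚ_[p]}
    (h : NormLe 1 ((splitTranslate hz t)⁻¹ * splitTranslate hz t').1) : ‖t' - t‖ ≤ ‖z‖ ^ 2 := by
  have h1 : ((splitTranslate hz t)⁻¹ * splitTranslate hz t').1 1 2 = (t' - t) * (z ^ 2)⁻¹ := by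
    change (((splitTranslate hz t)⁻¹).1 * (splitTranslate hz t').1) 1 2 = _
    rw [coe_splitTranslate_inv, coe_splitTranslate, leftMat_mul]
    simp only [leftMat, Matrix.of_apply, Matrix.cons_val]
    field_simp
    ring
  have h2 := h 1 2
  rw [h1, norm_mul, norm_inv, norm_pow] at h2
  have hpos : 0 < ‖z‖ ^ 2 := pow_pos (norm_pos_iff.2 hz) 2
  rwa [← div_eq_mul_inv, div_le_one hpos] at h2

end SplitTranslates

/-! ### A single generator in the split case -/

section SplitCase

variable {p : ℕ} [hp : Fact p.Prime]

theorem exists_small_generator_of_split {v : Fin 5 → ℤ} {k : SLd 5 ℝ} (hadm : Admissible p v k)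
    {Θ : Set (SOd 5 ℝ)} (hΘ : IsOpen Θ) (hΘ1 : 1 ∈ Θ) {M I : Matrix (Fin 5) (Fin 5) ℚ_[p]}
    {c : ℚ_[p]} (hS : IsSplitBasis (fun i => (v i : ℚ_[p])) M I c) :
    ∃ γ : SLd 5 (ZInv p), (γ ∈ Gamma4 p 5 ∧ diagEmbed p 5 γ ∈ HvS p v) ∧
      fixedSpace p γ = lineOf v ∧ maxNorm (diagEmbed p 5 γ).1.1 ≤ 1 ∧
      maxNorm (diagEmbed p 5 γ).2.1 ≤ (p : ℝ) ^ 2 * V4 p v k Θ := by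
  have hodd : Odd p := Nat.odd_iff.2 (by have := hadm.p_mod; omega)
  have hp1 : (1 : ℝ) < p := by exact_mod_cast hp.out.one_lt
  have hp0 : (0 : ℝ) < p := one_pos.trans hp1
  have hv0 : v ⬝ᵥ v ≠ 0 := fun h => hadm.not_dvd (h ▸ dvd_zero _)
  -- Here `p ^ (2N) ≤ V₄ < p ^ (2N + 2)`. With `|z| = p ^ (-(N + 1))` the translates separate `p ^
  -- (2N + 2)` parameters, enough for a collision, and `γ` has size at most `|z|⁻² = p ^ (2N + 2) ≤
  -- p ^ 2 V₄`.
  obtain ⟨N, hN1, hN2⟩ := exists_nat_pow_near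
    (one_le_V4 (n := 4) (by norm_num) hadm hΘ hΘ1) (one_lt_pow₀ hp1 two_ne_zero)
  set z : ℚ_[p] := (p : ℚ_[p]) ^ (N + 1) with hzdef
  have hz : z ≠ 0 := pow_ne_zero _ (by exact_mod_cast hp.out.ne_zero)
  have hzn : ‖z‖ = ((p : ℝ) ^ (N + 1))⁻¹ := by rw [hzdef, norm_pow, Padic.norm_p, inv_pow]
  have hz1 : ‖z‖ ≤ 1 := by
    rw [hzn]
    exact inv_le_one_of_one_le₀ (one_le_pow₀ hp1.le)
  set P : Fin ((p ^ 2) ^ (N + 1)) → SLd 4 ℚ_[p] :=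
    fun t => splitTranslate hz ((t : ℕ) : ℤ) with hP
  have hint : ∀ t : Fin ((p ^ 2) ^ (N + 1)), ‖(((t : ℕ) : ℤ) : ℚ_[p])‖ ≤ 1 := fun t =>
    Padic.norm_int_le_one _
  choose g hg hgP using fun t => hS.exists_stabSO (splitTranslate_mem hz (((t : ℕ) : ℤ) : ℚ_[p]))
  obtain ⟨a, b, hab, γ, hγ, hγv, hk⟩ := exists_collision (n := 4) (by norm_num) hadm hΘ hΘ1
    (ι := Fin ((p ^ 2) ^ (N + 1))) (by rw [Fintype.card_fin]; exact_mod_cast hN2)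
    (fun t => g t) (fun t => hg t)
  set κ₅ : SLd 5 ℚ_[p] := (g a)⁻¹ * (diagEmbed p 5 γ).2 * g b with hκ₅
  have hIM := hS.mul_eq'
  have hgP' (t : Fin ((p ^ 2) ^ (N + 1))) : I * (g t).1 * M = (blockEmbed 4 _ (P t)).1 := by
    rw [hgP, ← Matrix.mul_assoc, ← Matrix.mul_assoc, hIM, Matrix.one_mul, Matrix.mul_assoc, hIM,
      Matrix.mul_one]
  have hconj (A B : Matrix (Fin 5) (Fin 5) ℚ_[p]) : (I * A * M) * (I * B * M) = I * (A * B) * M := by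
    calc (I * A * M) * (I * B * M) = I * A * (M * I) * B * M := by simp only [Matrix.mul_assoc]
      _ = I * (A * B) * M := by rw [hS.mul_eq, Matrix.mul_one, Matrix.mul_assoc I]
  have htrI (A : Matrix (Fin 5) (Fin 5) ℚ_[p]) : (I * A * M).trace = A.trace := by
    rw [trace_mul_comm, ← Matrix.mul_assoc, hS.mul_eq, Matrix.one_mul]
  obtain ⟨s, hsJ, hs⟩ := hS.exists_blockEmbed hγv.2
  obtain ⟨κ, hκJ, hκ⟩ := hS.exists_blockEmbed
    (mul_mem (mul_mem (inv_mem (hg a)) hγv.2) (hg b) : κ₅ ∈ stabSO ℚ_[p] v)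
  have hκi : NormLe 1 κ.1 := fun i j => by
    rw [← blockEmbed_castSucc_castSucc, hκ]
    exact (hS.int_I.mul_one hk).mul_one hS.int_M _ _
  have hsκ : s * P b = P a * κ := by
    apply blockEmbed_injective
    apply Subtype.ext
    rw [map_mul, map_mul]
    change (blockEmbed 4 _ s).1 * (blockEmbed 4 _ (P b)).1 =
      (blockEmbed 4 _ (P a)).1 * (blockEmbed 4 _ κ).1
    rw [hs, hκ, ← hgP', ← hgP', hconj, hconj]
    have h1 : (diagEmbed p 5 γ).2 * g b = g a * κ₅ := by rw [hκ₅]; group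
    have h2 : (diagEmbed p 5 γ).2.1 * (g b).1 = (g a).1 * κ₅.1 := congrArg Subtype.val h1
    rw [h2]
  refine ⟨γ, ⟨hγ, hγv⟩, le_antisymm (fun w hw => ?_) (lineOf_le_fixedSpace hγv),
    maxNorm_le (SOd.abs_le_one hγv.1.1), maxNorm_le ?_⟩
  · by_contra hwv
    obtain ⟨u, -, -, huv, huu, huγ⟩ := exists_orthogonal_intVec (p := p) hv0 hwv
    obtain ⟨x, hx, hxx⟩ := hS.exists_fixed_coordinates hs huv huu (huγ γ hγv hw)
    -- A fixed vector outside the line of `v` makes the trace of the square integral, so `γ` is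
    -- trivial. The two colliding translates then differ by an integral matrix, against the
    -- separation of their parameters.
    have htr := norm_trace_mul_self_le hκJ hκi
      (rightMat_mul_splitTranslate hz _) (rightMat_mul_splitTranslate hz _) hsκ hx hxx
    have htr' : ‖((diagEmbed p 5 γ).2.1 * (diagEmbed p 5 γ).2.1).trace‖ ≤ 1 := by
      have h1 : ((diagEmbed p 5 γ).2.1 * (diagEmbed p 5 γ).2.1).trace = (s.1 * s.1).trace + 1 := by
        have h2 : (blockEmbed 4 _ (s * s)).1.trace = (s.1 * s.1).trace + 1 := trace_blockEmbed _
        rw [← h2, map_mul]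
        change _ = ((blockEmbed 4 _ s).1 * (blockEmbed 4 _ s).1).trace
        rw [hs, hconj]
        exact (htrI _).symm
      rw [h1]
      exact Padic.norm_add_le_of_le htr norm_one.le
    have hγ1 := Gamma4.eq_one_of_trace hodd (by norm_num) hγ htr'
    have hs1 : s = 1 := by
      apply blockEmbed_injective
      apply Subtype.ext
      rw [hs, hγ1, map_one, map_one]
      change I * 1 * M = 1
      rw [Matrix.mul_one, hIM]
    have hκP : κ = (P a)⁻¹ * P b := by
      rw [hs1, one_mul] at hsκ
      rw [hsκ, inv_mul_cancel_left]
    rw [hκP] at hκi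
    have h1 := norm_sub_le_of_splitTranslate hz hκi
    have h2 : ‖z‖ ^ 2 = (p : ℝ) ^ (-(((N + 1) * 2 : ℕ) : ℤ)) := by
      rw [hzn, inv_pow, ← pow_mul, _root_.zpow_neg, zpow_natCast]
    rw [h2, ← Int.cast_sub, Padic.norm_int_le_pow_iff_dvd] at h1
    have h3 : ((a : ℕ) : ℤ) ≡ ((b : ℕ) : ℤ) [ZMOD (((p ^ 2) ^ (N + 1) : ℕ) : ℤ)] := by
      have h4 : (p ^ 2) ^ (N + 1) = p ^ ((N + 1) * 2) := by ring
      rw [Nat.cast_inj.2 h4]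
      exact Int.modEq_iff_dvd.2 (by exact_mod_cast h1)
    exact hab (Fin.ext (Nat.ModEq.eq_of_lt_of_lt (Int.natCast_modEq_iff.1 h3) a.2 b.2))
  · have hzi : (0 : ℝ) ≤ ‖z‖⁻¹ := inv_nonneg.2 (norm_nonneg _)
    have hzi1 : (1 : ℝ) ≤ ‖z‖⁻¹ := (one_le_inv₀ (norm_pos_iff.2 hz)).2 hz1
    have hs1 : s = P a * κ * (P b)⁻¹ := eq_mul_inv_of_mul_eq hsκ
    have hs2 : s.1 = (P a).1 * κ.1 * ((P b)⁻¹).1 := congrArg Subtype.val hs1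
    have hsn : NormLe (‖z‖⁻¹ * ‖z‖⁻¹) s.1 := by
      have h1 := ((normLe_splitTranslate hz hz1 (hint a)).mul hzi zero_le_one hκi).mul
        (by rwa [_root_.mul_one]) hzi (normLe_splitTranslate_inv hz hz1 (hint b))
      rw [_root_.mul_one] at h1
      rwa [hs2]
    have hγM : (diagEmbed p 5 γ).2.1 = M * (blockEmbed 4 _ s).1 * I := by
      rw [hs]
      calc (diagEmbed p 5 γ).2.1 = (M * I) * (diagEmbed p 5 γ).2.1 * (M * I) := by
            rw [hS.mul_eq, Matrix.one_mul, Matrix.mul_one]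
        _ = _ := by simp only [Matrix.mul_assoc]
    have hb : ‖z‖⁻¹ * ‖z‖⁻¹ ≤ (p : ℝ) ^ 2 * V4 p v k Θ := by
      have h1 : ‖z‖⁻¹ * ‖z‖⁻¹ = (p : ℝ) ^ 2 * ((p : ℝ) ^ 2) ^ N := by
        rw [hzn, inv_inv]
        ring
      rw [h1]
      gcongr
    intro i j
    rw [hγM]
    have h1 := ((NormLe.mul zero_le_one (by positivity) hS.int_M
      (normLe_blockEmbed (one_le_mul_of_one_le_of_one_le hzi1 hzi1) hsn)).mul (by positivity)
      zero_le_one hS.int_I) i j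
    rw [_root_.one_mul, _root_.mul_one] at h1
    exact h1.trans hb

end SplitCase

theorem plusSubgroup_le {d : ℕ} {R : Type*} [CommRing R] (H : Subgroup (SLd d R)) :
    plusSubgroup H ≤ H := (Subgroup.closure_le H).2 fun _ h => h.1

theorem proposition6p1 :
    (∀ Θ : Set (SOd 4 ℝ), IsOpen Θ → 1 ∈ Θ → ∃ C : ℝ,
      ∀ (p : ℕ) [Fact p.Prime] (v : Fin 4 → ℤ) (k : SLd 4 ℝ), Admissible p v k →
        IsZpConj (stabSO ℚ_[p] v) ((SOForm (form21 ℚ_[p])).map (blockEmbed 3 ℚ_[p])) →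
        ∃ γ : Fin 2 → SLd 4 (ZInv p),
          (∀ i, γ i ∈ Gamma4 p 4 ∧ diagEmbed p 4 (γ i) ∈ HvS p v) ∧
          (⨅ i, fixedSpace p (γ i)) = lineOf v ∧
          ∀ i, maxNorm (diagEmbed p 4 (γ i)).1.1 ≤ C ∧
            maxNorm (diagEmbed p 4 (γ i)).2.1 ≤ (p : ℝ) ^ 4 * V4 p v k Θ ^ 2) ∧
    (∀ Θ : Set (SOd 5 ℝ), IsOpen Θ → 1 ∈ Θ → ∃ C : ℝ,
      ∀ (p : ℕ) [Fact p.Prime] (v : Fin 5 → ℤ) (k : SLd 5 ℝ), Admissible p v k →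
        (∀ η : ℤ_[p], IsUnit η → ¬ IsSquare η →
          IsZpConj (stabSO ℚ_[p] v)
            ((SOForm (form31 (η : ℚ_[p]))).map (blockEmbed 4 ℚ_[p])) →
          ∃ γ : Fin 3 → SLd 5 (ZInv p),
            (∀ i, γ i ∈ Gamma4 p 5 ∧ diagEmbed p 5 (γ i) ∈ HvS p v) ∧
            (⨅ i, fixedSpace p (γ i)) = lineOf v ∧
            ∀ i, maxNorm (diagEmbed p 5 (γ i)).1.1 ≤ C ∧
              maxNorm (diagEmbed p 5 (γ i)).2.1 ≤ (p : ℝ) ^ 4 * V4 p v k Θ ^ 2) ∧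
        (IsZpConj (plusSubgroup (stabSO ℚ_[p] v))
            ((plusSubgroup (SOForm (form22 ℚ_[p]))).map (blockEmbed 4 ℚ_[p])) →
          ∃ γ : SLd 5 (ZInv p),
            (γ ∈ Gamma4 p 5 ∧ diagEmbed p 5 γ ∈ HvS p v) ∧
            fixedSpace p γ = lineOf v ∧
            maxNorm (diagEmbed p 5 γ).1.1 ≤ C ∧
            maxNorm (diagEmbed p 5 γ).2.1 ≤ C * (p : ℝ) ^ 2 * V4 p v k Θ)) := by
  -- The constant 1 works throughout, as entries of real orthogonal matrices have absolute value at
  -- most 1.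
  refine ⟨fun Θ hΘ hΘ1 => ⟨1, ?_⟩, fun Θ hΘ hΘ1 => ⟨1, ?_⟩⟩
  · intro p _ v k hadm h
    rw [form21_eq_hypDiagonal] at h
    exact exists_generators_of_isZpConj_hypDiagonal (r := 1) (by norm_num) hadm hΘ hΘ1 rfl h
  · intro p _ v k hadm
    refine ⟨fun η _ _ h => ?_, fun h => ?_⟩
    · rw [form31_eq_hypDiagonal] at h
      exact exists_generators_of_isZpConj_hypDiagonal (r := 2) (by norm_num) hadm hΘ hΘ1 rfl h
    · have hv : v ≠ 0 := fun h => hadm.not_dvd (by rw [h, zero_dotProduct]; exact dvd_zero _)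
      obtain ⟨M, I, hMI⟩ := exists_isAdaptedBasis (plusSubgroup_le _) h
      rw [one_mul]
      exact exists_small_generator_of_split hadm hΘ hΘ1 (hMI.isSplitBasis (intCast_vec_ne_zero hv))
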